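/- \textbf{Setting.} Let $\mathcal X$ be a measurable space, $\mathcal Y$ a finite label set, $P_X$ a probability measure on $\mathcal X$, and let $\eta,\hat\eta$ be measurable maps from $\mathcal X$ to the probability vectors on $\mathcal Y$ (the true conditional label probabilities and a fixed classifier). Write $P_\eta=P_X\times\mathrm{Cat}(\eta(X))$ and $P_{\hat\eta}=P_X\times\mathrm{Cat}(\hat\eta(X))$ for the induced laws on $\mathcal X\times\mathcal Y$. Assume $P_{\hat\eta}\ll P_\eta$, with likelihood ratio $L(x,y)=\hat\eta_y(x)/\eta_y(x)$. For a score $h$ put $$\mathrm{AUC}(h)=\mathbb P\big(h(X,Y)<h(X',Y')\big)+\tfrac12\,\mathbb P\big(h(X,Y)=h(X',Y')\big),$$ where $(X,Y)\sim P_\eta$ and $(X',Y')\sim P_{\hat\eta}$ are independent, and let $\delta^*=\rho(P_\eta,P_{\hat\eta})=\mathrm{AUC}(L)-\tfrac12$. The data $\mathcal D_n$ are $n$ iid triplets $(X_i,Y_i,Y_i')$, where $X_i\sim P_X$ and, given $X_i$, $Y_i\sim\mathrm{Cat}(\eta(X_i))$ and $Y_i'\sim\mathrm{Cat}(\hat\eta(X_i))$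 are independent. A distinguisher procedure $\hat D$ maps a data set $\mathcal D$ of any size to a (jointly measurable) score $\hat g_{\mathcal D}:\mathcal X\times\mathcal Y\to[0,1]$; write $\hat g_N=\hat g_{\mathcal D_N}$. Set $$\phi(x,y;\mathcal D)=\mathbb P_{(X',Y')\sim P_{\hat\eta}}\big(\hat g_{\mathcal D}(x,y)<\hat g_{\mathcal D}(X',Y')\big),\qquad \psi(x',y';\mathcal D)=\mathbb P_{(X,Y)\sim P_{\eta}}\big(\hat g_{\mathcal D}(X,Y)<\hat g_{\mathcal D}(x',y')\big).$$ Fix $K\ge2$. For $n=Km$, split $\{1,\dots,n\}$ into $K$ folds $I_1,\dots,I_K$ of size $n_k=m$, let $\mathcal D_{n,-k}$ be the data outside fold $k$, $\hat g_{n,-k}=\hat g_{\mathcal D_{n,-k}}$ and $\hat L_{n,-k}=\hat g_{n,-k}/(1-\hat g_{n,-k})$. Define $$T_{n,-k}=\frac1{n_k^2}\sum_{i,j\in I_k}\mathbf 1\{\hat g_{n,-k}(X_i,Y_i)<\hat g_{n,-k}(X_j,Y_j')\},\qquad T_{n,cross}=\frac1K\sum_{k=1}^K T_{n,-k},$$ $$\hat\phi_k(x,y)=\frac1{n_k}\sum_{i\in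 I_k}\mathbf 1\{\hat g_{n,-k}(x,y)<\hat g_{n,-k}(X_i,Y_i')\},\qquad \hat\psi_k(x',y')=\frac1{n_k}\sum_{i\in I_k}\mathbf 1\{\hat g_{n,-k}(X_i,Y_i)<\hat g_{n,-k}(x',y')\},$$ $$\hat\sigma^2_{tr,cross}=\frac1K\sum_{k=1}^K\frac1{n_k-1}\sum_{i\in I_k}\big(\hat\phi_k(X_i,Y_i)+\hat\psi_k(X_i,Y_i')-2T_{n,-k}\big)^2.$$ \textbf{Cross-fit conditions.} With $(X,Y)\sim P_\eta$ and $(X',Y')\sim P_{\hat\eta}$ independent of the data: \begin{enumerate} \item There is $B>0$ such that for all sufficiently large $N$ and every data set of size $N$, the score $\hat g$ fitted on it is such that $\hat g(X,Y)$ and $\hat g(X',Y')$ have Lebesgue densities bounded by $B$. \item There is $\beta>0$ such that for all sufficiently large $N$ and all $i\le N$, each of $Z=\nabla_i\hat g_N(X,Y)$ and $Z=\nabla_i\hat g_N(X',Y')$ satisfies $\mathbb P(|Z|\ge t)\le 2\exp(-(t/\kappa_N)^{1/\beta})$ for all $t\ge0$, where $\kappa_N=\log(N)^{-\beta}N^{-1/2}$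 and $\nabla_i\hat g_N$ is the change of $\hat g_N$ when the $i$-th triplet of $\mathcal D_N$ is replaced by an independent copy. \item There is $c>0$ such that, for all sufficiently large $m$ and $N=(K-1)m=n-n/K$, one has $\sigma^2_{tr,cross}=\mathrm{Var}\big(\mathbb E[\phi(X,Y;\mathcal D_N)+\psi(X,Y';\mathcal D_N)\mid X,Y,Y']\big)>c$, where $(X,Y,Y')$ is a triplet independent of $\mathcal D_N$. \end{enumerate} \textbf{Statement.} Assume the cross-fit conditions. Let $r_n\ge0$ be such that for each $k$, $\mathbb P\big(\|\hat L_{n,-k}-L\|_{L_1(P_\eta)}>r_n\big)\to0$, and let $\delta_n$ be real numbers with $\delta^*-\delta_n-2r_n=\omega(1/\sqrt n)$, that is, $\sqrt n\,(\delta^*-\delta_n-2r_n)\to+\infty$. Then, as $n=Km\to\infty$, $$\frac{\sqrt n}{\hat\sigma_{tr,cross}}\Big(T_{n,cross}-\delta_n-\frac12\Big)\to+\infty\quad\text{in probability},$$ i.e. for every $M\in\mathbb R$ the probability that the left side exceeds $M$ tends to $1$. Consequently, for every $\alpha\in(0,1)$ the rejection rate $\mathbb P\Big(\frac{\sqrt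 n}{\hat\sigma_{tr,cross}}\big(T_{n,cross}-\delta_n-\frac12\big)>z_{1-\alpha}\Big)$ tends to $1$, where $z_{1-\alpha}$ is the standard normal $(1-\alpha)$-quantile. -/

import Mathlib

open MeasureTheory ProbabilityTheory Filter Topology

noncomputable section

namespace ClassifierTest

/- Throughout, `𝒳` is the feature space, `𝒴` the (finite) label set, and a probabilistic classifier
is a Markov kernel `η : Kernel 𝒳 𝒴`: `Cat(η(x))` is the measure `η x`, and `(η x).real {y}` is the
probability of the label `y` at the feature `x`. -/

/-- One observation `(X, Y, Y')`: a feature, its true label, and a label generated by the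
classifier under evaluation. -/
abbrev Triple (𝒳 𝒴 : Type*) := 𝒳 × 𝒴 × 𝒴

section Population

variable {𝒳 𝒴 : Type*} [MeasurableSpace 𝒳] [MeasurableSpace 𝒴]

/-- `P_η = P_X × Cat(η(X))`, the law of `(X, Y)`. -/
def jointLaw (PX : Measure 𝒳) (η : Kernel 𝒳 𝒴) : Measure (𝒳 × 𝒴) := PX ⊗ₘ η

/-- `P_X × Cat(η(X)) × Cat(η̂(X))`, the law of `(X, Y, Y')`, where `Y` and `Y'` are conditionally
independent given `X`. -/
def tripleLaw (PX : Measure 𝒳) (η ηhat : Kernel 𝒳 𝒴) : Measure (Triple 𝒳 𝒴) :=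
  PX ⊗ₘ (η ×ₖ ηhat)

/-- The law of a data set of `n` iid triplets. -/
def dataLaw (PX : Measure 𝒳) (η ηhat : Kernel 𝒳 𝒴) (n : ℕ) : Measure (Fin n → Triple 𝒳 𝒴) :=
  Measure.pi fun _ => tripleLaw PX η ηhat

/-- The likelihood ratio of `P_η̂` with respect to `P_η`: `L(x, y) = η̂_y(x) / η_y(x)`. -/
def likelihoodRatio (η ηhat : Kernel 𝒳 𝒴) (w : 𝒳 × 𝒴) : ℝ :=
  (ηhat w.1).real {w.2} / (η w.1).real {w.2}

/-- The area under the ROC curve of a score `h`: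
`P(h(X, Y) < h(X', Y')) + P(h(X, Y) = h(X', Y')) / 2` for independent `(X, Y) ∼ P_η` and
`(X', Y') ∼ P_η̂`. -/
def auc (PX : Measure 𝒳) (η ηhat : Kernel 𝒳 𝒴) (h : 𝒳 × 𝒴 → ℝ) : ℝ :=
  ((jointLaw PX η).prod (jointLaw PX ηhat)).real {p | h p.1 < h p.2} +
    ((jointLaw PX η).prod (jointLaw PX ηhat)).real {p | h p.1 = h p.2} / 2

/-- The separation `ρ(P_η, P_η̂) = AUC(L) - 1/2`. -/
def separation (PX : Measure 𝒳) (η ηhat : Kernel 𝒳 𝒴) : ℝ :=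
  auc PX η ηhat (likelihoodRatio η ηhat) - 1 / 2

end Population

/-- A distinguisher procedure: it turns a data set of any size into a `[0, 1]`-valued score
`ĝ_d(x, y)`, the estimated probability that `(x, y)` comes from `P_η̂` and not from `P_η`. -/
structure DistinguisherProcedure (𝒳 𝒴 : Type*) [MeasurableSpace 𝒳] [MeasurableSpace 𝒴] where
  /-- the fitted score -/
  fit : (N : ℕ) → (Fin N → Triple 𝒳 𝒴) → 𝒳 × 𝒴 → ℝ
  measurable_fit : ∀ N, Measurable fun p : (Fin N → Triple 𝒳 𝒴) × (𝒳 × 𝒴) => fit N p.1 p.2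
  fit_mem : ∀ N d w, fit N d w ∈ Set.Icc (0 : ℝ) 1

/-- The likelihood ratio transformation `ĝ / (1 - ĝ)` of a score. -/
def ratioTransform {𝒳 𝒴 : Type*} (g : 𝒳 × 𝒴 → ℝ) (w : 𝒳 × 𝒴) : ℝ := g w / (1 - g w)

/-- The real-valued random variable `W` has a Lebesgue density that is bounded by `B`. -/
def HasDensityBoundedBy {S : Type*} [MeasurableSpace S] (ν : Measure S) (W : S → ℝ) (B : ℝ) :
    Prop :=
  ∃ f : ℝ → ENNReal, Measurable f ∧ (∀ t, f t ≤ ENNReal.ofReal B) ∧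
    ν.map W = volume.withDensity f

/-- `W` is `(κ, β)` sub-Weibull: `P(|W| ≥ t) ≤ 2 exp(-(t / κ) ^ (1 / β))` for all `t ≥ 0`. -/
def IsSubWeibull {S : Type*} [MeasurableSpace S] (ν : Measure S) (W : S → ℝ) (κ β : ℝ) : Prop :=
  ∀ t : ℝ, 0 ≤ t → ν {s | t ≤ |W s|} ≤ ENNReal.ofReal (2 * Real.exp (-(t / κ) ^ (1 / β)))

section Assumption

variable {𝒳 𝒴 : Type*} [MeasurableSpace 𝒳] [MeasurableSpace 𝒴]

/-- The projection `φ(x, y; d) = P(ĝ_d(x, y) < ĝ_d(X', Y'))`, `(X', Y') ∼ P_η̂`. -/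
def proj₁ (PX : Measure 𝒳) (ηhat : Kernel 𝒳 𝒴) (g : 𝒳 × 𝒴 → ℝ) (w : 𝒳 × 𝒴) : ℝ :=
  (jointLaw PX ηhat).real {v | g w < g v}

/-- The projection `ψ(x', y'; d) = P(ĝ_d(X, Y) < ĝ_d(x', y'))`, `(X, Y) ∼ P_η`. -/
def proj₂ (PX : Measure 𝒳) (η : Kernel 𝒳 𝒴) (g : 𝒳 × 𝒴 → ℝ) (v : 𝒳 × 𝒴) : ℝ :=
  (jointLaw PX η).real {w | g w < g v}

/-- `Var(E[φ(X, Y; D_N) + ψ(X, Y'; D_N) | X, Y, Y'])` for a fitting sample `D_N` of size `N`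
that is independent of `(X, Y, Y')`. -/
def projVariance (PX : Measure 𝒳) (η ηhat : Kernel 𝒳 𝒴) (A : DistinguisherProcedure 𝒳 𝒴) (N : ℕ) :
    ℝ :=
  variance
    (fun z : Triple 𝒳 𝒴 =>
      ∫ d, (proj₁ PX ηhat (A.fit N d) (z.1, z.2.1) + proj₂ PX η (A.fit N d) (z.1, z.2.2))
        ∂(dataLaw PX η ηhat N))
    (tripleLaw PX η ηhat)

/-- The perturb-one difference `∇_i ĝ_N(w)`, as a function of the data set `p.1`, of the
replacement `p.2.1` of its `i`-th sample, and of the evaluation point `w = p.2.2`. -/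
def perturbOne (A : DistinguisherProcedure 𝒳 𝒴) (N : ℕ) (i : Fin N)
    (p : (Fin N → Triple 𝒳 𝒴) × Triple 𝒳 𝒴 × (𝒳 × 𝒴)) : ℝ :=
  A.fit N p.1 p.2.2 - A.fit N (Function.update p.1 i p.2.1) p.2.2

/-- The cross-fit conditions, with `K` folds of size `m`, so that the fitting sample size is
`n - n / K = (K - 1) * m`. -/
structure CrossFitConditions (PX : Measure 𝒳) (η ηhat : Kernel 𝒳 𝒴)
    (A : DistinguisherProcedure 𝒳 𝒴) (K : ℕ) : Prop where
  /-- `ĝ_N(X, Y)` and `ĝ_N(X', Y')` have densities bounded by `B`, for any data set. -/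
  density : ∃ B : ℝ, 0 < B ∧ ∀ᶠ N in atTop, ∀ d : Fin N → Triple 𝒳 𝒴,
    HasDensityBoundedBy (jointLaw PX η) (A.fit N d) B ∧
      HasDensityBoundedBy (jointLaw PX ηhat) (A.fit N d) B
  /-- `∇_i ĝ_N(X, Y)` and `∇_i ĝ_N(X', Y')` are `(log(N)^{-β} N^{-1/2}, β)` sub-Weibull. -/
  stability : ∃ β : ℝ, 0 < β ∧ ∀ᶠ N : ℕ in atTop, ∀ i : Fin N,
    IsSubWeibull ((dataLaw PX η ηhat N).prod ((tripleLaw PX η ηhat).prod (jointLaw PX η)))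
        (perturbOne A N i) (Real.log N ^ (-β) * (N : ℝ) ^ (-(1 / 2) : ℝ)) β ∧
      IsSubWeibull ((dataLaw PX η ηhat N).prod ((tripleLaw PX η ηhat).prod (jointLaw PX ηhat)))
        (perturbOne A N i) (Real.log N ^ (-β) * (N : ℝ) ^ (-(1 / 2) : ℝ)) β
  /-- `σ²_{tr,cross}` is bounded away from zero. -/
  variance_lower : ∃ c : ℝ, 0 < c ∧ ∀ᶠ m : ℕ in atTop, c < projVariance PX η ηhat A ((K - 1) * m)

end Assumption

section Statistic

variable {𝒳 𝒴 : Type*} [MeasurableSpace 𝒳] [MeasurableSpace 𝒴]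

/-- The sub-sample of `z` with indices in `s`, listed in increasing order. -/
def subsample {n : ℕ} {S : Type*} (z : Fin n → S) (s : Finset (Fin n)) : Fin s.card → S :=
  fun j => z (s.orderEmbOfFin rfl j)

/-- The index set `I_k` of the `k`-th fold, for an assignment of the `n` samples to `K` folds. -/
def foldSet {n K : ℕ} (fold : Fin n → Fin K) (k : Fin K) : Finset (Fin n) :=
  Finset.univ.filter fun i => fold i = k

/-- `ĝ_{n,-k}`: the distinguisher fitted on the data outside of the `k`-th fold. -/
def crossFit (A : DistinguisherProcedure 𝒳 𝒴) {n K : ℕ} (fold : Fin n → Fin K)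
    (z : Fin n → Triple 𝒳 𝒴) (k : Fin K) : 𝒳 × 𝒴 → ℝ :=
  A.fit (foldSet fold k)ᶜ.card (subsample z (foldSet fold k)ᶜ)

open Classical in
/-- The indicator of `g(w) < g(v)`. -/
def rankInd (g : 𝒳 × 𝒴 → ℝ) (w v : 𝒳 × 𝒴) : ℝ := if g w < g v then 1 else 0

/-- `(X_i, Y_i)` -/
def truePair (z : Triple 𝒳 𝒴) : 𝒳 × 𝒴 := (z.1, z.2.1)

/-- `(X_i, Y'_i)` -/
def modelPair (z : Triple 𝒳 𝒴) : 𝒳 × 𝒴 := (z.1, z.2.2)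

/-- `T_{n,-k} = n_k^{-2} ∑_{i,j ∈ I_k} R_{ij}(D_{n,-k})`, with
`R_{ij}(D_{n,-k})` the indicator of `ĝ_{n,-k}(X_i, Y_i) < ĝ_{n,-k}(X_j, Y'_j)`. -/
def foldStat (A : DistinguisherProcedure 𝒳 𝒴) {n K : ℕ} (fold : Fin n → Fin K)
    (z : Fin n → Triple 𝒳 𝒴) (k : Fin K) : ℝ :=
  1 / ((foldSet fold k).card : ℝ) ^ 2 *
    ∑ i ∈ foldSet fold k, ∑ j ∈ foldSet fold k,
      rankInd (crossFit A fold z k) (truePair (z i)) (modelPair (z j))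

/-- `T_{n,cross}` -/
def crossStat (A : DistinguisherProcedure 𝒳 𝒴) {n K : ℕ} (fold : Fin n → Fin K)
    (z : Fin n → Triple 𝒳 𝒴) : ℝ :=
  1 / (K : ℝ) * ∑ k, foldStat A fold z k

/-- The empirical projection `φ̂(w; D_{n,-k})`. -/
def empProj₁ (A : DistinguisherProcedure 𝒳 𝒴) {n K : ℕ} (fold : Fin n → Fin K)
    (z : Fin n → Triple 𝒳 𝒴) (k : Fin K) (w : 𝒳 × 𝒴) : ℝ :=
  1 / ((foldSet fold k).card : ℝ) *
    ∑ i ∈ foldSet fold k, rankInd (crossFit A fold z k) w (modelPair (z i))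

/-- The empirical projection `ψ̂(v; D_{n,-k})`. -/
def empProj₂ (A : DistinguisherProcedure 𝒳 𝒴) {n K : ℕ} (fold : Fin n → Fin K)
    (z : Fin n → Triple 𝒳 𝒴) (k : Fin K) (v : 𝒳 × 𝒴) : ℝ :=
  1 / ((foldSet fold k).card : ℝ) *
    ∑ i ∈ foldSet fold k, rankInd (crossFit A fold z k) (truePair (z i)) v

/-- The empirical variance `σ̂²_{n,-k}` of the `k`-th fold. -/
def foldVar (A : DistinguisherProcedure 𝒳 𝒴) {n K : ℕ} (fold : Fin n → Fin K)
    (z : Fin n → Triple 𝒳 𝒴) (k : Fin K) : ℝ :=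
  1 / (((foldSet fold k).card : ℝ) - 1) *
    ∑ i ∈ foldSet fold k,
      (empProj₁ A fold z k (truePair (z i)) + empProj₂ A fold z k (modelPair (z i)) -
        2 * foldStat A fold z k) ^ 2

/-- `σ̂²_{tr,cross}` -/
def crossVar (A : DistinguisherProcedure 𝒳 𝒴) {n K : ℕ} (fold : Fin n → Fin K)
    (z : Fin n → Triple 𝒳 𝒴) : ℝ :=
  1 / (K : ℝ) * ∑ k, foldVar A fold z k

/-- The standardized cross-fit statistic `√n / σ̂_{tr,cross} * (T_{n,cross} - δ - 1/2)`. -/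
def standardizedStat (A : DistinguisherProcedure 𝒳 𝒴) {n K : ℕ} (fold : Fin n → Fin K) (δ : ℝ)
    (z : Fin n → Triple 𝒳 𝒴) : ℝ :=
  √(n : ℝ) / √(crossVar A fold z) * (crossStat A fold z - δ - 1 / 2)

end Statistic

/-- The `p`-quantile `z_p` of the standard normal distribution, `0 < p < 1`. -/
def normalQuantile (p : ℝ) : ℝ := sInf {x : ℝ | p ≤ cdf (gaussianReal 0 1) x}

end ClassifierTest

end

noncomputable section

namespace ClassifierTest

/-! ### Variance on product spaces: the Efron–Stein inequality and resampling of a coordinate -/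

section ProductTools

variable {S V : Type*} [MeasurableSpace S] [MeasurableSpace V]

/-! The numerator and the denominator need very different information. The empirical projections and
the rank statistics lie in fixed bounded intervals, so each fold variance is at most 8 once a fold
has two points. Hence no consistency of the variance estimate and no central limit theorem is
needed: a numerator of larger order than `1/√n` drives the ratio to infinity, unless the estimate is
exactly zero, where the convention `x / 0 = 0` would destroy the conclusion.

Numerator. Given the data outside fold k, the fold statistic is a V-statistic of an independent
sample. Its mean square error about θ = P(ĝ(X,Y) < ĝ(X',Y')) is at most 3/m
(`integral_kernelStat_sub_sq_le`). Bounded densities exclude ties, so θ = AUC(ĝ), and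
`separation_sub_le` gives AUC(L) − AUC(ĝ) ≤ ‖ĝ/(1−ĝ) − L‖₁. To see this, change measure so that both
points W, V are iid from P_η with weight L(V), and symmetrize. The loss becomes half the mean of
(L(V) − L(W)) times the difference of the two rank indicators. Since t/(1−t) is increasing, ĝ can
misorder a pair only if its errors at W and V add up to at least |L(V) − L(W)|.

Denominator. If a fold variance vanishes, all empirical projections in that fold equal twice the
fold statistic. They are close to the conditional projections, which in turn are close to their
average over the fitting sample. The empirical variance of the averaged projection would then be
near zero, although it concentrates at a value above c (`measureReal_degenerate_le`).

Closeness of the conditional projection to its average comes from `efron_stein` applied to the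
fitting sample. The effect of one replacement is bounded by `integral_rank_perturbation_sq_le`: an
order relation flips only for pairs whose scores are within the size of the perturbation, and
bounded densities make such pairs rare. With the sub-Weibull condition, the N replacements together
contribute O(log(N)^(−β) + 1/N). -/

theorem integrable_of_abs_le {μ : Measure S} [IsFiniteMeasure μ] {f : S → ℝ} (hf : Measurable f)
    {C : ℝ} (hC : ∀ x, |f x| ≤ C) : Integrable f μ :=
  Integrable.of_bound hf.aestronglyMeasurable C (ae_of_all _ hC)

theorem abs_integral_le_of_abs_le {μ : Measure S} [IsProbabilityMeasure μ] {f : S → ℝ}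
    {C : ℝ} (hC : ∀ x, |f x| ≤ C) : |∫ x, f x ∂μ| ≤ C := by
  have := norm_integral_le_of_norm_le_const (μ := μ) (f := f) (C := C) (ae_of_all _ hC)
  simpa using this

theorem integral_le_of_le {μ : Measure S} [IsProbabilityMeasure μ] {f : S → ℝ}
    (hf : Integrable f μ) {C : ℝ} (hC : ∀ x, f x ≤ C) : ∫ x, f x ∂μ ≤ C := by
  calc ∫ x, f x ∂μ ≤ ∫ _, C ∂μ := integral_mono hf (integrable_const C) hC
    _ = C := by simp

theorem measurable_integral_right {ν : Measure V} [SFinite ν] {f : S × V → ℝ}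
    (hf : Measurable f) : Measurable fun s => ∫ v, f (s, v) ∂ν :=
  (hf.stronglyMeasurable.integral_prod_right' (ν := ν)).measurable

theorem measurable_integral_left {μ : Measure S} [SFinite μ] {f : S × V → ℝ}
    (hf : Measurable f) : Measurable fun v => ∫ s, f (s, v) ∂μ :=
  (hf.stronglyMeasurable.integral_prod_left' (μ := μ)).measurable

theorem integral_integral_swap_of_abs_le {μ : Measure S} [IsFiniteMeasure μ]
    {ν : Measure V} [IsFiniteMeasure ν] {f : S × V → ℝ} (hf : Measurable f) {C : ℝ}
    (hC : ∀ x, |f x| ≤ C) :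
    ∫ s, ∫ v, f (s, v) ∂ν ∂μ = ∫ v, ∫ s, f (s, v) ∂μ ∂ν :=
  integral_integral_swap (f := fun s v => f (s, v)) (integrable_of_abs_le hf hC)

theorem sq_le_of_abs_le {a C : ℝ} (h : |a| ≤ C) : |a ^ 2| ≤ C ^ 2 := by
  rw [abs_pow]
  exact pow_le_pow_left₀ (abs_nonneg _) h 2

theorem abs_sub_le_two {a b C : ℝ} (ha : |a| ≤ C) (hb : |b| ≤ C) : |a - b| ≤ 2 * C := by
  have := abs_sub a b
  linarith

/-- The variance decomposition about an arbitrary point. -/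
theorem integral_sub_sq {μ : Measure S} [IsProbabilityMeasure μ] {h : S → ℝ} (hh : Measurable h)
    {C : ℝ} (hC : ∀ x, |h x| ≤ C) (a : ℝ) :
    ∫ s, (h s - a) ^ 2 ∂μ = ∫ s, (h s - ∫ t, h t ∂μ) ^ 2 ∂μ + (∫ t, h t ∂μ - a) ^ 2 := by
  have i1 : Integrable h μ := integrable_of_abs_le hh hC
  have i2 : Integrable (fun s => h s ^ 2) μ :=
    integrable_of_abs_le (hh.pow_const 2) fun x => sq_le_of_abs_le (hC x)
  have key : ∀ b : ℝ, ∫ s, (h s - b) ^ 2 ∂μ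
      = ∫ s, h s ^ 2 ∂μ - 2 * b * ∫ s, h s ∂μ + b ^ 2 := by
    intro b
    have : ∀ s, (h s - b) ^ 2 = h s ^ 2 - 2 * b * h s + b ^ 2 := fun s => by ring
    simp_rw [this]
    have i3 : Integrable (fun s => 2 * b * h s) μ := i1.const_mul _
    have i4 : Integrable (fun s => h s ^ 2 - 2 * b * h s) μ := i2.sub i3
    rw [integral_add i4 (integrable_const _), integral_sub i2 i3, integral_const_mul]
    simp
  rw [key, key]
  ring

theorem sq_integral_le {μ : Measure S} [IsProbabilityMeasure μ] {h : S → ℝ} (hh : Measurable h)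
    {C : ℝ} (hC : ∀ x, |h x| ≤ C) : (∫ s, h s ∂μ) ^ 2 ≤ ∫ s, h s ^ 2 ∂μ := by
  have := integral_sub_sq (μ := μ) hh hC 0
  simp only [sub_zero] at this
  rw [this]
  have : 0 ≤ ∫ s, (h s - ∫ t, h t ∂μ) ^ 2 ∂μ := integral_nonneg fun _ => sq_nonneg _
  linarith

/-- The resampling form of the variance, obtained by expanding the inner integral about the mean. It
produces the factor 1/2 in Efron–Stein. -/
theorem integral_sub_integral_sq {μ : Measure S} [IsProbabilityMeasure μ] {h : S → ℝ}
    (hh : Measurable h) {C : ℝ} (hC : ∀ x, |h x| ≤ C) :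
    ∫ s, (h s - ∫ t, h t ∂μ) ^ 2 ∂μ = 1 / 2 * ∫ s, ∫ t, (h s - h t) ^ 2 ∂μ ∂μ := by
  have e : ∀ s, ∫ t, (h s - h t) ^ 2 ∂μ
      = ∫ t, (h t - ∫ t, h t ∂μ) ^ 2 ∂μ + (h s - ∫ t, h t ∂μ) ^ 2 := by
    intro s
    have := integral_sub_sq (μ := μ) hh hC (h s)
    rw [show (h s - ∫ t, h t ∂μ) ^ 2 = (∫ t, h t ∂μ - h s) ^ 2 by ring, ← this]
    exact integral_congr_ae (ae_of_all _ fun t => by ring)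
  simp_rw [e]
  rw [integral_add (integrable_const _)]
  · simp
    ring
  · refine integrable_of_abs_le (C := (2 * C) ^ 2) ((hh.sub_const _).pow_const 2) fun x => ?_
    exact sq_le_of_abs_le (abs_sub_le_two (hC x) (abs_integral_le_of_abs_le hC))

/-- The law of total variance, conditioning on the second coordinate and with the conditional
variance in resampling form. It is the induction step of Efron–Stein. -/
theorem integral_sub_integral_sq_prod {μ : Measure S} [IsProbabilityMeasure μ] {ν : Measure V}
    [IsProbabilityMeasure ν] {f : S × V → ℝ} (hf : Measurable f) {C : ℝ} (hC : ∀ x, |f x| ≤ C) :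
    ∫ s, ∫ v, (f (s, v) - ∫ s', ∫ v', f (s', v') ∂ν ∂μ) ^ 2 ∂ν ∂μ =
      1 / 2 * ∫ s, ∫ v, ∫ t, (f (s, v) - f (t, v)) ^ 2 ∂μ ∂ν ∂μ +
      ∫ v, (∫ s, f (s, v) ∂μ - ∫ v', ∫ s, f (s, v') ∂μ ∂ν) ^ 2 ∂ν := by
  have hm := integral_integral_swap_of_abs_le (μ := μ) (ν := ν) hf hC
  set m := ∫ s', ∫ v', f (s', v') ∂ν ∂μ with hmdef
  rw [← hm]
  have hmC : |m| ≤ C :=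
    abs_integral_le_of_abs_le fun s => abs_integral_le_of_abs_le fun v => hC _
  have hsec : ∀ v, Measurable fun s => f (s, v) := fun v => hf.comp (by fun_prop)
  have ha : Measurable fun v => ∫ s, f (s, v) ∂μ := measurable_integral_left hf
  have haC : ∀ v, |∫ s, f (s, v) ∂μ| ≤ C := fun v => abs_integral_le_of_abs_le fun s => hC _
  have hq : Measurable fun p : (S × V) × S => (f p.1 - f (p.2, p.1.2)) ^ 2 :=
    ((hf.comp measurable_fst).sub (hf.comp (by fun_prop))).pow_const 2
  have hqC : ∀ p : (S × V) × S, |(f p.1 - f (p.2, p.1.2)) ^ 2| ≤ (2 * C) ^ 2 := fun p =>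
    sq_le_of_abs_le (abs_sub_le_two (hC _) (hC _))
  rw [integral_integral_swap_of_abs_le (f := fun p : S × V => (f p - m) ^ 2) (C := (2 * C) ^ 2)
      ((hf.sub_const _).pow_const 2) fun x => sq_le_of_abs_le (abs_sub_le_two (hC x) hmC),
    integral_integral_swap_of_abs_le
      (f := fun p : S × V => ∫ t, (f p - f (t, p.2)) ^ 2 ∂μ) (C := (2 * C) ^ 2)
      (measurable_integral_right hq) fun x => abs_integral_le_of_abs_le fun t => hqC (x, t)]
  simp only
  have e : ∀ v, ∫ s, (f (s, v) - m) ^ 2 ∂μ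
      = 1 / 2 * ∫ s, ∫ t, (f (s, v) - f (t, v)) ^ 2 ∂μ ∂μ + (∫ s, f (s, v) ∂μ - m) ^ 2 := by
    intro v
    rw [integral_sub_sq (hsec v) (fun s => hC (s, v)) m,
      integral_sub_integral_sq (hsec v) (fun s => hC (s, v))]
  simp_rw [e]
  rw [integral_add, integral_const_mul]
  · refine Integrable.const_mul ?_ _
    refine integrable_of_abs_le (C := (2 * C) ^ 2)
      (measurable_integral_left (f := fun p : S × V => ∫ t, (f p - f (t, p.2)) ^ 2 ∂μ)
        (measurable_integral_right hq)) fun v => ?_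
    exact abs_integral_le_of_abs_le fun s => abs_integral_le_of_abs_le fun t => hqC ((s, v), t)
  · exact integrable_of_abs_le (C := (2 * C) ^ 2) ((ha.sub_const _).pow_const 2)
      fun v => sq_le_of_abs_le (abs_sub_le_two (haC v) hmC)

theorem measurable_finCons {n : ℕ} :
    Measurable fun p : S × (Fin n → S) => (Fin.cons p.1 p.2 : Fin (n + 1) → S) := by
  refine measurable_pi_lambda _ fun i => ?_
  refine Fin.cases ?_ (fun j => ?_) i
  · simpa using measurable_fst
  · simpa using (measurable_snd (α := S) (β := Fin n → S)).eval

theorem measurable_update_pair {ι : Type*} [DecidableEq ι] (i : ι) :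
    Measurable fun p : (ι → S) × S => Function.update p.1 i p.2 := by
  refine measurable_pi_lambda _ fun j => ?_
  by_cases h : j = i
  · subst h
    simpa using measurable_snd
  · simpa [Function.update_of_ne h] using (measurable_fst (α := ι → S) (β := S)).eval

theorem integral_pi_finCons {μ : Measure S} [IsProbabilityMeasure μ] {n : ℕ}
    {G : (Fin (n + 1) → S) → ℝ} (hG : Measurable G) {C : ℝ} (hC : ∀ u, |G u| ≤ C) :
    ∫ u, G u ∂(Measure.pi fun _ => μ) =
      ∫ s, ∫ v, G (Fin.cons s v) ∂(Measure.pi fun _ : Fin n => μ) ∂μ := by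
  have h := (measurePreserving_piFinSuccAbove (fun _ : Fin (n + 1) => μ) 0).symm
  rw [← h.integral_comp (MeasurableEquiv.measurableEmbedding _), integral_prod]
  · simp [MeasurableEquiv.piFinSuccAbove, Fin.insertNthEquiv]
  · exact integrable_of_abs_le (hG.comp (MeasurableEquiv.measurable _)) fun u => hC _

/-- The Efron–Stein inequality. -/
theorem efron_stein {μ : Measure S} [IsProbabilityMeasure μ] {n : ℕ}
    {F : (Fin n → S) → ℝ} (hF : Measurable F) {C : ℝ} (hC : ∀ u, |F u| ≤ C) :
    ∫ u, (F u - ∫ u', F u' ∂(Measure.pi fun _ => μ)) ^ 2 ∂(Measure.pi fun _ => μ) ≤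
      1 / 2 * ∑ i, ∫ u, ∫ t, (F u - F (Function.update u i t)) ^ 2 ∂μ
        ∂(Measure.pi fun _ => μ) := by
  induction n with
  | zero =>
    have h : ∀ u, F u = F (fun i => i.elim0) := fun u => congrArg F (Subsingleton.elim _ _)
    have h2 : ∫ u', F u' ∂(Measure.pi fun _ => μ) = F (fun i => i.elim0) := by
      simp_rw [h]
      simp
    rw [h2]
    simp_rw [fun u => h u]
    simp
  | succ n ih =>
    set ν : Measure (Fin n → S) := Measure.pi fun _ => μ with hν
    have hFc : Measurable fun p : S × (Fin n → S) => F (Fin.cons p.1 p.2) :=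
      hF.comp measurable_finCons
    have hm : ∫ u', F u' ∂(Measure.pi fun _ => μ) = ∫ s, ∫ v, F (Fin.cons s v) ∂ν ∂μ :=
      integral_pi_finCons hF hC
    have hmC : |∫ u', F u' ∂(Measure.pi fun _ => μ)| ≤ C := abs_integral_le_of_abs_le hC
    rw [integral_pi_finCons (C := (2 * C) ^ 2) ((hF.sub_const _).pow_const 2)
      fun u => sq_le_of_abs_le (abs_sub_le_two (hC u) hmC), hm]
    rw [integral_sub_integral_sq_prod
      (f := fun p : S × (Fin n → S) => F (Fin.cons p.1 p.2)) hFc fun p => hC _]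
    have hD : ∀ i : Fin (n + 1), Measurable fun p : (Fin (n + 1) → S) × S =>
        (F p.1 - F (Function.update p.1 i p.2)) ^ 2 := fun i =>
      ((hF.comp measurable_fst).sub (hF.comp (measurable_update_pair i))).pow_const 2
    have hDC : ∀ (i : Fin (n + 1)) u t, |(F u - F (Function.update u i t)) ^ 2| ≤ (2 * C) ^ 2 :=
      fun i u t => sq_le_of_abs_le (abs_sub_le_two (hC _) (hC _))
    have hsum : ∀ i : Fin (n + 1), ∫ u, ∫ t, (F u - F (Function.update u i t)) ^ 2 ∂μ
        ∂(Measure.pi fun _ => μ) = ∫ s, ∫ v, ∫ t, (F (Fin.cons s v) -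
          F (Function.update (Fin.cons s v) i t)) ^ 2 ∂μ ∂ν ∂μ := fun i =>
      integral_pi_finCons (measurable_integral_right (hD i))
        fun u => abs_integral_le_of_abs_le fun t => hDC i u t
    -- The term of coordinate 0 is exactly the conditional variance. For the others, the induction
    -- hypothesis is applied to the average of `F` over coordinate 0, and Jensen moves the square
    -- inside that average.
    simp_rw [hsum, Fin.sum_univ_succ, Fin.update_cons_zero, mul_add]
    refine add_le_add le_rfl ?_
    have haM : Measurable fun v : Fin n → S => ∫ s, F (Fin.cons s v) ∂μ :=
      measurable_integral_left hFc
    refine (ih haM fun v => abs_integral_le_of_abs_le (C := C) fun s => hC _).trans ?_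
    refine mul_le_mul_of_nonneg_left (Finset.sum_le_sum fun i _ => ?_) (by norm_num)
    simp_rw [← Fin.cons_update]
    have hE : Measurable fun p : (S × (Fin n → S)) × S =>
        F (Fin.cons p.1.1 p.1.2) - F (Fin.cons p.1.1 (Function.update p.1.2 i p.2)) := by
      have hu : Measurable fun p : (S × (Fin n → S)) × S =>
          (p.1.1, Function.update p.1.2 i p.2) :=
        (by fun_prop : Measurable fun p : (S × (Fin n → S)) × S => p.1.1).prodMk
          ((measurable_update_pair i).comp (by fun_prop :
            Measurable fun p : (S × (Fin n → S)) × S => (p.1.2, p.2)))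
      exact (hFc.comp measurable_fst).sub (hFc.comp hu)
    have hEC : ∀ p : (S × (Fin n → S)) × S,
        |F (Fin.cons p.1.1 p.1.2) - F (Fin.cons p.1.1 (Function.update p.1.2 i p.2))|
          ≤ 2 * C := fun p => abs_sub_le_two (hC _) (hC _)
    rw [integral_integral_swap_of_abs_le (μ := μ) (ν := ν) (C := (2 * C) ^ 2)
      (f := fun p : S × (Fin n → S) => ∫ t, (F (Fin.cons p.1 p.2) -
          F (Fin.cons p.1 (Function.update p.2 i t))) ^ 2 ∂μ)
      (measurable_integral_right (hE.pow_const 2))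
      fun p => abs_integral_le_of_abs_le fun t => sq_le_of_abs_le (hEC (p, t))]
    have hE1 : Measurable fun p : ((Fin n → S) × S) × S =>
        F (Fin.cons p.2 p.1.1) - F (Fin.cons p.2 (Function.update p.1.1 i p.1.2)) :=
      hE.comp (f := fun p : ((Fin n → S) × S) × S => ((p.2, p.1.1), p.1.2)) (by fun_prop)
    have hE2 : Measurable fun p : ((Fin n → S) × S) × S =>
        F (Fin.cons p.1.2 p.1.1) - F (Fin.cons p.1.2 (Function.update p.1.1 i p.2)) :=
      hE.comp (f := fun p : ((Fin n → S) × S) × S => ((p.1.2, p.1.1), p.2)) (by fun_prop)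
    have hsub : ∀ v t, ∫ s, F (Fin.cons s v) ∂μ - ∫ s, F (Fin.cons s (Function.update v i t)) ∂μ
        = ∫ s, (F (Fin.cons s v) - F (Fin.cons s (Function.update v i t))) ∂μ := fun v t =>
      (integral_sub
        (integrable_of_abs_le (hFc.comp (by fun_prop : Measurable fun s : S => (s, v)))
          fun s => hC _)
        (integrable_of_abs_le
          (hFc.comp (by fun_prop : Measurable fun s : S => (s, Function.update v i t)))
          fun s => hC _)).symm
    simp_rw [hsub]
    refine integral_mono
      (integrable_of_abs_le (C := (2 * C) ^ 2) (measurable_integral_right (f := fun p :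
        (Fin n → S) × S => (∫ s, (F (Fin.cons s p.1) -
          F (Fin.cons s (Function.update p.1 i p.2))) ∂μ) ^ 2)
        ((measurable_integral_right hE1).pow_const 2))
        fun v => abs_integral_le_of_abs_le fun t => sq_le_of_abs_le
          (abs_integral_le_of_abs_le fun s => hEC ((s, v), t)))
      (integrable_of_abs_le (C := (2 * C) ^ 2) (measurable_integral_right (f := fun p :
        (Fin n → S) × S => ∫ t, (F (Fin.cons p.2 p.1) -
          F (Fin.cons p.2 (Function.update p.1 i t))) ^ 2 ∂μ)
        (measurable_integral_right (hE2.pow_const 2)))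
        fun v => abs_integral_le_of_abs_le fun s => abs_integral_le_of_abs_le fun t =>
          sq_le_of_abs_le (hEC ((s, v), t))) fun v => ?_
    simp only
    rw [integral_integral_swap_of_abs_le (μ := μ) (ν := μ) (C := (2 * C) ^ 2)
      (f := fun p : S × S => (F (Fin.cons p.1 v) -
          F (Fin.cons p.1 (Function.update v i p.2))) ^ 2)
      ((hE.comp (f := fun p : S × S => ((p.1, v), p.2)) (by fun_prop)).pow_const 2)
      fun p => sq_le_of_abs_le (hEC ((p.1, v), p.2))]
    refine integral_mono
      (integrable_of_abs_le (C := (2 * C) ^ 2) ((measurable_integral_right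
        (hE1.comp (f := fun p : S × S => ((v, p.1), p.2)) (by fun_prop))).pow_const 2)
        fun t => sq_le_of_abs_le (abs_integral_le_of_abs_le fun s => hEC ((s, v), t)))
      (integrable_of_abs_le (C := (2 * C) ^ 2) (measurable_integral_right
        ((hE1.comp (f := fun p : S × S => ((v, p.1), p.2)) (by fun_prop)).pow_const 2))
        fun t => abs_integral_le_of_abs_le fun s => sq_le_of_abs_le (hEC ((s, v), t)))
      fun t => ?_
    exact sq_integral_le (hE.comp (f := fun s : S => ((s, v), t)) (by fun_prop))
      fun s => hEC ((s, v), t)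

/-- The variance bound for functions of independent variables with bounded differences. -/
theorem variance_le_of_bounded_differences {μ : Measure S} [IsProbabilityMeasure μ] {n : ℕ}
    {F : (Fin n → S) → ℝ} (hF : Measurable F) {C : ℝ} (hC : ∀ u, |F u| ≤ C) {b : ℝ}
    (hb : ∀ u i t, |F u - F (Function.update u i t)| ≤ b) :
    ∫ u, (F u - ∫ u', F u' ∂(Measure.pi fun _ => μ)) ^ 2 ∂(Measure.pi fun _ => μ) ≤
      n * b ^ 2 / 2 := by
  refine (efron_stein hF hC).trans ?_
  have : ∀ i ∈ Finset.univ, ∫ u, ∫ t, (F u - F (Function.update u i t)) ^ 2 ∂μ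
      ∂(Measure.pi fun _ : Fin n => μ) ≤ b ^ 2 := fun i _ =>
    (le_abs_self _).trans <| abs_integral_le_of_abs_le fun u =>
      abs_integral_le_of_abs_le fun t => sq_le_of_abs_le (hb u i t)
  have := Finset.sum_le_card_nsmul _ _ _ this
  simp only [Finset.card_univ, Fintype.card_fin, nsmul_eq_mul] at this
  linarith

/-- Through `integral_pi_update`, this replaces arguments by independence: one coordinate may be
integrated out while the others are frozen. -/
theorem measurePreserving_update {ι : Type*} [Fintype ι] [DecidableEq ι] {μ : Measure S}
    [IsProbabilityMeasure μ] (i : ι) :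
    MeasurePreserving (fun p : (ι → S) × S => Function.update p.1 i p.2)
      ((Measure.pi fun _ => μ).prod μ) (Measure.pi fun _ => μ) := by
  refine ⟨measurable_update_pair i, (Measure.pi_eq fun s hs => ?_).symm⟩
  rw [Measure.map_apply (measurable_update_pair i) (MeasurableSet.univ_pi hs)]
  have : (fun p : (ι → S) × S => Function.update p.1 i p.2) ⁻¹' (Set.univ.pi s)
      = (Set.univ.pi (Function.update s i Set.univ)) ×ˢ s i := by
    ext p
    simp only [Set.mem_preimage, Set.mem_univ_pi, Set.mem_prod]
    constructor
    · intro h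
      refine ⟨fun j => ?_, by simpa using h i⟩
      by_cases hj : j = i
      · subst hj; simp
      · simpa [Function.update_of_ne hj] using h j
    · rintro ⟨h1, h2⟩ j
      by_cases hj : j = i
      · subst hj; simpa using h2
      · simpa [Function.update_of_ne hj] using h1 j
  rw [this, Measure.prod_prod, Measure.pi_pi, ← Finset.prod_erase_mul _ _ (Finset.mem_univ i),
    ← Finset.prod_erase_mul (a := i) _ (fun i => μ (s i)) (Finset.mem_univ i)]
  simp only [Function.update_self, measure_univ, mul_one]
  congr 1
  exact Finset.prod_congr rfl fun j hj => by
    rw [Function.update_of_ne (Finset.ne_of_mem_erase hj)]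

theorem integral_pi_update {ι : Type*} [Fintype ι] [DecidableEq ι] {μ : Measure S}
    [IsProbabilityMeasure μ] (i : ι) {H : (ι → S) → ℝ} (hH : Measurable H) {C : ℝ}
    (hC : ∀ u, |H u| ≤ C) :
    ∫ u, H u ∂(Measure.pi fun _ => μ) =
      ∫ u, ∫ t, H (Function.update u i t) ∂μ ∂(Measure.pi fun _ => μ) := by
  have h := measurePreserving_update (μ := μ) i
  rw [← h.map_eq, integral_map h.measurable.aemeasurable hH.aestronglyMeasurable, h.map_eq,
    integral_prod]
  exact integrable_of_abs_le (hH.comp h.measurable) fun p => hC _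

end ProductTools

/-! ### V-statistics of order two: deterministic bounds -/

section KernelBounds

variable {S : Type*}

/-- The V-statistic of order two with kernel `R`. -/
def kernelStat (R : S → S → ℝ) {m : ℕ} (u : Fin m → S) : ℝ :=
  1 / (m : ℝ) ^ 2 * ∑ i, ∑ j, R (u i) (u j)

/-- The empirical counterpart of `kernelProj`. -/
def kernelEmpProj (R : S → S → ℝ) {m : ℕ} (u : Fin m → S) (s : S) : ℝ :=
  1 / (m : ℝ) * ∑ j, R s (u j) + 1 / (m : ℝ) * ∑ j, R (u j) s

variable {R : S → S → ℝ}

theorem kernelStat_le_one (h1 : ∀ s t, R s t ≤ 1) {m : ℕ} (u : Fin m → S) :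
    kernelStat R u ≤ 1 := by
  unfold kernelStat
  have : ∑ i, ∑ j, R (u i) (u j) ≤ (m : ℝ) ^ 2 := by
    calc ∑ i, ∑ j, R (u i) (u j) ≤ ∑ _i : Fin m, ∑ _j : Fin m, (1 : ℝ) :=
          Finset.sum_le_sum fun i _ => Finset.sum_le_sum fun j _ => h1 _ _
      _ = (m : ℝ) ^ 2 := by simp [sq]
  rw [one_div_mul_eq_div]
  exact div_le_one_of_le₀ this (by positivity)

theorem kernelStat_nonneg (h0 : ∀ s t, 0 ≤ R s t) {m : ℕ} (u : Fin m → S) :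
    0 ≤ kernelStat R u :=
  mul_nonneg (by positivity) (Finset.sum_nonneg fun _ _ => Finset.sum_nonneg fun _ _ => h0 _ _)

theorem kernelEmpProj_nonneg (h0 : ∀ s t, 0 ≤ R s t) {m : ℕ} (u : Fin m → S) (s : S) :
    0 ≤ kernelEmpProj R u s :=
  add_nonneg (mul_nonneg (by positivity) (Finset.sum_nonneg fun _ _ => h0 _ _))
    (mul_nonneg (by positivity) (Finset.sum_nonneg fun _ _ => h0 _ _))

theorem kernelEmpProj_le_two (h1 : ∀ s t, R s t ≤ 1) {m : ℕ} (u : Fin m → S) (s : S) :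
    kernelEmpProj R u s ≤ 2 := by
  have key : ∀ f : Fin m → ℝ, (∀ j, f j ≤ 1) → 1 / (m : ℝ) * ∑ j, f j ≤ 1 := fun f hf => by
    rw [one_div_mul_eq_div]
    refine div_le_one_of_le₀ ((Finset.sum_le_sum fun j _ => hf j).trans ?_) (by positivity)
    simp
  have h2 := key (fun j => R s (u j)) fun j => h1 _ _
  have h3 := key (fun j => R (u j) s) fun j => h1 _ _
  unfold kernelEmpProj
  linarith

theorem abs_kernel_le_one (h0 : ∀ s t, 0 ≤ R s t) (h1 : ∀ s t, R s t ≤ 1) (s t : S) : |R s t| ≤ 1 := by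
  rw [abs_of_nonneg (h0 s t)]
  exact h1 s t

theorem abs_kernelStat_sub_update_le (h0 : ∀ s t, 0 ≤ R s t) (h1 : ∀ s t, R s t ≤ 1)
    {m : ℕ} (u : Fin m → S) (i : Fin m) (t : S) :
    |kernelStat R u - kernelStat R (Function.update u i t)| ≤ 2 / m := by
  have hm : (0 : ℝ) < m := by exact_mod_cast i.pos
  unfold kernelStat
  rw [← mul_sub, ← Finset.sum_sub_distrib]
  simp_rw [← Finset.sum_sub_distrib]
  rw [abs_mul, abs_of_nonneg (by positivity)]
  have key : |∑ a, ∑ b, (R (u a) (u b) -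
      R (Function.update u i t a) (Function.update u i t b))| ≤ 2 * m := by
    calc _ ≤ ∑ a, ∑ b, |R (u a) (u b) - R (Function.update u i t a) (Function.update u i t b)| :=
          (Finset.abs_sum_le_sum_abs _ _).trans
            (Finset.sum_le_sum fun a _ => Finset.abs_sum_le_sum_abs _ _)
      -- A pair is affected only if one of its indices is `i`. The row and the column of `i`
      -- together count 2m pairs, the diagonal one twice.
      _ ≤ ∑ a, ∑ b, ((if a = i then (1 : ℝ) else 0) + if b = i then (1 : ℝ) else 0) := by
          refine Finset.sum_le_sum fun a _ => Finset.sum_le_sum fun b _ => ?_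
          have hle : |R (u a) (u b) - R (Function.update u i t a) (Function.update u i t b)| ≤ 1 :=
            by
            have h2 := h0 (Function.update u i t a) (Function.update u i t b)
            have h3 := h1 (Function.update u i t a) (Function.update u i t b)
            exact abs_sub_le_iff.2 ⟨by linarith [h1 (u a) (u b)], by linarith [h0 (u a) (u b)]⟩
          by_cases ha : a = i
          · refine hle.trans ?_
            split_ifs <;> norm_num
          · by_cases hb : b = i
            · refine hle.trans ?_
              split_ifs
              norm_num
            · simp [Function.update_of_ne, ha, hb]
      _ = 2 * m := by
          simp [Finset.sum_add_distrib]
          ring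
  calc _ ≤ 1 / (m : ℝ) ^ 2 * (2 * m) := by gcongr
    _ = 2 / m := by field_simp

end KernelBounds

/-! ### V-statistics of order two: mean square bounds -/

section KernelStatistics

variable {S : Type*} [MeasurableSpace S]

/-- The sum of the two marginal projections of the kernel `R`. -/
def kernelProj (μ : Measure S) (R : S → S → ℝ) (s : S) : ℝ :=
  ∫ t, R s t ∂μ + ∫ t, R t s ∂μ

variable {μ : Measure S} [IsProbabilityMeasure μ] {R : S → S → ℝ}
  (hR : Measurable fun p : S × S => R p.1 p.2) (h0 : ∀ s t, 0 ≤ R s t) (h1 : ∀ s t, R s t ≤ 1)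

include hR in
theorem measurable_kernelStat {m : ℕ} :
    Measurable fun u : Fin m → S => kernelStat R u := by
  unfold kernelStat
  refine Measurable.const_mul (Finset.measurable_sum _ fun i _ =>
    Finset.measurable_sum _ fun j _ => ?_) _
  exact hR.comp (f := fun u : Fin m → S => (u i, u j)) (by fun_prop)

include hR in
theorem measurable_kernelProj : Measurable (kernelProj μ R) :=
  (measurable_integral_right hR).add (measurable_integral_left hR)

theorem kernelProj_nonneg {μ : Measure S} {R : S → S → ℝ} (h0 : ∀ s t, 0 ≤ R s t) (s : S) :
    0 ≤ kernelProj μ R s :=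
  add_nonneg (integral_nonneg fun _ => h0 _ _) (integral_nonneg fun _ => h0 _ _)

include h0 h1 in
theorem kernelProj_le_two (s : S) : kernelProj μ R s ≤ 2 := by
  have h2 := (le_abs_self _).trans
    (abs_integral_le_of_abs_le (μ := μ) fun t => abs_kernel_le_one h0 h1 s t)
  have h3 := (le_abs_self _).trans
    (abs_integral_le_of_abs_le (μ := μ) fun t => abs_kernel_le_one h0 h1 t s)
  unfold kernelProj
  linarith

include hR h0 h1 in
theorem integral_kernelProj : ∫ s, kernelProj μ R s ∂μ = 2 * ∫ s, ∫ t, R s t ∂μ ∂μ := by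
  unfold kernelProj
  rw [integral_add, ← integral_integral_swap_of_abs_le (f := fun p : S × S => R p.1 p.2) hR
    (C := 1) fun p => abs_kernel_le_one h0 h1 _ _]
  · ring
  · exact integrable_of_abs_le (C := 1) (measurable_integral_right hR) fun s =>
      abs_integral_le_of_abs_le fun t => abs_kernel_le_one h0 h1 _ _
  · exact integrable_of_abs_le (C := 1) (measurable_integral_left hR) fun s =>
      abs_integral_le_of_abs_le fun t => abs_kernel_le_one h0 h1 _ _

include hR h0 h1 in
theorem integral_kernel_pair {m : ℕ} {i j : Fin m} (hij : i ≠ j) :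
    ∫ u, R (u i) (u j) ∂(Measure.pi fun _ : Fin m => μ) = ∫ s, ∫ t, R s t ∂μ ∂μ := by
  have hb := abs_kernel_le_one h0 h1
  rw [integral_pi_update (H := fun u => R (u i) (u j)) j
    (hR.comp (f := fun u : Fin m → S => (u i, u j)) (by fun_prop)) (C := 1) fun u => hb _ _]
  simp only [Function.update_self, Function.update_of_ne hij]
  have := integral_pi_update (μ := μ) (C := 1) i
    ((measurable_integral_right (ν := μ) hR).comp (measurable_pi_apply i)) fun u =>
      abs_integral_le_of_abs_le fun t => hb (u i) t
  simp only [Function.comp_def] at this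
  rw [this]
  simp

include hR h0 h1 in
theorem integral_kernelStat_sub_sq_le {m : ℕ} (hm : 0 < m) :
    ∫ u : Fin m → S, (kernelStat R u - ∫ s, ∫ t, R s t ∂μ ∂μ) ^ 2 ∂(Measure.pi fun _ => μ) ≤
      3 / m := by
  have hm' : (1 : ℝ) ≤ m := by exact_mod_cast hm
  have hb := abs_kernel_le_one h0 h1
  have hC : ∀ u : Fin m → S, |kernelStat R u| ≤ 1 := fun u => by
    rw [abs_of_nonneg (kernelStat_nonneg h0 u)]
    exact kernelStat_le_one h1 u
  have hpair : ∀ i j : Fin m, Measurable fun u : Fin m → S => R (u i) (u j) := fun i j =>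
    hR.comp (f := fun u : Fin m → S => (u i, u j)) (by fun_prop)
  have hint : ∀ i j : Fin m, Integrable (fun u : Fin m → S => R (u i) (u j))
      (Measure.pi fun _ => μ) := fun i j => integrable_of_abs_le (hpair i j) fun u => hb _ _
  set θ := ∫ s, ∫ t, R s t ∂μ ∂μ with hθ
  have hθ0 : 0 ≤ θ := integral_nonneg fun s => integral_nonneg fun t => h0 s t
  have hθ1 : θ ≤ 1 := (le_abs_self _).trans
    (abs_integral_le_of_abs_le fun s => abs_integral_le_of_abs_le fun t => hb s t)
  rw [integral_sub_sq (measurable_kernelStat hR) hC]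
  have hv := variance_le_of_bounded_differences (μ := μ) (measurable_kernelStat (m := m) hR) hC
    fun u i t => abs_kernelStat_sub_update_le h0 h1 u i t
  -- Only the m diagonal terms out of m² can have a mean different from θ. Efron–Stein with
  -- differences 2/m gives variance at most 2/m, and the squared bias adds at most 1/m.
  have hbias : |∫ u : Fin m → S, kernelStat R u ∂(Measure.pi fun _ => μ) - θ| ≤ 1 / m := by
    have e : ∫ u : Fin m → S, kernelStat R u ∂(Measure.pi fun _ => μ) - θ
        = 1 / (m : ℝ) ^ 2 * ∑ i : Fin m, ∑ j : Fin m,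
          (∫ u : Fin m → S, R (u i) (u j) ∂(Measure.pi fun _ => μ) - θ) := by
      unfold kernelStat
      rw [integral_const_mul, integral_finsetSum _ fun i _ => integrable_finsetSum _
        fun j _ => hint i j]
      simp_rw [integral_finsetSum _ fun j _ => hint _ j, Finset.sum_sub_distrib]
      simp
      field_simp
    rw [e, abs_mul, abs_of_nonneg (by positivity)]
    have : |∑ i : Fin m, ∑ j : Fin m,
        (∫ u : Fin m → S, R (u i) (u j) ∂(Measure.pi fun _ => μ) - θ)| ≤ m := by
      calc _ ≤ ∑ i : Fin m, ∑ j : Fin m,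
            |∫ u : Fin m → S, R (u i) (u j) ∂(Measure.pi fun _ => μ) - θ| :=
            (Finset.abs_sum_le_sum_abs _ _).trans
              (Finset.sum_le_sum fun a _ => Finset.abs_sum_le_sum_abs _ _)
        _ ≤ ∑ i : Fin m, ∑ j : Fin m, if i = j then (1 : ℝ) else 0 := by
            refine Finset.sum_le_sum fun i _ => Finset.sum_le_sum fun j _ => ?_
            split_ifs with h
            · have h2 : 0 ≤ ∫ u : Fin m → S, R (u i) (u j) ∂(Measure.pi fun _ => μ) :=
                integral_nonneg fun u => h0 _ _
              have h3 : ∫ u : Fin m → S, R (u i) (u j) ∂(Measure.pi fun _ => μ) ≤ 1 :=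
                integral_le_of_le (hint i j) fun u => h1 _ _
              exact abs_sub_le_iff.2 ⟨by linarith, by linarith⟩
            · rw [integral_kernel_pair hR h0 h1 h]
              simp [hθ]
        _ = m := by simp
    calc _ ≤ 1 / (m : ℝ) ^ 2 * m := by gcongr
      _ = 1 / m := by field_simp
  have hbias2 := pow_le_pow_left₀ (abs_nonneg _) hbias 2
  rw [sq_abs] at hbias2
  have e1 : (m : ℝ) * (2 / m) ^ 2 / 2 = 2 / m := by field_simp
  have e2 : (1 / (m : ℝ)) ^ 2 ≤ 1 / m := by
    rw [sq]
    exact mul_le_of_le_one_right (by positivity) ((div_le_one (by positivity)).2 hm')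
  have e3 : (3 : ℝ) / m = 2 / m + 1 / m := by ring
  rw [e1] at hv
  linarith

include hR h0 h1 in
theorem integral_kernelProj_sub_kernelEmpProj_sq_le {m : ℕ} (i : Fin m) :
    ∫ u : Fin m → S, (kernelProj μ R (u i) - kernelEmpProj R u (u i)) ^ 2
      ∂(Measure.pi fun _ => μ) ≤ 8 / m := by
  have hm : (0 : ℝ) < m := by exact_mod_cast i.pos
  have hb := abs_kernel_le_one h0 h1
  -- The error is the average of the `a j`. For l ≠ i, `a l` has mean zero over coordinate l, so
  -- only the products with j = l or l = i survive: at most 2m of them, each bounded by 4.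
  set a : Fin m → (Fin m → S) → ℝ := fun j u =>
    kernelProj μ R (u i) - (R (u i) (u j) + R (u j) (u i)) with ha
  have haM : ∀ j, Measurable (a j) := fun j =>
    ((measurable_kernelProj hR).comp (measurable_pi_apply i)).sub
      ((hR.comp (f := fun u : Fin m → S => (u i, u j)) (by fun_prop)).add
        (hR.comp (f := fun u : Fin m → S => (u j, u i)) (by fun_prop)))
  have haC : ∀ j u, |a j u| ≤ 2 := fun j u => by
    have := kernelProj_nonneg (μ := μ) h0 (u i)
    have := kernelProj_le_two (μ := μ) h0 h1 (u i)
    simp only [ha]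
    exact abs_sub_le_iff.2 ⟨by linarith [h0 (u i) (u j), h0 (u j) (u i)],
      by linarith [h1 (u i) (u j), h1 (u j) (u i)]⟩
  have haC2 : ∀ j l u, |a j u * a l u| ≤ 4 := fun j l u => by
    rw [abs_mul]
    calc |a j u| * |a l u| ≤ 2 * 2 :=
          mul_le_mul (haC j u) (haC l u) (abs_nonneg _) (by norm_num)
      _ = 4 := by norm_num
  have haint : ∀ j l, Integrable (fun u => a j u * a l u) (Measure.pi fun _ => μ) := fun j l =>
    integrable_of_abs_le ((haM j).mul (haM l)) (haC2 j l)
  have e : ∀ u : Fin m → S, (kernelProj μ R (u i) - kernelEmpProj R u (u i)) ^ 2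
      = 1 / (m : ℝ) ^ 2 * ∑ j, ∑ l, a j u * a l u := fun u => by
    rw [← Finset.sum_mul_sum, ← sq]
    have : ∑ j, a j u = m * (kernelProj μ R (u i) - kernelEmpProj R u (u i)) := by
      simp only [ha, kernelEmpProj, Finset.sum_sub_distrib, Finset.sum_add_distrib]
      simp
      field_simp
    rw [this]
    field_simp
  simp_rw [e]
  rw [integral_const_mul, integral_finsetSum _ fun j _ => integrable_finsetSum _
        fun l _ => haint j l]
  simp_rw [integral_finsetSum _ fun l _ => haint _ l]
  have hsum : ∑ j, ∑ l, ∫ u, a j u * a l u ∂(Measure.pi fun _ => μ) ≤ 8 * m := by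
    calc _ ≤ ∑ j, ∑ l, ((if j = l then (4 : ℝ) else 0) + if i = l then (4 : ℝ) else 0) := by
          refine Finset.sum_le_sum fun j _ => Finset.sum_le_sum fun l _ => ?_
          have hle : ∫ u, a j u * a l u ∂(Measure.pi fun _ => μ) ≤ 4 :=
            (le_abs_self _).trans (abs_integral_le_of_abs_le (haC2 j l))
          by_cases hj : j = l
          · refine hle.trans ?_
            split_ifs <;> norm_num
          by_cases hi : i = l
          · refine hle.trans ?_
            split_ifs
            norm_num
          -- Resampling coordinate l, which is neither i nor j, leaves `a j` fixed and averages `a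
          -- l` to zero.
          rw [integral_pi_update (H := fun u => a j u * a l u) l ((haM j).mul (haM l)) (haC2 j l), if_neg hj, if_neg hi, add_zero]
          refine le_of_eq ?_
          have hz : ∀ u : Fin m → S, ∫ t, a j (Function.update u l t) *
              a l (Function.update u l t) ∂μ = 0 := fun u => by
            simp only [ha, Function.update_self, Function.update_of_ne hi,
              Function.update_of_ne hj]
            have i1 : Integrable (fun t => R (u i) t) μ := integrable_of_abs_le
              (hR.comp (f := fun t : S => (u i, t)) (by fun_prop)) fun t => hb _ _
            have i2 : Integrable (fun t => R t (u i)) μ := integrable_of_abs_le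
              (hR.comp (f := fun t : S => (t, u i)) (by fun_prop)) fun t => hb _ _
            have i3 : Integrable (fun t => R (u i) t + R t (u i)) μ := i1.add i2
            rw [integral_const_mul, integral_sub (integrable_const _) i3, integral_add i1 i2]
            simp [kernelProj]
          simp_rw [hz]
          simp
      _ = 8 * m := by
          simp [Finset.sum_add_distrib]
          ring
  calc _ ≤ 1 / (m : ℝ) ^ 2 * (8 * m) := by gcongr
    _ = 8 / m := by field_simp

/-- Concentration of an average of bounded iid variables. -/
theorem integral_average_sub_sq_le {q : S → ℝ} (hq : Measurable q) {b : ℝ}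
    (hq0 : ∀ s, 0 ≤ q s) (hqb : ∀ s, q s ≤ b) {m : ℕ} (hm : 0 < m) :
    ∫ u : Fin m → S, (1 / (m : ℝ) * ∑ i, q (u i) - ∫ s, q s ∂μ) ^ 2 ∂(Measure.pi fun _ => μ) ≤
      b ^ 2 / m := by
  have hm' : (0 : ℝ) < m := by exact_mod_cast hm
  have hqC : ∀ s, |q s| ≤ b := fun s => by
    rw [abs_of_nonneg (hq0 s)]; exact hqb s
  have hqi : ∀ i : Fin m, Measurable fun u : Fin m → S => q (u i) := fun i =>
    hq.comp (measurable_pi_apply i)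
  have hM : Measurable fun u : Fin m → S => 1 / (m : ℝ) * ∑ i, q (u i) :=
    (Finset.measurable_sum _ fun i _ => hqi i).const_mul _
  have hC : ∀ u : Fin m → S, |1 / (m : ℝ) * ∑ i, q (u i)| ≤ b := fun u => by
    rw [abs_mul, abs_of_nonneg (by positivity)]
    have : |∑ i, q (u i)| ≤ m * b := by
      refine (Finset.abs_sum_le_sum_abs _ _).trans
        ((Finset.sum_le_sum fun i _ => hqC (u i)).trans ?_)
      simp
    calc _ ≤ 1 / (m : ℝ) * (m * b) := by gcongr
      _ = b := by field_simp
  have hmean : ∫ u : Fin m → S, 1 / (m : ℝ) * ∑ i, q (u i) ∂(Measure.pi fun _ => μ)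
      = ∫ s, q s ∂μ := by
    rw [integral_const_mul, integral_finsetSum _ fun i _ =>
      integrable_of_abs_le (hqi i) fun u => hqC _]
    have : ∀ i : Fin m, ∫ u : Fin m → S, q (u i) ∂(Measure.pi fun _ => μ) = ∫ s, q s ∂μ :=
      fun i => by
        rw [integral_pi_update i (hqi i) fun u => hqC _]
        simp
    simp_rw [this]
    simp
    field_simp
  have hv := variance_le_of_bounded_differences (μ := μ) hM hC (b := b / m) fun u i t => by
    rw [← mul_sub, ← Finset.sum_sub_distrib, abs_mul, abs_of_nonneg (by positivity),
      Finset.sum_eq_single i]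
    · have : |q (u i) - q (Function.update u i t i)| ≤ b :=
        abs_sub_le_iff.2 ⟨by linarith [hqb (u i), hq0 (Function.update u i t i)],
          by linarith [hq0 (u i), hqb (Function.update u i t i)]⟩
      calc _ ≤ 1 / (m : ℝ) * b := by gcongr
        _ = b / m := by ring
    · intro j _ hj
      simp [Function.update_of_ne hj]
    · simp
  rw [hmean] at hv
  refine hv.trans ?_
  have e : (m : ℝ) * (b / m) ^ 2 / 2 = b ^ 2 / m / 2 := by field_simp
  rw [e]
  have : 0 ≤ b ^ 2 / m := by positivity
  linarith

end KernelStatistics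

/-! ### Empirical projections of a random kernel are rarely constant -/

section Degenerate

variable {S Ω : Type*} [MeasurableSpace S] [MeasurableSpace Ω]

theorem measurable_kernelProj_param {μ : Measure S} [IsProbabilityMeasure μ] {R : Ω → S → S → ℝ}
    (hR : Measurable fun p : Ω × S × S => R p.1 p.2.1 p.2.2) :
    Measurable fun p : Ω × S => kernelProj μ (R p.1) p.2 := by
  refine Measurable.add ?_ ?_
  · exact measurable_integral_right (f := fun q : (Ω × S) × S => R q.1.1 q.1.2 q.2)
      (hR.comp (f := fun q : (Ω × S) × S => (q.1.1, q.1.2, q.2)) (by fun_prop))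
  · exact measurable_integral_right (f := fun q : (Ω × S) × S => R q.1.1 q.2 q.1.2)
      (hR.comp (f := fun q : (Ω × S) × S => (q.1.1, q.2, q.1.2)) (by fun_prop))

theorem measurable_kernelStat_param {R : Ω → S → S → ℝ}
    (hR : Measurable fun p : Ω × S × S => R p.1 p.2.1 p.2.2) {m : ℕ} :
    Measurable fun p : Ω × (Fin m → S) => kernelStat (R p.1) p.2 := by
  unfold kernelStat
  refine Measurable.const_mul (Finset.measurable_sum _ fun i _ =>
    Finset.measurable_sum _ fun j _ => ?_) _
  exact hR.comp (f := fun p : Ω × (Fin m → S) => (p.1, p.2 i, p.2 j)) (by fun_prop)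

theorem measurable_kernelEmpProj_param {R : Ω → S → S → ℝ}
    (hR : Measurable fun p : Ω × S × S => R p.1 p.2.1 p.2.2) {m : ℕ} (i : Fin m) :
    Measurable fun p : Ω × (Fin m → S) => kernelEmpProj (R p.1) p.2 (p.2 i) := by
  unfold kernelEmpProj
  refine (Measurable.const_mul (Finset.measurable_sum _ fun j _ => ?_) _).add
    (Measurable.const_mul (Finset.measurable_sum _ fun j _ => ?_) _)
  · exact hR.comp (f := fun p : Ω × (Fin m → S) => (p.1, p.2 i, p.2 j)) (by fun_prop)
  · exact hR.comp (f := fun p : Ω × (Fin m → S) => (p.1, p.2 j, p.2 i)) (by fun_prop)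

theorem add_four_sq_le (a b c d : ℝ) :
    (a + b + c + d) ^ 2 ≤ 4 * (a ^ 2 + b ^ 2 + c ^ 2 + d ^ 2) := by
  nlinarith [sq_nonneg (a - b), sq_nonneg (a - c), sq_nonneg (a - d), sq_nonneg (b - c),
    sq_nonneg (b - d), sq_nonneg (c - d)]

theorem integral_average_le {ρ : Measure Ω} {m : ℕ} {F : Fin m → Ω → ℝ}
    (hF : ∀ i, Integrable (F i) ρ) {b : ℝ} (hb0 : 0 ≤ b) (hb : ∀ i, ∫ ω, F i ω ∂ρ ≤ b) :
    ∫ ω, 1 / (m : ℝ) * ∑ i, F i ω ∂ρ ≤ b := by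
  rw [integral_const_mul, integral_finsetSum _ fun i _ => hF i]
  have : ∑ i, ∫ ω, F i ω ∂ρ ≤ m * b := by
    refine (Finset.sum_le_sum fun i _ => hb i).trans ?_
    simp
  rcases m.eq_zero_or_pos with rfl | hm
  · simpa using hb0
  · have hm' : (0 : ℝ) < m := by exact_mod_cast hm
    calc _ ≤ 1 / (m : ℝ) * (m * b) := by gcongr
      _ = b := by field_simp

/-- The probability that the empirical projections of a random kernel are constant on an
independent sample is small if the averaged projection is nondegenerate and the projection
concentrates around its average. -/
theorem measureReal_degenerate_le {μ : Measure S} [IsProbabilityMeasure μ] {ρ : Measure Ω}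
    [IsProbabilityMeasure ρ] {R : Ω → S → S → ℝ}
    (hR : Measurable fun p : Ω × S × S => R p.1 p.2.1 p.2.2)
    (h0 : ∀ ω s t, 0 ≤ R ω s t) (h1 : ∀ ω s t, R ω s t ≤ 1) {m : ℕ} (hm : 0 < m) {c e : ℝ}
    (hc : 0 < c)
    (hv : c < variance (fun s => ∫ ω, kernelProj μ (R ω) s ∂ρ) μ)
    (he : ∫ s, ∫ ω, (kernelProj μ (R ω) s - ∫ ω', kernelProj μ (R ω') s ∂ρ) ^ 2 ∂ρ ∂μ ≤ e) :
    (ρ.prod (Measure.pi fun _ : Fin m => μ)).real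
      {p | ∀ i, kernelEmpProj (R p.1) p.2 (p.2 i) = 2 * kernelStat (R p.1) p.2} ≤
      64 / c ^ 2 / m + 8 / c * (2 * e + 20 / m) := by
  have hm' : (0 : ℝ) < m := by exact_mod_cast hm
  have hRω : ∀ ω, Measurable fun p : S × S => R ω p.1 p.2 := fun ω =>
    hR.comp (f := fun p : S × S => (ω, p.1, p.2)) (by fun_prop)
  have hf : Measurable fun p : Ω × S => kernelProj μ (R p.1) p.2 :=
    measurable_kernelProj_param hR
  have hf0 : ∀ ω s, 0 ≤ kernelProj μ (R ω) s := fun ω s => kernelProj_nonneg (h0 ω) s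
  have hf2 : ∀ ω s, kernelProj μ (R ω) s ≤ 2 := fun ω s => kernelProj_le_two (h0 ω) (h1 ω) s
  have hfabs : ∀ ω s, |kernelProj μ (R ω) s| ≤ 2 := fun ω s => by
    rw [abs_of_nonneg (hf0 ω s)]; exact hf2 ω s
  set fb : S → ℝ := fun s => ∫ ω, kernelProj μ (R ω) s ∂ρ with hfb
  have hfbM : Measurable fb := measurable_integral_left hf
  have hfb0 : ∀ s, 0 ≤ fb s := fun s => integral_nonneg fun ω => hf0 ω s
  have hfbabs : ∀ s, |fb s| ≤ 2 := fun s => abs_integral_le_of_abs_le fun ω => hfabs ω s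
  have hfb2 : ∀ s, fb s ≤ 2 := fun s => (le_abs_self _).trans (hfbabs s)
  set M := ∫ s, fb s ∂μ with hM
  have hM0 : 0 ≤ M := integral_nonneg hfb0
  have hM2 : M ≤ 2 := (le_abs_self _).trans (abs_integral_le_of_abs_le hfbabs)
  rw [variance_eq_integral hfbM.aemeasurable] at hv
  set q : S → ℝ := fun s => (fb s - M) ^ 2 with hq
  have hqM : Measurable q := (hfbM.sub_const M).pow_const 2
  have hq0 : ∀ s, 0 ≤ q s := fun s => sq_nonneg _
  have hdiff : ∀ s, |fb s - M| ≤ 2 := fun s =>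
    abs_sub_le_iff.2 ⟨by linarith [hfb2 s], by linarith [hfb0 s]⟩
  have hq4 : ∀ s, q s ≤ 4 := fun s => by
    have := (le_abs_self _).trans (sq_le_of_abs_le (hdiff s))
    norm_num at this
    exact this
  set v := ∫ s, q s ∂μ with hvdef
  change c < v at hv
  have hv4 : v ≤ 4 := (le_abs_self _).trans
    (abs_integral_le_of_abs_le fun s => by rw [abs_of_nonneg (hq0 s)]; exact hq4 s)
  set θ : Ω → ℝ := fun ω => ∫ s, ∫ t, R ω s t ∂μ ∂μ with hθ
  have hθM : Measurable θ :=
    measurable_integral_right (f := fun p : Ω × S => ∫ t, R p.1 p.2 t ∂μ)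
      (measurable_integral_right (f := fun q : (Ω × S) × S => R q.1.1 q.1.2 q.2)
        (hR.comp (f := fun q : (Ω × S) × S => (q.1.1, q.1.2, q.2)) (by fun_prop)))
  have hθ0 : ∀ ω, 0 ≤ θ ω := fun ω => integral_nonneg fun s => integral_nonneg fun t => h0 ω s t
  have hθ1 : ∀ ω, θ ω ≤ 1 := fun ω => (le_abs_self _).trans
    (abs_integral_le_of_abs_le fun s => abs_integral_le_of_abs_le fun t =>
      abs_kernel_le_one (h0 ω) (h1 ω) s t)
  have hproj : ∀ ω, ∫ s, kernelProj μ (R ω) s ∂μ = 2 * θ ω := fun ω =>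
    integral_kernelProj (hRω ω) (h0 ω) (h1 ω)
  -- the five error terms
  set ν : Measure (Fin m → S) := Measure.pi fun _ => μ with hν
  set Λ : (Fin m → S) → ℝ := fun u => 1 / (m : ℝ) * ∑ i, q (u i) with hΛ
  set r1 : Fin m → Ω × (Fin m → S) → ℝ := fun i p =>
    (fb (p.2 i) - kernelProj μ (R p.1) (p.2 i)) ^ 2 with hr1
  set r2 : Fin m → Ω × (Fin m → S) → ℝ := fun i p =>
    (kernelProj μ (R p.1) (p.2 i) - kernelEmpProj (R p.1) p.2 (p.2 i)) ^ 2 with hr2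
  set r3 : Ω × (Fin m → S) → ℝ := fun p => (2 * kernelStat (R p.1) p.2 - 2 * θ p.1) ^ 2 with hr3
  set r4 : Ω × (Fin m → S) → ℝ := fun p => (2 * θ p.1 - M) ^ 2 with hr4
  set r5 : Ω × (Fin m → S) → ℝ := fun p => (Λ p.2 - v) ^ 2 with hr5
  have hΛM : Measurable Λ :=
    (Finset.measurable_sum _ fun i _ => hqM.comp (measurable_pi_apply i)).const_mul _
  have hΛ0 : ∀ u, 0 ≤ Λ u := fun u =>
    mul_nonneg (by positivity) (Finset.sum_nonneg fun i _ => hq0 _)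
  have hΛ4 : ∀ u, Λ u ≤ 4 := fun u => by
    have : ∑ i, q (u i) ≤ m * 4 := by
      refine (Finset.sum_le_sum fun i _ => hq4 (u i)).trans ?_
      simp
    calc Λ u ≤ 1 / (m : ℝ) * (m * 4) := mul_le_mul_of_nonneg_left this (by positivity)
      _ = 4 := by field_simp
  have hT0 : ∀ p : Ω × (Fin m → S), 0 ≤ kernelStat (R p.1) p.2 := fun p =>
    kernelStat_nonneg (h0 p.1) p.2
  have hT1 : ∀ p : Ω × (Fin m → S), kernelStat (R p.1) p.2 ≤ 1 := fun p =>
    kernelStat_le_one (h1 p.1) p.2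
  have hfi : ∀ i : Fin m,
      Measurable fun p : Ω × (Fin m → S) => kernelProj μ (R p.1) (p.2 i) := fun i =>
    hf.comp (f := fun p : Ω × (Fin m → S) => (p.1, p.2 i)) (by fun_prop)
  have m1 : ∀ i, Measurable (r1 i) := fun i =>
    ((hfbM.comp (f := fun p : Ω × (Fin m → S) => p.2 i) (by fun_prop)).sub
      (hfi i)).pow_const 2
  have m2 : ∀ i, Measurable (r2 i) := fun i =>
    ((hfi i).sub (measurable_kernelEmpProj_param hR i)).pow_const 2
  have m3 : Measurable r3 := (((measurable_kernelStat_param hR).const_mul 2).sub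
    ((hθM.comp measurable_fst).const_mul 2)).pow_const 2
  have m4 : Measurable r4 := (((hθM.comp measurable_fst).const_mul 2).sub_const M).pow_const 2
  have m5 : Measurable r5 := ((hΛM.comp measurable_snd).sub_const v).pow_const 2
  have b1 : ∀ i p, |r1 i p| ≤ 2 ^ 2 := fun i p => sq_le_of_abs_le <| abs_sub_le_iff.2
    ⟨by linarith [hfb2 (p.2 i), hf0 p.1 (p.2 i)], by linarith [hfb0 (p.2 i), hf2 p.1 (p.2 i)]⟩
  have b2 : ∀ i p, |r2 i p| ≤ 2 ^ 2 := fun i p => by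
    have h3 := kernelEmpProj_nonneg (h0 p.1) p.2 (p.2 i)
    have h4 := kernelEmpProj_le_two (h1 p.1) p.2 (p.2 i)
    exact sq_le_of_abs_le <| abs_sub_le_iff.2
      ⟨by linarith [hf2 p.1 (p.2 i)], by linarith [hf0 p.1 (p.2 i)]⟩
  have b3 : ∀ p, |r3 p| ≤ 2 ^ 2 := fun p => sq_le_of_abs_le <| abs_sub_le_iff.2
    ⟨by linarith [hT1 p, hθ0 p.1], by linarith [hT0 p, hθ1 p.1]⟩
  have b4 : ∀ p, |r4 p| ≤ 2 ^ 2 := fun p => sq_le_of_abs_le <| abs_sub_le_iff.2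
    ⟨by linarith [hθ1 p.1], by linarith [hθ0 p.1]⟩
  have b5 : ∀ p, |r5 p| ≤ 4 ^ 2 := fun p => sq_le_of_abs_le <| abs_sub_le_iff.2
    ⟨by linarith [hΛ4 p.2], by linarith [hΛ0 p.2]⟩
  have n1 : ∀ i, Integrable (r1 i) (ρ.prod ν) := fun i => integrable_of_abs_le (m1 i) (b1 i)
  have n2 : ∀ i, Integrable (r2 i) (ρ.prod ν) := fun i => integrable_of_abs_le (m2 i) (b2 i)
  have n3 : Integrable r3 (ρ.prod ν) := integrable_of_abs_le m3 b3
  have n4 : Integrable r4 (ρ.prod ν) := integrable_of_abs_le m4 b4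
  have n5 : Integrable r5 (ρ.prod ν) := integrable_of_abs_le m5 b5
  have hfbsq : Measurable fun p : Ω × S => (kernelProj μ (R p.1) p.2 - fb p.2) ^ 2 :=
    (hf.sub (hfbM.comp measurable_snd)).pow_const 2
  have hfbsqb : ∀ p : Ω × S, |(kernelProj μ (R p.1) p.2 - fb p.2) ^ 2| ≤ 2 ^ 2 := fun p =>
    sq_le_of_abs_le <| abs_sub_le_iff.2
      ⟨by linarith [hfb0 p.2, hf2 p.1 p.2], by linarith [hfb2 p.2, hf0 p.1 p.2]⟩
  have he' : ∫ ω, ∫ s, (kernelProj μ (R ω) s - fb s) ^ 2 ∂μ ∂ρ ≤ e := by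
    rw [integral_integral_swap_of_abs_le
      (f := fun p : Ω × S => (kernelProj μ (R p.1) p.2 - fb p.2) ^ 2) hfbsq hfbsqb]
    exact he
  have e0 : 0 ≤ e := (integral_nonneg fun ω => integral_nonneg fun s => sq_nonneg _).trans he'
  have B1 : ∀ i, ∫ p, r1 i p ∂(ρ.prod ν) ≤ e := fun i => by
    rw [integral_prod _ (n1 i)]
    refine le_trans (le_of_eq ?_) he'
    refine integral_congr_ae (ae_of_all _ fun ω => ?_)
    have := integral_pi_update (μ := μ) (H := fun u : Fin m → S =>
      (fb (u i) - kernelProj μ (R ω) (u i)) ^ 2) i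
      ((m1 i).comp (f := fun u => (ω, u)) (by fun_prop)) fun u => b1 i (ω, u)
    simp only [hr1]
    rw [this]
    simp only [Function.update_self, integral_const, probReal_univ, one_smul]
    exact integral_congr_ae (ae_of_all _ fun s => by ring)
  have B2 : ∀ i, ∫ p, r2 i p ∂(ρ.prod ν) ≤ 8 / m := fun i => by
    rw [integral_prod _ (n2 i)]
    refine integral_le_of_le (n2 i).integral_prod_left fun ω => ?_
    exact integral_kernelProj_sub_kernelEmpProj_sq_le (hRω ω) (h0 ω) (h1 ω) i
  have B3 : ∫ p, r3 p ∂(ρ.prod ν) ≤ 12 / m := by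
    rw [integral_prod _ n3]
    refine integral_le_of_le n3.integral_prod_left fun ω => ?_
    have h := integral_kernelStat_sub_sq_le (μ := μ) (hRω ω) (h0 ω) (h1 ω) hm
    have e1 : ∀ u, r3 (ω, u) = 4 * (kernelStat (R ω) u - θ ω) ^ 2 := fun u => by
      simp only [hr3]; ring
    simp_rw [e1]
    rw [integral_const_mul]
    calc _ ≤ 4 * (3 / (m : ℝ)) := mul_le_mul_of_nonneg_left h (by norm_num)
      _ = 12 / m := by ring
  -- Both 2θ and M are means over the evaluation point, of the conditional and of the averaged
  -- projection. Jensen reduces their squared distance to the fluctuation already bounded by `e`.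
  have B4 : ∫ p, r4 p ∂(ρ.prod ν) ≤ e := by
    rw [integral_prod _ n4]
    refine le_trans (integral_mono n4.integral_prod_left ?_ fun ω => ?_) he'
    · exact integrable_of_abs_le (measurable_integral_right hfbsq) fun ω =>
        abs_integral_le_of_abs_le fun s => hfbsqb (ω, s)
    · simp only [hr4, integral_const, probReal_univ, one_smul]
      have hfω : Measurable fun s => kernelProj μ (R ω) s := measurable_kernelProj (hRω ω)
      rw [← hproj ω, hM, ← integral_sub (integrable_of_abs_le hfω (hfabs ω))
        (integrable_of_abs_le hfbM hfbabs)]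
      exact sq_integral_le (C := 4) (hfω.sub hfbM) fun s => by
        have := abs_sub_le_two (hfabs ω s) (hfbabs s)
        linarith
  have B5 : ∫ p, r5 p ∂(ρ.prod ν) ≤ 16 / m := by
    rw [integral_prod _ n5]
    refine integral_le_of_le n5.integral_prod_left fun ω => ?_
    have h := integral_average_sub_sq_le (μ := μ) hqM hq0 hq4 hm
    norm_num at h
    simpa [hr5, hΛ, hν] using h
  -- The weights make W at least 1 on the degenerate event, where Λ is at most four times the
  -- bracket X. If Λ ≥ c/2 then X ≥ c/8; if Λ < c/2 then Λ misses v > c by more than c/2, so r5 ≥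
  -- c²/4. Markov's inequality for W concludes.
  set W : Ω × (Fin m → S) → ℝ := fun p => 4 / c ^ 2 * r5 p + 8 / c *
    ((1 / (m : ℝ) * ∑ i, r1 i p) + (1 / (m : ℝ) * ∑ i, r2 i p) + (r3 p + r4 p)) with hW
  have nS1 : Integrable (fun p => 1 / (m : ℝ) * ∑ i, r1 i p) (ρ.prod ν) :=
    (integrable_finsetSum _ fun i _ => n1 i).const_mul _
  have nS2 : Integrable (fun p => 1 / (m : ℝ) * ∑ i, r2 i p) (ρ.prod ν) :=
    (integrable_finsetSum _ fun i _ => n2 i).const_mul _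
  have n34 : Integrable (fun p => r3 p + r4 p) (ρ.prod ν) := n3.add n4
  have n12 : Integrable (fun p => (1 / (m : ℝ) * ∑ i, r1 i p) + (1 / (m : ℝ) * ∑ i, r2 i p))
    (ρ.prod ν) := nS1.add nS2
  have n1234 : Integrable (fun p => (1 / (m : ℝ) * ∑ i, r1 i p) + (1 / (m : ℝ) * ∑ i, r2 i p) +
    (r3 p + r4 p)) (ρ.prod ν) := n12.add n34
  have nW : Integrable W (ρ.prod ν) := (n5.const_mul _).add (n1234.const_mul _)
  have r1nn : ∀ i p, 0 ≤ r1 i p := fun i p => sq_nonneg _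
  have r2nn : ∀ i p, 0 ≤ r2 i p := fun i p => sq_nonneg _
  have hWnn : ∀ p, 0 ≤ W p := fun p => by
    have h1 : 0 ≤ ∑ i, r1 i p := Finset.sum_nonneg fun i _ => r1nn i p
    have h2 : 0 ≤ ∑ i, r2 i p := Finset.sum_nonneg fun i _ => r2nn i p
    have h3 : 0 ≤ r3 p := sq_nonneg _
    have h4 : 0 ≤ r4 p := sq_nonneg _
    have h5 : 0 ≤ r5 p := sq_nonneg _
    simp only [hW]
    positivity
  have hsub : {p : Ω × (Fin m → S) |
      ∀ i, kernelEmpProj (R p.1) p.2 (p.2 i) = 2 * kernelStat (R p.1) p.2} ⊆ {p | 1 ≤ W p} := by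
    intro p hp
    simp only [Set.mem_ofPred_eq] at hp ⊢
    -- Since the empirical projection at each sample point equals twice the statistic, fb(u_i) − M
    -- telescopes into four differences, whose squares are r1, r2, r3 and r4.
    have hle : Λ p.2 ≤ 4 * ((1 / (m : ℝ) * ∑ i, r1 i p) + (1 / (m : ℝ) * ∑ i, r2 i p) +
        (r3 p + r4 p)) := by
      have : ∑ i, q (p.2 i) ≤ ∑ i, 4 * (r1 i p + r2 i p + r3 p + r4 p) := by
        refine Finset.sum_le_sum fun i _ => ?_
        have h := add_four_sq_le (fb (p.2 i) - kernelProj μ (R p.1) (p.2 i))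
          (kernelProj μ (R p.1) (p.2 i) - kernelEmpProj (R p.1) p.2 (p.2 i))
          (2 * kernelStat (R p.1) p.2 - 2 * θ p.1) (2 * θ p.1 - M)
        refine le_trans (le_of_eq ?_) h
        simp only [hq]
        rw [hp i]
        ring
      calc Λ p.2 ≤ 1 / (m : ℝ) * ∑ i, 4 * (r1 i p + r2 i p + r3 p + r4 p) :=
            mul_le_mul_of_nonneg_left this (by positivity)
        _ = _ := by
          rw [← Finset.mul_sum]
          simp only [Finset.sum_add_distrib, Finset.sum_const, Finset.card_univ, Fintype.card_fin,
            nsmul_eq_mul]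
          field_simp
          ring
    set X := (1 / (m : ℝ) * ∑ i, r1 i p) + (1 / (m : ℝ) * ∑ i, r2 i p) + (r3 p + r4 p)
    have hX : 0 ≤ X := by
      have := hΛ0 p.2
      linarith
    simp only [hW]
    by_cases hcase : c / 2 ≤ Λ p.2
    · have h8 : 1 ≤ 8 / c * X := by
        rw [div_mul_eq_mul_div, le_div_iff₀ hc]
        linarith
      have : 0 ≤ 4 / c ^ 2 * r5 p := mul_nonneg (by positivity) (sq_nonneg _)
      linarith
    · push Not at hcase
      have h5 : (c / 2) ^ 2 ≤ r5 p := by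
        simp only [hr5]
        have : (v - Λ p.2) ^ 2 = (Λ p.2 - v) ^ 2 := by ring
        rw [← this]
        exact pow_le_pow_left₀ (by positivity) (by linarith) 2
      have h6 : 1 ≤ 4 / c ^ 2 * r5 p := by
        calc (1 : ℝ) = 4 / c ^ 2 * (c / 2) ^ 2 := by field_simp; norm_num
          _ ≤ _ := by gcongr
      have : 0 ≤ 8 / c * X := by positivity
      linarith
  have hmk := mul_meas_ge_le_integral_of_nonneg (ae_of_all (ρ.prod ν) hWnn) nW 1
  rw [one_mul] at hmk
  refine (measureReal_mono hsub).trans (hmk.trans ?_)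
  simp only [hW]
  rw [integral_add (n5.const_mul _) (n1234.const_mul _), integral_const_mul, integral_const_mul,
    integral_add n12 n34, integral_add nS1 nS2, integral_add n3 n4]
  have A1 := integral_average_le n1 e0 B1
  have A2 := integral_average_le n2 (by positivity) B2
  have h64 : 64 / c ^ 2 / m = 4 / c ^ 2 * (16 / m) := by ring
  rw [h64]
  refine add_le_add (mul_le_mul_of_nonneg_left B5 (by positivity))
    (mul_le_mul_of_nonneg_left ?_ (by positivity))
  have : (20 : ℝ) / m = 8 / m + 12 / m := by ring
  rw [this]
  linarith

end Degenerate

/-! ### Rank projections under a small change of the score -/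

section Perturbation

variable {T : Type*} [MeasurableSpace T]

/-- The event is that the score falls in an interval of length 2s. The case s = 0 is used later to
exclude atoms and hence ties. -/
theorem measureReal_abs_sub_le_of_density {ν : Measure T} {g : T → ℝ} (hg : Measurable g) {B : ℝ}
    (hB : 0 < B) (h : HasDensityBoundedBy ν g B) (a : ℝ) {s : ℝ} (hs : 0 ≤ s) :
    ν.real {w | |g w - a| ≤ s} ≤ 2 * B * s := by
  obtain ⟨f, -, hfB, hmap⟩ := h
  have hset : {w | |g w - a| ≤ s} = g ⁻¹' Set.Icc (a - s) (a + s) := by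
    ext w
    simp only [Set.mem_ofPred_eq, Set.mem_preimage, Set.mem_Icc, abs_le]
    constructor
    · rintro ⟨h1, h2⟩; constructor <;> linarith
    · rintro ⟨h1, h2⟩; constructor <;> linarith
  have hle : ν {w | |g w - a| ≤ s} ≤ ENNReal.ofReal (2 * B * s) := by
    rw [hset, ← Measure.map_apply hg measurableSet_Icc, hmap,
      withDensity_apply _ measurableSet_Icc]
    calc ∫⁻ t in Set.Icc (a - s) (a + s), f t
        ≤ ∫⁻ _ in Set.Icc (a - s) (a + s), ENNReal.ofReal B := lintegral_mono fun t => hfB t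
      _ = ENNReal.ofReal (2 * B * s) := by
        rw [setLIntegral_const, Real.volume_Icc, ← ENNReal.ofReal_mul hB.le]
        congr 1
        ring
  exact ENNReal.toReal_le_of_le_ofReal (by positivity) hle

theorem integral_measureReal_swap {P Q : Measure T} [IsProbabilityMeasure P]
    [IsProbabilityMeasure Q] {E : Set (T × T)} (hE : MeasurableSet E) :
    ∫ w, Q.real {v | (w, v) ∈ E} ∂P = ∫ v, P.real {w | (w, v) ∈ E} ∂Q := by
  have h := integral_integral_swap_of_abs_le (μ := P) (ν := Q) (C := 1)
    (f := E.indicator fun _ => (1 : ℝ)) (measurable_const.indicator hE) fun x => by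
      by_cases hx : x ∈ E <;> simp [hx]
  have e1 : ∀ w, ∫ v, E.indicator (fun _ => (1 : ℝ)) (w, v) ∂Q = Q.real {v | (w, v) ∈ E} :=
    fun w => by
      have : MeasurableSet {v | (w, v) ∈ E} := hE.preimage (by fun_prop)
      rw [← integral_indicator_one this]
      rfl
  have e2 : ∀ v, ∫ w, E.indicator (fun _ => (1 : ℝ)) (w, v) ∂P = P.real {w | (w, v) ∈ E} :=
    fun v => by
      have : MeasurableSet {w | (w, v) ∈ E} := hE.preimage (by fun_prop)
      rw [← integral_indicator_one this]
      rfl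
  simp_rw [e1, e2] at h
  exact h

theorem measurable_measureReal_right {Q : Measure T} [IsProbabilityMeasure Q] {A : Type*}
    [MeasurableSpace A] {E : Set (A × T)} (hE : MeasurableSet E) :
    Measurable fun w => Q.real {v | (w, v) ∈ E} :=
  (measurable_measure_prodMk_left hE).ennreal_toReal

theorem abs_measureReal_sub_le {Q : Measure T} [IsProbabilityMeasure Q] {A A' C : Set T}
    (h1 : A ⊆ A' ∪ C) (h2 : A' ⊆ A ∪ C) : |Q.real A - Q.real A'| ≤ Q.real C := by
  have h3 := (measureReal_mono (μ := Q) h1).trans (measureReal_union_le _ _)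
  have h4 := (measureReal_mono (μ := Q) h2).trans (measureReal_union_le _ _)
  exact abs_sub_le_iff.2 ⟨by linarith, by linarith⟩

/-- Perturbing a score with bounded density changes its rank projection little in mean square. -/
theorem integral_rank_perturbation_sq_le {P Q : Measure T} [IsProbabilityMeasure P]
    [IsProbabilityMeasure Q] {g g' : T → ℝ} (hg : Measurable g) (hg' : Measurable g')
    (hd : ∀ w, |g w - g' w| ≤ 1) {B : ℝ} (hB : 0 < B)
    (hP : ∀ a s : ℝ, 0 ≤ s → P.real {w | |g w - a| ≤ s} ≤ 2 * B * s)
    (hQ : ∀ a s : ℝ, 0 ≤ s → Q.real {w | |g w - a| ≤ s} ≤ 2 * B * s) {ε : ℝ} (hε : 0 ≤ ε) :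
    ∫ w, (Q.real {v | g w < g v} - Q.real {v | g' w < g' v}) ^ 2 ∂P ≤
      16 * B ^ 2 * ε * (∫ w, |g w - g' w| ∂P + ∫ v, |g v - g' v| ∂Q) +
        (P.real {w | ε ≤ |g w - g' w|} + Q.real {v | ε ≤ |g v - g' v|}) := by
  set Δ : T → ℝ := fun w => |g w - g' w| with hΔ
  have hΔM : Measurable Δ := (hg.sub hg').abs
  have hΔ0 : ∀ w, 0 ≤ Δ w := fun w => abs_nonneg _
  have hΔi : ∀ (μ : Measure T) [IsProbabilityMeasure μ], Integrable Δ μ := fun μ _ =>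
    integrable_of_abs_le hΔM (C := 1) fun w => by rw [abs_of_nonneg (hΔ0 w)]; exact hd w
  -- E contains every pair that `g` and `g'` order differently. It involves the law of `g` only, so
  -- no density is required of `g'`.
  set E : Set (T × T) := {p | |g p.2 - g p.1| ≤ Δ p.2 + Δ p.1} with hE
  set F : Set (T × T) := {p | |g p.2 - g p.1| ≤ 2 * Δ p.2} with hF
  have hEM : MeasurableSet E := measurableSet_le
    ((hg.comp measurable_snd).sub (hg.comp measurable_fst)).abs
    ((hΔM.comp measurable_snd).add (hΔM.comp measurable_fst))
  have hFM : MeasurableSet F := measurableSet_le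
    ((hg.comp measurable_snd).sub (hg.comp measurable_fst)).abs
    ((hΔM.comp measurable_snd).const_mul 2)
  set X : T → ℝ := fun w => Q.real {v | (w, v) ∈ E} with hX
  set Y : T → ℝ := fun w => Q.real {v | (w, v) ∈ F} with hY
  have hXM : Measurable X := measurable_measureReal_right hEM
  have hYM : Measurable Y := measurable_measureReal_right hFM
  have hX0 : ∀ w, 0 ≤ X w := fun w => measureReal_nonneg
  have hX1 : ∀ w, X w ≤ 1 := fun w => measureReal_le_one
  have hXi : Integrable X P := integrable_of_abs_le (C := 1) hXM fun w => by
    rw [abs_of_nonneg (hX0 w)]; exact hX1 w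
  have hYi : Integrable Y P := integrable_of_abs_le (C := 1) hYM fun w => by
    rw [abs_of_nonneg measureReal_nonneg]; exact measureReal_le_one
  have hUM : MeasurableSet {w | ε ≤ Δ w} := measurableSet_le measurable_const hΔM
  set ind : T → ℝ := {w | ε ≤ Δ w}.indicator 1 with hind
  have hindM : Measurable ind := measurable_one.indicator hUM
  have hind0 : ∀ w, 0 ≤ ind w := fun w => Set.indicator_nonneg (fun _ _ => zero_le_one) w
  have hindi : Integrable ind P := (integrable_const (1 : ℝ)).indicator hUM
  -- the first moment
  have hXY : ∀ w, X w ≤ 4 * B * Δ w + Y w := fun w => by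
    have hsub : {v | (w, v) ∈ E} ⊆ {v | |g v - g w| ≤ 2 * Δ w} ∪ {v | (w, v) ∈ F} := by
      intro v hv
      have hv' : |g v - g w| ≤ Δ v + Δ w := hv
      rcases le_total (Δ v) (Δ w) with h | h
      · left
        change |g v - g w| ≤ 2 * Δ w
        linarith
      · right
        change |g v - g w| ≤ 2 * Δ v
        linarith
    have h2 := hQ (g w) (2 * Δ w) (by linarith [hΔ0 w])
    have := (measureReal_mono (μ := Q) hsub).trans (measureReal_union_le _ _)
    simp only [hX, hY]
    linarith
  have hYint : ∫ w, Y w ∂P ≤ 4 * B * ∫ v, Δ v ∂Q := by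
    rw [integral_measureReal_swap hFM, ← integral_const_mul]
    refine integral_mono (integrable_of_abs_le (C := 1) ?_ fun v => ?_) ((hΔi Q).const_mul _)
      fun v => ?_
    · exact measurable_measureReal_right (E := Prod.swap ⁻¹' F) (hFM.preimage measurable_swap)
    · rw [abs_of_nonneg measureReal_nonneg]
      exact measureReal_le_one
    · have h2 := hP (g v) (2 * Δ v) (by linarith [hΔ0 v])
      have e : {w | (w, v) ∈ F} = {w | |g w - g v| ≤ 2 * Δ v} := by
        ext w
        change |g v - g w| ≤ 2 * Δ v ↔ |g w - g v| ≤ 2 * Δ v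
        rw [abs_sub_comm]
      simp only [e]
      linarith
  have hXint : ∫ w, X w ∂P ≤ 4 * B * (∫ w, Δ w ∂P + ∫ v, Δ v ∂Q) := by
    have i1 : Integrable (fun w => 4 * B * Δ w) P := (hΔi P).const_mul _
    have := integral_mono hXi (i1.add hYi) hXY
    simp only [Pi.add_apply] at this
    rw [integral_add i1 hYi, integral_const_mul] at this
    linarith
  -- the second moment
  set κ := Q.real {v | ε ≤ Δ v} with hκ
  have hκ0 : 0 ≤ κ := measureReal_nonneg
  have hXε : ∀ w, X w ≤ 4 * B * ε + κ + ind w := fun w => by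
    by_cases hw : ε ≤ Δ w
    · have : ind w = 1 := Set.indicator_of_mem (s := {w | ε ≤ Δ w}) hw 1
      rw [this]
      have h2 : 0 ≤ 4 * B * ε := by positivity
      linarith [hX1 w]
    · have hsub : {v | (w, v) ∈ E} ⊆ {v | |g v - g w| ≤ 2 * ε} ∪ {v | ε ≤ Δ v} := by
        intro v hv
        have hv' : |g v - g w| ≤ Δ v + Δ w := hv
        rcases le_total ε (Δ v) with h | h
        · exact Or.inr h
        · left
          change |g v - g w| ≤ 2 * ε
          linarith
      have h2 := hQ (g w) (2 * ε) (by linarith)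
      have := (measureReal_mono (μ := Q) hsub).trans (measureReal_union_le _ _)
      have h3 := hind0 w
      simp only [hX]
      linarith
  have hmain : ∀ w, (Q.real {v | g w < g v} - Q.real {v | g' w < g' v}) ^ 2 ≤
      4 * B * ε * X w + κ + ind w := fun w => by
    have h1 : |Q.real {v | g w < g v} - Q.real {v | g' w < g' v}| ≤ X w := by
      refine abs_measureReal_sub_le ?_ ?_
      · intro v hv
        by_cases hv' : g' w < g' v
        · exact Or.inl hv'
        · right
          change |g v - g w| ≤ |g v - g' v| + |g w - g' w|
          have hv2 : g w < g v := hv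
          rw [abs_of_pos (by linarith)]
          push Not at hv'
          linarith [le_abs_self (g v - g' v), neg_le_abs (g w - g' w)]
      · intro v hv
        by_cases hv' : g w < g v
        · exact Or.inl hv'
        · right
          change |g v - g w| ≤ |g v - g' v| + |g w - g' w|
          have hv2 : g' w < g' v := hv
          push Not at hv'
          rw [abs_of_nonpos (by linarith)]
          linarith [neg_le_abs (g v - g' v), le_abs_self (g w - g' w)]
    have h2 := pow_le_pow_left₀ (abs_nonneg _) h1 2
    rw [sq_abs] at h2
    -- Only one factor X is replaced by its bound off the tail; the other is kept for its first
    -- moment. This gives ε·E|Δ| instead of ε². With the threshold used later, ε² is of order 1/N,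
    -- and N replacements would not sum to something vanishing.
    have h3 : X w ^ 2 ≤ (4 * B * ε + κ + ind w) * X w := by
      rw [sq]
      exact mul_le_mul_of_nonneg_right (hXε w) (hX0 w)
    have h4 : (κ + ind w) * X w ≤ κ + ind w :=
      mul_le_of_le_one_right (add_nonneg hκ0 (hind0 w)) (hX1 w)
    linarith
  have i1 : Integrable (fun w => 4 * B * ε * X w) P := hXi.const_mul _
  have i2 : Integrable (fun w => 4 * B * ε * X w + κ) P := i1.add (integrable_const _)
  have hφM : Measurable fun w => (Q.real {v | g w < g v} - Q.real {v | g' w < g' v}) ^ 2 := by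
    refine Measurable.pow_const (Measurable.sub ?_ ?_) 2
    · exact measurable_measureReal_right (E := {p : T × T | g p.1 < g p.2})
        (measurableSet_lt (hg.comp measurable_fst) (hg.comp measurable_snd))
    · exact measurable_measureReal_right (E := {p : T × T | g' p.1 < g' p.2})
        (measurableSet_lt (hg'.comp measurable_fst) (hg'.comp measurable_snd))
  have hfin := integral_mono (integrable_of_abs_le (μ := P) (C := 1 ^ 2) hφM fun w =>
    sq_le_of_abs_le <| abs_sub_le_iff.2
      ⟨by linarith [measureReal_le_one (μ := Q) (s := {v | g w < g v}),
          measureReal_nonneg (μ := Q) (s := {v | g' w < g' v})],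
        by linarith [measureReal_le_one (μ := Q) (s := {v | g' w < g' v}),
          measureReal_nonneg (μ := Q) (s := {v | g w < g v})]⟩) (i2.add hindi) hmain
  simp only [Pi.add_apply] at hfin
  rw [integral_add i2 hindi, integral_add i1 (integrable_const _), integral_const_mul,
    integral_indicator_one hUM] at hfin
  simp only [integral_const, probReal_univ, one_smul] at hfin
  have hmul := mul_le_mul_of_nonneg_left hXint (by positivity : 0 ≤ 4 * B * ε)
  have e : 4 * B * ε * (4 * B * (∫ w, Δ w ∂P + ∫ v, Δ v ∂Q)) =
    16 * B ^ 2 * ε * (∫ w, Δ w ∂P + ∫ v, Δ v ∂Q) := by ring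
  linarith

theorem integral_abs_le_of_isSubWeibull {ν : Measure T} [IsProbabilityMeasure ν] {W : T → ℝ}
    (hW : Measurable W) {κ β : ℝ} (hκ : 0 < κ) (hβ : 0 < β) (h : IsSubWeibull ν W κ β) :
    ∫ s, |W s| ∂ν ≤ 2 * Real.Gamma (β + 1) * κ := by
  have hp : 0 < 1 / β := by positivity
  have hG : ∫ t in Set.Ioi (0 : ℝ), Real.exp (-(κ ^ (-(1 / β))) * t ^ (1 / β)) =
      κ * Real.Gamma (β + 1) := by
    rw [integral_exp_neg_mul_rpow hp (by positivity), ← Real.rpow_mul hκ.le]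
    congr 1
    · have : -(1 / β) * (-1 / (1 / β)) = 1 := by field_simp
      rw [this, Real.rpow_one]
    · rw [one_div_one_div]
  have hpt : ∀ t ∈ Set.Ioi (0 : ℝ), 2 * Real.exp (-(t / κ) ^ (1 / β)) =
      2 * Real.exp (-(κ ^ (-(1 / β))) * t ^ (1 / β)) := fun t ht => by
    rw [Real.div_rpow (le_of_lt ht) hκ.le, Real.rpow_neg hκ.le]
    congr 2
    field_simp
  have hGpos : 0 < κ * Real.Gamma (β + 1) := mul_pos hκ (Real.Gamma_pos_of_pos (by linarith))
  -- The integral of a non-integrable function is 0 by default, whereas this one has a positive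
  -- value.
  have hint : IntegrableOn (fun t : ℝ => Real.exp (-(κ ^ (-(1 / β))) * t ^ (1 / β)))
      (Set.Ioi 0) := by
    by_contra hcon
    rw [integral_undef hcon] at hG
    exact hGpos.ne hG
  rw [integral_eq_lintegral_of_nonneg_ae (ae_of_all _ fun s => abs_nonneg _)
    hW.abs.aestronglyMeasurable]
  refine ENNReal.toReal_le_of_le_ofReal (by linarith) ?_
  rw [lintegral_eq_lintegral_meas_le ν (ae_of_all _ fun s => abs_nonneg _) hW.abs.aemeasurable]
  calc ∫⁻ t in Set.Ioi (0 : ℝ), ν {a | t ≤ |W a|}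
      ≤ ∫⁻ t in Set.Ioi (0 : ℝ),
          ENNReal.ofReal (2 * Real.exp (-(κ ^ (-(1 / β))) * t ^ (1 / β))) := by
        refine setLIntegral_mono' measurableSet_Ioi fun t ht => ?_
        rw [← hpt t ht]
        exact h t (le_of_lt ht)
    _ = ENNReal.ofReal (∫ t in Set.Ioi (0 : ℝ),
          2 * Real.exp (-(κ ^ (-(1 / β))) * t ^ (1 / β))) :=
        (ofReal_integral_eq_lintegral_ofReal (hint.const_mul 2)
          (ae_of_all _ fun t => by positivity)).symm
    _ = ENNReal.ofReal (2 * Real.Gamma (β + 1) * κ) := by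
        rw [integral_const_mul, hG]
        congr 1
        ring

theorem measureReal_le_of_isSubWeibull {ν : Measure T} {W : T → ℝ}
    {κ β : ℝ} (h : IsSubWeibull ν W κ β) {t : ℝ} (ht : 0 ≤ t) :
    ν.real {s | t ≤ |W s|} ≤ 2 * Real.exp (-(t / κ) ^ (1 / β)) :=
  ENNReal.toReal_le_of_le_ofReal (by positivity) (h t ht)

end Perturbation

/-! ### The rank indicator as a kernel with values in [0, 1] -/

section RankIndicator

variable {𝒳 𝒴 : Type*}

theorem rankInd_nonneg (g : 𝒳 × 𝒴 → ℝ) (w v : 𝒳 × 𝒴) : 0 ≤ rankInd g w v := by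
  unfold rankInd
  split_ifs <;> norm_num

theorem rankInd_le_one (g : 𝒳 × 𝒴 → ℝ) (w v : 𝒳 × 𝒴) : rankInd g w v ≤ 1 := by
  unfold rankInd
  split_ifs <;> norm_num

theorem rankInd_eq_indicator (g : 𝒳 × 𝒴 → ℝ) (w v : 𝒳 × 𝒴) :
    rankInd g w v = {p : (𝒳 × 𝒴) × 𝒳 × 𝒴 | g p.1 < g p.2}.indicator 1 (w, v) := by
  classical
  simp [rankInd, Set.indicator_apply]

end RankIndicator

/-! ### Marginals of the triplet law and projections of the rank kernel -/

section Model

variable {𝒳 𝒴 : Type*} [MeasurableSpace 𝒳] [MeasurableSpace 𝒴]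

instance instIsProbabilityMeasureJointLaw (PX : Measure 𝒳) [IsProbabilityMeasure PX]
    (η : Kernel 𝒳 𝒴) [IsMarkovKernel η] : IsProbabilityMeasure (jointLaw PX η) := by
  unfold jointLaw
  infer_instance

instance instIsProbabilityMeasureTripleLaw (PX : Measure 𝒳) [IsProbabilityMeasure PX]
    (η ηhat : Kernel 𝒳 𝒴) [IsMarkovKernel η] [IsMarkovKernel ηhat] :
    IsProbabilityMeasure (tripleLaw PX η ηhat) := by
  unfold tripleLaw
  infer_instance

instance instIsProbabilityMeasureDataLaw (PX : Measure 𝒳) [IsProbabilityMeasure PX]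
    (η ηhat : Kernel 𝒳 𝒴) [IsMarkovKernel η] [IsMarkovKernel ηhat] (n : ℕ) :
    IsProbabilityMeasure (dataLaw PX η ηhat n) := by
  unfold dataLaw
  infer_instance

theorem measurable_truePair : Measurable (truePair : Triple 𝒳 𝒴 → 𝒳 × 𝒴) := by
  unfold truePair
  fun_prop

theorem measurable_modelPair : Measurable (modelPair : Triple 𝒳 𝒴 → 𝒳 × 𝒴) := by
  unfold modelPair
  fun_prop

theorem integral_rankInd_right (PX : Measure 𝒳) (ηhat : Kernel 𝒳 𝒴) {g : 𝒳 × 𝒴 → ℝ} (hg : Measurable g)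
    (w : 𝒳 × 𝒴) :
    ∫ v, rankInd g w v ∂(jointLaw PX ηhat) = proj₁ PX ηhat g w := by
  unfold proj₁
  rw [← integral_indicator_one (measurableSet_lt measurable_const hg)]
  simp_rw [rankInd_eq_indicator]
  rfl

theorem integral_rankInd_left (PX : Measure 𝒳) (η : Kernel 𝒳 𝒴) {g : 𝒳 × 𝒴 → ℝ} (hg : Measurable g)
    (v : 𝒳 × 𝒴) :
    ∫ w, rankInd g w v ∂(jointLaw PX η) = proj₂ PX η g v := by
  unfold proj₂
  rw [← integral_indicator_one (measurableSet_lt hg measurable_const)]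
  simp_rw [rankInd_eq_indicator]
  rfl

variable (PX : Measure 𝒳) [IsProbabilityMeasure PX]
  (η ηhat : Kernel 𝒳 𝒴) [IsMarkovKernel η] [IsMarkovKernel ηhat]

/-- The first marginal of a product with a Markov kernel is the first kernel. -/
theorem measurePreserving_truePair :
    MeasurePreserving truePair (tripleLaw PX η ηhat) (jointLaw PX η) := by
  refine ⟨measurable_truePair, ?_⟩
  unfold jointLaw tripleLaw
  nth_rw 2 [← Kernel.fst_prod η ηhat]
  rw [Kernel.fst_eq, Measure.compProd_map measurable_fst]
  rfl

theorem measurePreserving_modelPair :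
    MeasurePreserving modelPair (tripleLaw PX η ηhat) (jointLaw PX ηhat) := by
  refine ⟨measurable_modelPair, ?_⟩
  unfold jointLaw tripleLaw
  nth_rw 2 [← Kernel.snd_prod η ηhat]
  rw [Kernel.snd_eq, Measure.compProd_map measurable_snd]
  rfl

theorem MeasurePreserving.integral_comp_of_measurable {S T : Type*} [MeasurableSpace S]
    [MeasurableSpace T] {μ : Measure S} {ν : Measure T} {f : S → T}
    (hf : MeasurePreserving f μ ν) {h : T → ℝ} (hh : Measurable h) :
    ∫ s, h (f s) ∂μ = ∫ t, h t ∂ν := by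
  rw [← hf.map_eq, integral_map hf.measurable.aemeasurable hh.aestronglyMeasurable]

/-- The kernel `1{g(X_i, Y_i) < g(X_j, Y'_j)}` on triplets. -/
def rankKernel (g : 𝒳 × 𝒴 → ℝ) (s t : Triple 𝒳 𝒴) : ℝ := rankInd g (truePair s) (modelPair t)

theorem measurable_rankKernel_param {Ω : Type*} [MeasurableSpace Ω] {g : Ω → 𝒳 × 𝒴 → ℝ}
    (hg : Measurable fun p : Ω × (𝒳 × 𝒴) => g p.1 p.2) :
    Measurable fun p : Ω × Triple 𝒳 𝒴 × Triple 𝒳 𝒴 => rankKernel (g p.1) p.2.1 p.2.2 := by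
  unfold rankKernel rankInd
  refine Measurable.ite (measurableSet_lt ?_ ?_) measurable_const measurable_const
  · exact hg.comp (measurable_fst.prodMk
      (measurable_truePair.comp (measurable_fst.comp measurable_snd)))
  · exact hg.comp (measurable_fst.prodMk
      (measurable_modelPair.comp (measurable_snd.comp measurable_snd)))

theorem measurable_rankInd_left {g : 𝒳 × 𝒴 → ℝ} (hg : Measurable g) (v : 𝒳 × 𝒴) :
    Measurable fun w => rankInd g w v := by
  unfold rankInd
  exact Measurable.ite (measurableSet_lt hg measurable_const) measurable_const measurable_const

theorem measurable_rankInd_right {g : 𝒳 × 𝒴 → ℝ} (hg : Measurable g) (w : 𝒳 × 𝒴) :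
    Measurable fun v => rankInd g w v := by
  unfold rankInd
  exact Measurable.ite (measurableSet_lt measurable_const hg) measurable_const measurable_const

theorem integral_rankKernel_right {g : 𝒳 × 𝒴 → ℝ} (hg : Measurable g) (s : Triple 𝒳 𝒴) :
    ∫ t, rankKernel g s t ∂(tripleLaw PX η ηhat) = proj₁ PX ηhat g (truePair s) := by
  rw [← integral_rankInd_right PX ηhat hg]
  exact MeasurePreserving.integral_comp_of_measurable (measurePreserving_modelPair PX η ηhat)
    (measurable_rankInd_right hg (truePair s))

theorem integral_rankKernel_left {g : 𝒳 × 𝒴 → ℝ} (hg : Measurable g) (s : Triple 𝒳 𝒴) :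
    ∫ t, rankKernel g t s ∂(tripleLaw PX η ηhat) = proj₂ PX η g (modelPair s) := by
  rw [← integral_rankInd_left PX η hg]
  exact MeasurePreserving.integral_comp_of_measurable (measurePreserving_truePair PX η ηhat)
    (measurable_rankInd_left hg (modelPair s))

theorem kernelProj_rankKernel {g : 𝒳 × 𝒴 → ℝ} (hg : Measurable g) (s : Triple 𝒳 𝒴) :
    kernelProj (tripleLaw PX η ηhat) (rankKernel g) s =
      proj₁ PX ηhat g (truePair s) + proj₂ PX η g (modelPair s) := by
  unfold kernelProj
  rw [integral_rankKernel_right PX η ηhat hg, integral_rankKernel_left PX η ηhat hg]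

theorem measurable_proj₁ {g : 𝒳 × 𝒴 → ℝ} (hg : Measurable g) : Measurable (proj₁ PX ηhat g) :=
  measurable_measureReal_right (E := {p : (𝒳 × 𝒴) × 𝒳 × 𝒴 | g p.1 < g p.2})
    (measurableSet_lt (hg.comp measurable_fst) (hg.comp measurable_snd))

theorem measurable_proj₂ {g : 𝒳 × 𝒴 → ℝ} (hg : Measurable g) : Measurable (proj₂ PX η g) :=
  measurable_measureReal_right (E := {p : (𝒳 × 𝒴) × 𝒳 × 𝒴 | g p.2 < g p.1})
    (measurableSet_lt (hg.comp measurable_snd) (hg.comp measurable_fst))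

theorem abs_proj₁_le_one (g : 𝒳 × 𝒴 → ℝ) (w : 𝒳 × 𝒴) : |proj₁ PX ηhat g w| ≤ 1 := by
  unfold proj₁
  rw [abs_of_nonneg measureReal_nonneg]
  exact measureReal_le_one

theorem abs_proj₂_le_one (g : 𝒳 × 𝒴 → ℝ) (w : 𝒳 × 𝒴) : |proj₂ PX η g w| ≤ 1 := by
  unfold proj₂
  rw [abs_of_nonneg measureReal_nonneg]
  exact measureReal_le_one

theorem integral_integral_rankKernel {g : 𝒳 × 𝒴 → ℝ} (hg : Measurable g) :
    ∫ s, ∫ t, rankKernel g s t ∂(tripleLaw PX η ηhat) ∂(tripleLaw PX η ηhat) =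
      ((jointLaw PX η).prod (jointLaw PX ηhat)).real {p | g p.1 < g p.2} := by
  have hM : MeasurableSet {p : (𝒳 × 𝒴) × 𝒳 × 𝒴 | g p.1 < g p.2} :=
    measurableSet_lt (hg.comp measurable_fst) (hg.comp measurable_snd)
  simp_rw [integral_rankKernel_right PX η ηhat hg]
  rw [MeasurePreserving.integral_comp_of_measurable (measurePreserving_truePair PX η ηhat)
    (measurable_proj₁ PX ηhat hg), ← integral_indicator_one hM, integral_prod]
  · simp_rw [← integral_rankInd_right PX ηhat hg, rankInd_eq_indicator]
  · exact (integrable_const (1 : ℝ)).indicator hM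

/-- The mean square effect of replacing a score on the sum of its projections. -/
theorem integral_kernelProj_perturbation_sq_le {g g' : 𝒳 × 𝒴 → ℝ} (hg : Measurable g)
    (hg' : Measurable g') (hd : ∀ w, |g w - g' w| ≤ 1) {B : ℝ} (hB : 0 < B)
    (hP : HasDensityBoundedBy (jointLaw PX η) g B)
    (hQ : HasDensityBoundedBy (jointLaw PX ηhat) g B) {ε : ℝ} (hε : 0 ≤ ε) :
    ∫ z, (kernelProj (tripleLaw PX η ηhat) (rankKernel g) z -
        kernelProj (tripleLaw PX η ηhat) (rankKernel g') z) ^ 2 ∂(tripleLaw PX η ηhat) ≤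
      4 * (16 * B ^ 2 * ε * (∫ w, |g w - g' w| ∂(jointLaw PX η) +
          ∫ v, |g v - g' v| ∂(jointLaw PX ηhat)) +
        ((jointLaw PX η).real {w | ε ≤ |g w - g' w|} +
          (jointLaw PX ηhat).real {v | ε ≤ |g v - g' v|})) := by
  have hP' := fun a s => measureReal_abs_sub_le_of_density hg hB hP a (s := s)
  have hQ' := fun a s => measureReal_abs_sub_le_of_density hg hB hQ a (s := s)
  have h1 := integral_rank_perturbation_sq_le (P := jointLaw PX η) (Q := jointLaw PX ηhat)
    hg hg' hd hB hP' hQ' hε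
  have hneg : ∀ (ν : Measure (𝒳 × 𝒴)), (∀ a s : ℝ, 0 ≤ s → ν.real {w | |g w - a| ≤ s} ≤ 2 * B * s) →
      ∀ a s : ℝ, 0 ≤ s → ν.real {w | |-g w - a| ≤ s} ≤ 2 * B * s := fun ν h a s hs => by
    have := h (-a) s hs
    have e : ∀ w, |-g w - a| = |g w - -a| := fun w => by
      rw [← abs_neg]; congr 1; ring
    simp_rw [e]
    exact this
  have hsw : ∀ w, |-g w - -g' w| = |g w - g' w| := fun w => by
    rw [← abs_neg]; congr 1; ring
  -- Negating the scores reverses the order, so the same bound with P and Q exchanged handles the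
  -- second projection.
  have h2 := integral_rank_perturbation_sq_le (P := jointLaw PX ηhat) (Q := jointLaw PX η)
    (g := fun w => -g w) (g' := fun w => -g' w) hg.neg hg'.neg (fun w => by rw [hsw]; exact hd w)
    hB (hneg _ hQ') (hneg _ hP') hε
  simp only [hsw, neg_lt_neg_iff] at h2
  have hM1 : Measurable fun w => (proj₁ PX ηhat g w - proj₁ PX ηhat g' w) ^ 2 :=
    ((measurable_proj₁ PX ηhat hg).sub (measurable_proj₁ PX ηhat hg')).pow_const 2
  have hM2 : Measurable fun w => (proj₂ PX η g w - proj₂ PX η g' w) ^ 2 :=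
    ((measurable_proj₂ PX η hg).sub (measurable_proj₂ PX η hg')).pow_const 2
  have b1 : ∀ w, |(proj₁ PX ηhat g w - proj₁ PX ηhat g' w) ^ 2| ≤ (2 * 1) ^ 2 := fun w =>
    sq_le_of_abs_le (abs_sub_le_two (abs_proj₁_le_one PX ηhat _ _)
      (abs_proj₁_le_one PX ηhat _ _))
  have b2 : ∀ w, |(proj₂ PX η g w - proj₂ PX η g' w) ^ 2| ≤ (2 * 1) ^ 2 := fun w =>
    sq_le_of_abs_le (abs_sub_le_two (abs_proj₂_le_one PX η _ _)
      (abs_proj₂_le_one PX η _ _))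
  have i1 : Integrable (fun z : Triple 𝒳 𝒴 =>
      2 * (proj₁ PX ηhat g (truePair z) - proj₁ PX ηhat g' (truePair z)) ^ 2)
      (tripleLaw PX η ηhat) :=
    (integrable_of_abs_le (hM1.comp measurable_truePair) fun z => b1 _).const_mul 2
  have i2 : Integrable (fun z : Triple 𝒳 𝒴 =>
      2 * (proj₂ PX η g (modelPair z) - proj₂ PX η g' (modelPair z)) ^ 2)
      (tripleLaw PX η ηhat) :=
    (integrable_of_abs_le (hM2.comp measurable_modelPair) fun z => b2 _).const_mul 2
  have hle : ∀ z, (kernelProj (tripleLaw PX η ηhat) (rankKernel g) z -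
        kernelProj (tripleLaw PX η ηhat) (rankKernel g') z) ^ 2 ≤
      2 * (proj₁ PX ηhat g (truePair z) - proj₁ PX ηhat g' (truePair z)) ^ 2 +
      2 * (proj₂ PX η g (modelPair z) - proj₂ PX η g' (modelPair z)) ^ 2 := fun z => by
    rw [kernelProj_rankKernel PX η ηhat hg, kernelProj_rankKernel PX η ηhat hg']
    nlinarith [sq_nonneg ((proj₁ PX ηhat g (truePair z) - proj₁ PX ηhat g' (truePair z)) -
      (proj₂ PX η g (modelPair z) - proj₂ PX η g' (modelPair z)))]
  have hint := integral_mono_of_nonneg (μ := tripleLaw PX η ηhat)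
    (ae_of_all _ fun z => sq_nonneg _) (i1.add i2) (ae_of_all _ hle)
  simp only [Pi.add_apply] at hint
  rw [integral_add i1 i2, integral_const_mul, integral_const_mul,
    MeasurePreserving.integral_comp_of_measurable (measurePreserving_truePair PX η ηhat) hM1,
    MeasurePreserving.integral_comp_of_measurable (measurePreserving_modelPair PX η ηhat) hM2]
    at hint
  unfold proj₁ proj₂ at hint
  linarith

theorem integral_prod_prod_of_abs_le {Ω S T : Type*} [MeasurableSpace Ω] [MeasurableSpace S]
    [MeasurableSpace T] {ρ : Measure Ω} [IsProbabilityMeasure ρ] {μ : Measure S}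
    [IsProbabilityMeasure μ] {P : Measure T} [IsProbabilityMeasure P] {G : Ω × S × T → ℝ}
    (hG : Measurable G) {C : ℝ} (hC : ∀ x, |G x| ≤ C) :
    ∫ p, ∫ w, G (p.1, p.2, w) ∂P ∂(ρ.prod μ) = ∫ x, G x ∂(ρ.prod (μ.prod P)) := by
  have hG' : Measurable fun q : (Ω × S) × T => G (q.1.1, q.1.2, q.2) := hG.comp (by fun_prop)
  rw [integral_prod _ (integrable_of_abs_le hG hC), integral_prod _ (integrable_of_abs_le
    (measurable_integral_right hG') fun p => abs_integral_le_of_abs_le fun w => hC _)]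
  refine integral_congr_ae (ae_of_all _ fun ω => ?_)
  simp only
  have hGω : Measurable fun q : S × T => G (ω, q) := hG.comp (by fun_prop)
  rw [integral_prod _ (integrable_of_abs_le hGω fun p => hC _)]

end Model

/-! ### Concentration of the conditional projection over the fitting sample -/

section Concentration

/-- The Efron–Stein inequality for a family of functions, integrated over the parameter. -/
theorem integral_efron_stein {S V : Type*} [MeasurableSpace S] [MeasurableSpace V]
    {μ : Measure S} [IsProbabilityMeasure μ] {ν : Measure V} [IsProbabilityMeasure ν] {n : ℕ}
    {f : (Fin n → S) → V → ℝ} (hf : Measurable fun p : (Fin n → S) × V => f p.1 p.2) {C : ℝ}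
    (hC : ∀ d v, |f d v| ≤ C) :
    ∫ v, ∫ d, (f d v - ∫ d', f d' v ∂(Measure.pi fun _ => μ)) ^ 2 ∂(Measure.pi fun _ => μ) ∂ν ≤
      1 / 2 * ∑ i : Fin n, ∫ p, ∫ v, (f p.1 v - f (Function.update p.1 i p.2) v) ^ 2 ∂ν
        ∂((Measure.pi fun _ : Fin n => μ).prod μ) := by
  set ρ : Measure (Fin n → S) := Measure.pi fun _ => μ with hρ
  have hfd : ∀ v, Measurable fun d => f d v := fun v =>
    hf.comp (f := fun d => (d, v)) (by fun_prop)
  have hqM : ∀ i : Fin n, Measurable fun p : V × (Fin n → S) × S =>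
      (f p.2.1 p.1 - f (Function.update p.2.1 i p.2.2) p.1) ^ 2 := fun i => by
    have hu : Measurable fun p : V × (Fin n → S) × S =>
        (Function.update p.2.1 i p.2.2, p.1) :=
      ((measurable_update_pair i).comp measurable_snd).prodMk measurable_fst
    exact ((hf.comp (by fun_prop : Measurable fun p : V × (Fin n → S) × S => (p.2.1, p.1))).sub
      (hf.comp hu)).pow_const 2
  have hqb : ∀ (i : Fin n) (p : V × (Fin n → S) × S),
      |(f p.2.1 p.1 - f (Function.update p.2.1 i p.2.2) p.1) ^ 2| ≤ (2 * C) ^ 2 := fun i p =>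
    sq_le_of_abs_le (abs_sub_le_two (hC _ _) (hC _ _))
  have hqint : ∀ i : Fin n, Integrable (fun v => ∫ p, (f p.1 v -
      f (Function.update p.1 i p.2) v) ^ 2 ∂(ρ.prod μ)) ν := fun i =>
    integrable_of_abs_le (measurable_integral_right (hqM i)) fun v =>
      abs_integral_le_of_abs_le fun p => hqb i (v, p)
  have hES : ∀ v, ∫ d, (f d v - ∫ d', f d' v ∂ρ) ^ 2 ∂ρ ≤
      1 / 2 * ∑ i : Fin n, ∫ p, (f p.1 v - f (Function.update p.1 i p.2) v) ^ 2 ∂(ρ.prod μ) :=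
    fun v => by
      refine (efron_stein (hfd v) fun d => hC d v).trans (le_of_eq ?_)
      congr 1
      refine Finset.sum_congr rfl fun i _ => ?_
      have hint : Integrable (fun p : (Fin n → S) × S =>
          (f p.1 v - f (Function.update p.1 i p.2) v) ^ 2) (ρ.prod μ) :=
        integrable_of_abs_le ((hqM i).comp (by fun_prop : Measurable fun p :
          (Fin n → S) × S => (v, p))) fun p => hqb i (v, p)
      rw [integral_prod _ hint]
  calc ∫ v, ∫ d, (f d v - ∫ d', f d' v ∂ρ) ^ 2 ∂ρ ∂ν
      ≤ ∫ v, 1 / 2 * ∑ i : Fin n, ∫ p, (f p.1 v - f (Function.update p.1 i p.2) v) ^ 2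
          ∂(ρ.prod μ) ∂ν := by
        refine integral_mono_of_nonneg
          (ae_of_all _ fun v => integral_nonneg fun d => sq_nonneg _) ?_ (ae_of_all _ hES)
        exact (integrable_finsetSum _ fun i _ => hqint i).const_mul _
    _ = 1 / 2 * ∑ i : Fin n, ∫ v, ∫ p, (f p.1 v - f (Function.update p.1 i p.2) v) ^ 2
          ∂(ρ.prod μ) ∂ν := by
        rw [integral_const_mul, integral_finsetSum _ fun i _ => hqint i]
    _ = _ := by
        congr 1
        exact Finset.sum_congr rfl fun i _ => integral_integral_swap_of_abs_le (f := fun p :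
          V × (Fin n → S) × S => (f p.2.1 p.1 - f (Function.update p.2.1 i p.2.2) p.1) ^ 2)
          (hqM i) (hqb i)

theorem integral_weighted_sum {S : Type*} [MeasurableSpace S] {μ : Measure S} {a b t u : S → ℝ}
    (c : ℝ) (ha : Integrable a μ) (hb : Integrable b μ) (ht : Integrable t μ)
    (hu : Integrable u μ) :
    ∫ p, 4 * (c * (a p + b p) + (t p + u p)) ∂μ =
      4 * (c * (∫ p, a p ∂μ + ∫ p, b p ∂μ) + (∫ p, t p ∂μ + ∫ p, u p ∂μ)) := by
  have h1 : Integrable (fun p => a p + b p) μ := ha.add hb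
  have h2 : Integrable (fun p => t p + u p) μ := ht.add hu
  rw [integral_const_mul, integral_add (h1.const_mul c) h2, integral_const_mul,
    integral_add ha hb, integral_add ht hu]

variable {𝒳 𝒴 : Type*} [MeasurableSpace 𝒳] [MeasurableSpace 𝒴]

theorem DistinguisherProcedure.measurable_fit_apply (A : DistinguisherProcedure 𝒳 𝒴) (N : ℕ)
    (d : Fin N → Triple 𝒳 𝒴) : Measurable (A.fit N d) :=
  (A.measurable_fit N).comp (f := fun w => (d, w)) (by fun_prop)

theorem abs_sub_le_one_of_mem_Icc {a b : ℝ} (ha : a ∈ Set.Icc (0 : ℝ) 1)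
    (hb : b ∈ Set.Icc (0 : ℝ) 1) : |a - b| ≤ 1 :=
  abs_sub_le_iff.2 ⟨by linarith [ha.2, hb.1], by linarith [ha.1, hb.2]⟩

theorem measurable_perturbOne (A : DistinguisherProcedure 𝒳 𝒴) (N : ℕ) (i : Fin N) :
    Measurable (perturbOne A N i) := by
  unfold perturbOne
  have hu : Measurable fun p : (Fin N → Triple 𝒳 𝒴) × Triple 𝒳 𝒴 × (𝒳 × 𝒴) =>
      (Function.update p.1 i p.2.1, p.2.2) :=
    ((measurable_update_pair i).comp (by fun_prop :
      Measurable fun p : (Fin N → Triple 𝒳 𝒴) × Triple 𝒳 𝒴 × (𝒳 × 𝒴) =>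
        (p.1, p.2.1))).prodMk (by fun_prop)
  exact ((A.measurable_fit N).comp (by fun_prop :
    Measurable fun p : (Fin N → Triple 𝒳 𝒴) × Triple 𝒳 𝒴 × (𝒳 × 𝒴) => (p.1, p.2.2))).sub
    ((A.measurable_fit N).comp hu)

theorem abs_perturbOne_le_one (A : DistinguisherProcedure 𝒳 𝒴) (N : ℕ) (i : Fin N)
    (p : (Fin N → Triple 𝒳 𝒴) × Triple 𝒳 𝒴 × (𝒳 × 𝒴)) : |perturbOne A N i p| ≤ 1 :=
  abs_sub_le_one_of_mem_Icc (A.fit_mem _ _ _) (A.fit_mem _ _ _)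

variable (PX : Measure 𝒳) [IsProbabilityMeasure PX]
  (η ηhat : Kernel 𝒳 𝒴) [IsMarkovKernel η] [IsMarkovKernel ηhat]

/-- The rank perturbation bound needs from the sub-Weibull condition only a first moment of order κ
and a tail at ε. The nested integrals isolate the evaluation point, because that bound is applied
for a fixed data set and a fixed replacement. -/
theorem integral_perturbOne_moments_le (A : DistinguisherProcedure 𝒳 𝒴) {N : ℕ} (i : Fin N)
    {Q : Measure (𝒳 × 𝒴)} [IsProbabilityMeasure Q] {κ β ε : ℝ} (hκ : 0 < κ) (hβ : 0 < β)
    (hε : 0 ≤ ε)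
    (h : IsSubWeibull ((dataLaw PX η ηhat N).prod ((tripleLaw PX η ηhat).prod Q))
      (perturbOne A N i) κ β) :
    ∫ p, ∫ w, |perturbOne A N i (p.1, p.2, w)| ∂Q
        ∂((dataLaw PX η ηhat N).prod (tripleLaw PX η ηhat)) ≤ 2 * Real.Gamma (β + 1) * κ ∧
      ∫ p, Q.real {w | ε ≤ |perturbOne A N i (p.1, p.2, w)|}
        ∂((dataLaw PX η ηhat N).prod (tripleLaw PX η ηhat)) ≤
          2 * Real.exp (-(ε / κ) ^ (1 / β)) := by
  have hM := measurable_perturbOne A N i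
  constructor
  · rw [integral_prod_prod_of_abs_le (G := fun x => |perturbOne A N i x|) (C := 1) hM.abs
      fun x => by rw [abs_abs]; exact abs_perturbOne_le_one A N i x]
    exact integral_abs_le_of_isSubWeibull hM hκ hβ h
  · have hS : MeasurableSet {x | ε ≤ |perturbOne A N i x|} :=
      measurableSet_le measurable_const hM.abs
    have e : ∀ p : (Fin N → Triple 𝒳 𝒴) × Triple 𝒳 𝒴,
        Q.real {w | ε ≤ |perturbOne A N i (p.1, p.2, w)|} =
        ∫ w, {x | ε ≤ |perturbOne A N i x|}.indicator 1 (p.1, p.2, w) ∂Q := fun p => by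
      have hS' : MeasurableSet {w | ε ≤ |perturbOne A N i (p.1, p.2, w)|} :=
        hS.preimage (by fun_prop : Measurable fun w : 𝒳 × 𝒴 => (p.1, p.2, w))
      rw [← integral_indicator_one hS']
      rfl
    simp_rw [e]
    rw [integral_prod_prod_of_abs_le (C := 1) (measurable_one.indicator hS) fun x => by
      by_cases hx : x ∈ {x | ε ≤ |perturbOne A N i x|} <;> simp [hx], integral_indicator_one hS]
    exact measureReal_le_of_isSubWeibull h hε

/-- The mean square effect of resampling one observation of the fitting sample on the projection
of the cross-fit rank kernel. -/
theorem integral_perturbation_step_le (A : DistinguisherProcedure 𝒳 𝒴) {N : ℕ} (i : Fin N)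
    {B κ β ε : ℝ} (hB : 0 < B) (hκ : 0 < κ) (hβ : 0 < β) (hε : 0 ≤ ε)
    (hdens : ∀ d : Fin N → Triple 𝒳 𝒴, HasDensityBoundedBy (jointLaw PX η) (A.fit N d) B ∧
      HasDensityBoundedBy (jointLaw PX ηhat) (A.fit N d) B)
    (hstab :
      IsSubWeibull ((dataLaw PX η ηhat N).prod ((tripleLaw PX η ηhat).prod (jointLaw PX η)))
        (perturbOne A N i) κ β ∧
      IsSubWeibull ((dataLaw PX η ηhat N).prod ((tripleLaw PX η ηhat).prod (jointLaw PX ηhat)))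
        (perturbOne A N i) κ β) :
    ∫ p, ∫ s, (kernelProj (tripleLaw PX η ηhat) (rankKernel (A.fit N p.1)) s -
        kernelProj (tripleLaw PX η ηhat) (rankKernel (A.fit N (Function.update p.1 i p.2))) s) ^ 2
        ∂(tripleLaw PX η ηhat) ∂((dataLaw PX η ηhat N).prod (tripleLaw PX η ηhat)) ≤
      4 * (16 * B ^ 2 * ε * (4 * Real.Gamma (β + 1) * κ) +
        4 * Real.exp (-(ε / κ) ^ (1 / β))) := by
  obtain ⟨m1, t1⟩ := integral_perturbOne_moments_le PX η ηhat A i hκ hβ hε hstab.1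
  obtain ⟨m2, t2⟩ := integral_perturbOne_moments_le PX η ηhat A i hκ hβ hε hstab.2
  have hpM : Measurable fun q : ((Fin N → Triple 𝒳 𝒴) × Triple 𝒳 𝒴) × (𝒳 × 𝒴) =>
      |perturbOne A N i (q.1.1, q.1.2, q.2)| :=
    ((measurable_perturbOne A N i).comp (by fun_prop)).abs
  have I1 : ∀ (Q : Measure (𝒳 × 𝒴)) [IsProbabilityMeasure Q], Integrable
      (fun p : (Fin N → Triple 𝒳 𝒴) × Triple 𝒳 𝒴 =>
        ∫ w, |perturbOne A N i (p.1, p.2, w)| ∂Q)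
      ((dataLaw PX η ηhat N).prod (tripleLaw PX η ηhat)) := fun Q _ =>
    integrable_of_abs_le (C := 1) (measurable_integral_right hpM) fun p =>
      abs_integral_le_of_abs_le fun w => by
        rw [abs_abs]; exact abs_perturbOne_le_one A N i _
  have I2 : ∀ (Q : Measure (𝒳 × 𝒴)) [IsProbabilityMeasure Q], Integrable
      (fun p : (Fin N → Triple 𝒳 𝒴) × Triple 𝒳 𝒴 =>
        Q.real {w | ε ≤ |perturbOne A N i (p.1, p.2, w)|})
      ((dataLaw PX η ηhat N).prod (tripleLaw PX η ηhat)) := fun Q _ =>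
    integrable_of_abs_le (C := 1) (measurable_measureReal_right
      (measurableSet_le measurable_const hpM)) fun p => by
        rw [abs_of_nonneg measureReal_nonneg]; exact measureReal_le_one
  have J1 := (I1 (jointLaw PX η)).add (I1 (jointLaw PX ηhat))
  have J2 := (I2 (jointLaw PX η)).add (I2 (jointLaw PX ηhat))
  have J := ((J1.const_mul (16 * B ^ 2 * ε)).add J2).const_mul 4
  have hle := integral_mono_of_nonneg (μ := (dataLaw PX η ηhat N).prod (tripleLaw PX η ηhat))
    (ae_of_all _ fun p => integral_nonneg fun s => sq_nonneg _) J
    (ae_of_all _ fun p => integral_kernelProj_perturbation_sq_le PX η ηhat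
      (A.measurable_fit_apply N p.1) (A.measurable_fit_apply N (Function.update p.1 i p.2))
      (fun w => abs_sub_le_one_of_mem_Icc (A.fit_mem _ _ _) (A.fit_mem _ _ _))
      hB (hdens p.1).1 (hdens p.1).2 hε)
  refine hle.trans ?_
  refine (integral_weighted_sum _ (I1 _) (I1 _) (I2 _) (I2 _)).le.trans ?_
  refine mul_le_mul_of_nonneg_left ?_ (by norm_num)
  refine add_le_add (mul_le_mul_of_nonneg_left ?_ (by positivity)) ?_
  · linarith
  · linarith

/-- The conditional projection of the cross-fit rank kernel concentrates around its average over
the fitting sample. -/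
theorem integral_projection_fluctuation_le (A : DistinguisherProcedure 𝒳 𝒴) {N : ℕ}
    {B κ β ε : ℝ} (hB : 0 < B) (hκ : 0 < κ) (hβ : 0 < β) (hε : 0 ≤ ε)
    (hdens : ∀ d : Fin N → Triple 𝒳 𝒴, HasDensityBoundedBy (jointLaw PX η) (A.fit N d) B ∧
      HasDensityBoundedBy (jointLaw PX ηhat) (A.fit N d) B)
    (hstab : ∀ i : Fin N,
      IsSubWeibull ((dataLaw PX η ηhat N).prod ((tripleLaw PX η ηhat).prod (jointLaw PX η)))
        (perturbOne A N i) κ β ∧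
      IsSubWeibull ((dataLaw PX η ηhat N).prod ((tripleLaw PX η ηhat).prod (jointLaw PX ηhat)))
        (perturbOne A N i) κ β) :
    ∫ s, ∫ d, (kernelProj (tripleLaw PX η ηhat) (rankKernel (A.fit N d)) s -
        ∫ d', kernelProj (tripleLaw PX η ηhat) (rankKernel (A.fit N d')) s
          ∂(dataLaw PX η ηhat N)) ^ 2 ∂(dataLaw PX η ηhat N) ∂(tripleLaw PX η ηhat) ≤
      N * (2 * (16 * B ^ 2 * ε * (4 * Real.Gamma (β + 1) * κ) +
        4 * Real.exp (-(ε / κ) ^ (1 / β)))) := by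
  have hM : Measurable fun p : (Fin N → Triple 𝒳 𝒴) × Triple 𝒳 𝒴 =>
      kernelProj (tripleLaw PX η ηhat) (rankKernel (A.fit N p.1)) p.2 :=
    measurable_kernelProj_param (R := fun d => rankKernel (A.fit N d))
      (measurable_rankKernel_param (A.measurable_fit N))
  have habs : ∀ (d : Fin N → Triple 𝒳 𝒴) s,
      |kernelProj (tripleLaw PX η ηhat) (rankKernel (A.fit N d)) s| ≤ 2 := fun d s => by
    have h0 : 0 ≤ kernelProj (tripleLaw PX η ηhat) (rankKernel (A.fit N d)) s :=
      kernelProj_nonneg (fun _ _ => rankInd_nonneg _ _ _) s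
    rw [abs_of_nonneg h0]
    exact kernelProj_le_two (fun _ _ => rankInd_nonneg _ _ _) (fun _ _ => rankInd_le_one _ _ _) s
  refine (integral_efron_stein (μ := tripleLaw PX η ηhat) (ν := tripleLaw PX η ηhat) hM
    habs).trans ?_
  calc _ ≤ 1 / 2 * ∑ _i : Fin N, 4 * (16 * B ^ 2 * ε * (4 * Real.Gamma (β + 1) * κ) +
          4 * Real.exp (-(ε / κ) ^ (1 / β))) :=
        mul_le_mul_of_nonneg_left (Finset.sum_le_sum fun i _ =>
          integral_perturbation_step_le PX η ηhat A i hB hκ hβ hε hdens (hstab i)) (by norm_num)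
    _ = _ := by
        simp only [Finset.sum_const, Finset.card_univ, Fintype.card_fin, nsmul_eq_mul]
        ring

end Concentration

/-! ### The loss in ranking is at most the L¹ error of the ratio -/

section RankOrder

variable {T : Type*} [MeasurableSpace T]

open Classical in
/-- The rank indicator of the score `h`, with ties counted by one half. -/
def tieRankInd (h : T → ℝ) (w v : T) : ℝ :=
  if h w < h v then 1 else if h w = h v then 1 / 2 else 0

/-- Weight one half on ties is what makes this complementarity hold without exception; the
symmetrization of the AUC loss rests on it. -/
theorem tieRankInd_swap {T : Type*} (h : T → ℝ) (w v : T) :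
    tieRankInd h v w = 1 - tieRankInd h w v := by
  unfold tieRankInd
  rcases lt_trichotomy (h w) (h v) with hlt | heq | hgt
  · simp [hlt, hlt.not_gt, hlt.ne']
  · simp [heq]; norm_num
  · simp [hgt, hgt.not_gt, hgt.ne']

theorem tieRankInd_mem {T : Type*} (h : T → ℝ) (w v : T) :
    0 ≤ tieRankInd h w v ∧ tieRankInd h w v ≤ 1 := by
  unfold tieRankInd
  split_ifs <;> constructor <;> norm_num

theorem measurable_tieRankInd {h : T → ℝ} (hh : Measurable h) :
    Measurable fun p : T × T => tieRankInd h p.1 p.2 := by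
  unfold tieRankInd
  exact Measurable.ite (measurableSet_lt (hh.comp measurable_fst) (hh.comp measurable_snd))
    measurable_const (Measurable.ite (measurableSet_eq_fun (hh.comp measurable_fst)
      (hh.comp measurable_snd)) measurable_const measurable_const)

/-- A score that misorders a pair must err by at least the gap of the true values. -/
theorem mul_tieRankInd_sub_le {T : Type*} {L g : T → ℝ} {w v : T}
    (hw : g w < 1) (hv : g v < 1) :
    (L v - L w) * (tieRankInd L w v - tieRankInd g w v) ≤
      |g w / (1 - g w) - L w| + |g v / (1 - g v) - L v| := by
  have hmono : ∀ {a b : T}, g a < 1 → g b < 1 → g a ≤ g b →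
      g a / (1 - g a) ≤ g b / (1 - g b) := fun {a b} ha hb hab => by
    rw [div_le_div_iff₀ (by linarith) (by linarith)]
    nlinarith
  have hg := tieRankInd_mem g w v
  have hgap := abs_nonneg (g w / (1 - g w) - L w)
  have hgap' := abs_nonneg (g v / (1 - g v) - L v)
  rcases lt_trichotomy (L w) (L v) with hlt | heq | hgt
  · have hL : tieRankInd L w v = 1 := by simp [tieRankInd, hlt]
    rw [hL]
    by_cases hgg : g w < g v
    · have : tieRankInd g w v = 1 := by simp [tieRankInd, hgg]
      rw [this]
      linarith
    -- The pair is not strictly ordered as `L` orders it, so the transformed score at v is at most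
    -- that at w. Subtracting, the gap of `L` is at most the sum of the two errors; a tie loses only
    -- half the gap.
    · have h1 := hmono hv hw (not_lt.1 hgg)
      have h2 := neg_le_abs (g v / (1 - g v) - L v)
      have h3 := le_abs_self (g w / (1 - g w) - L w)
      have : (L v - L w) * (1 - tieRankInd g w v) ≤ (L v - L w) * 1 :=
        mul_le_mul_of_nonneg_left (by linarith) (by linarith)
      linarith
  · rw [heq] at hgap ⊢
    rw [sub_self, zero_mul]
    linarith
  · have hL : tieRankInd L w v = 0 := by simp [tieRankInd, hgt.not_gt, hgt.ne']
    rw [hL]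
    by_cases hgg : g v < g w
    · have : tieRankInd g w v = 0 := by simp [tieRankInd, hgg.not_gt, hgg.ne']
      rw [this]
      linarith
    · have h1 := hmono hw hv (not_lt.1 hgg)
      have h2 := le_abs_self (g v / (1 - g v) - L v)
      have h3 := neg_le_abs (g w / (1 - g w) - L w)
      have : (L w - L v) * tieRankInd g w v ≤ (L w - L v) * 1 :=
        mul_le_mul_of_nonneg_left hg.2 (by linarith)
      linarith

theorem integral_prod_swap_eq {P : Measure T} [IsProbabilityMeasure P] (f : T × T → ℝ) :
    ∫ p, f (p.2, p.1) ∂(P.prod P) = ∫ p, f p ∂(P.prod P) :=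
  integral_prod_swap (μ := P) (ν := P) f

/-- Among all scores, the separation loss relative to the likelihood ratio is controlled by the
`L¹` error of the ratio. -/
theorem integral_mul_tieRankInd_sub_le {P : Measure T} [IsProbabilityMeasure P] {L g : T → ℝ}
    (hL : Measurable L) (hLi : Integrable L P) (hg : Measurable g) (hg1 : ∀ᵐ w ∂P, g w < 1)
    (hD : Integrable (fun w => g w / (1 - g w) - L w) P) :
    ∫ p, L p.2 * tieRankInd L p.1 p.2 ∂(P.prod P) - ∫ p, L p.2 * tieRankInd g p.1 p.2 ∂(P.prod P)
      ≤ ∫ w, |g w / (1 - g w) - L w| ∂P := by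
  have hS : Measurable fun p : T × T => tieRankInd L p.1 p.2 - tieRankInd g p.1 p.2 :=
    (measurable_tieRankInd hL).sub (measurable_tieRankInd hg)
  have hSb : ∀ p : T × T, |tieRankInd L p.1 p.2 - tieRankInd g p.1 p.2| ≤ 1 := fun p =>
    abs_sub_le_one_of_mem_Icc (tieRankInd_mem L p.1 p.2) (tieRankInd_mem g p.1 p.2)
  have hLsnd : Integrable (fun p : T × T => L p.2) (P.prod P) := hLi.comp_snd P
  have hLfst : Integrable (fun p : T × T => L p.1) (P.prod P) := hLi.comp_fst P
  have hmul : ∀ {f : T × T → ℝ}, Integrable f (P.prod P) → ∀ {s : T × T → ℝ}, Measurable s →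
      (∀ p, |s p| ≤ 1) → Integrable (fun p => f p * s p) (P.prod P) := fun hf s hs hb =>
    hf.mul_bdd (c := 1) hs.aestronglyMeasurable (ae_of_all _ hb)
  have htie : ∀ (h : T → ℝ) (p : T × T), |tieRankInd h p.1 p.2| ≤ 1 := fun h p => by
    rw [abs_of_nonneg (tieRankInd_mem h p.1 p.2).1]; exact (tieRankInd_mem h p.1 p.2).2
  rw [← integral_sub (hmul hLsnd (measurable_tieRankInd hL) (htie L))
    (hmul hLsnd (measurable_tieRankInd hg) (htie g))]
  set F : T × T → ℝ := fun p => L p.2 * (tieRankInd L p.1 p.2 - tieRankInd g p.1 p.2) with hF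
  have hFi : Integrable F (P.prod P) := hmul hLsnd hS hSb
  have e1 : ∀ p : T × T, L p.2 * tieRankInd L p.1 p.2 - L p.2 * tieRankInd g p.1 p.2 = F p :=
    fun p => by simp only [hF]; ring
  simp_rw [e1]
  have hFs : Integrable (fun p : T × T => F (p.2, p.1)) (P.prod P) := hFi.swap
  -- Adding the integrand at the swapped pair turns the weight L(v) into L(v) − L(w). The pairwise
  -- bound then integrates to twice the L¹ error, and the factor 2 cancels.
  have hsum : 2 * ∫ p, F p ∂(P.prod P) = ∫ p, (F p + F (p.2, p.1)) ∂(P.prod P) := by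
    rw [integral_add hFi hFs, integral_prod_swap_eq]
    ring
  have hDa : Integrable (fun w => |g w / (1 - g w) - L w|) P := hD.abs
  have hD1 : Integrable (fun p : T × T => |g p.1 / (1 - g p.1) - L p.1|) (P.prod P) :=
    hDa.comp_fst P
  have hD2 : Integrable (fun p : T × T => |g p.2 / (1 - g p.2) - L p.2|) (P.prod P) :=
    hDa.comp_snd P
  have h1 : ∀ᵐ p ∂(P.prod P), g p.1 < 1 :=
    Measure.quasiMeasurePreserving_fst.ae hg1
  have h2 : ∀ᵐ p ∂(P.prod P), g p.2 < 1 :=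
    Measure.quasiMeasurePreserving_snd.ae hg1
  have hle : ∫ p, (F p + F (p.2, p.1)) ∂(P.prod P) ≤
      ∫ p, (|g p.1 / (1 - g p.1) - L p.1| + |g p.2 / (1 - g p.2) - L p.2|) ∂(P.prod P) := by
    refine integral_mono_ae (hFi.add hFs) (hD1.add hD2) ?_
    filter_upwards [h1, h2] with p hp1 hp2
    refine le_trans (le_of_eq ?_) (mul_tieRankInd_sub_le hp1 hp2)
    simp only [hF, tieRankInd_swap L p.1 p.2, tieRankInd_swap g p.1 p.2]
    ring
  rw [integral_add hD1 hD2] at hle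
  have e2 : ∫ p, |g p.1 / (1 - g p.1) - L p.1| ∂(P.prod P) = ∫ w, |g w / (1 - g w) - L w| ∂P := by
    have := integral_fun_fst (μ := P) (ν := P) (fun w => |g w / (1 - g w) - L w|)
    simpa using this
  have e3 : ∫ p, |g p.2 / (1 - g p.2) - L p.2| ∂(P.prod P) = ∫ w, |g w / (1 - g w) - L w| ∂P := by
    have := integral_fun_snd (μ := P) (ν := P) (fun w => |g w / (1 - g w) - L w|)
    simpa using this
  rw [e2, e3] at hle
  linarith

end RankOrder

/-! ### Change of measure and the AUC deficit of a fitted score -/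

section LikelihoodRatio

theorem likelihoodRatio_nonneg {𝒳 𝒴 : Type*} [MeasurableSpace 𝒳] [MeasurableSpace 𝒴]
    (η ηhat : Kernel 𝒳 𝒴) (w : 𝒳 × 𝒴) : 0 ≤ likelihoodRatio η ηhat w :=
  div_nonneg measureReal_nonneg measureReal_nonneg

variable {𝒳 𝒴 : Type*} [MeasurableSpace 𝒳] [Finite 𝒴] [MeasurableSpace 𝒴]
  [MeasurableSingletonClass 𝒴]

theorem measurable_kernel_real_singleton (η : Kernel 𝒳 𝒴) [IsMarkovKernel η] :
    Measurable fun w : 𝒳 × 𝒴 => (η w.1).real {w.2} :=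
  measurable_from_prod_countable_left fun y =>
    (η.measurable_coe (measurableSet_singleton y)).ennreal_toReal

theorem measurable_likelihoodRatio (η ηhat : Kernel 𝒳 𝒴) [IsMarkovKernel η]
    [IsMarkovKernel ηhat] : Measurable (likelihoodRatio η ηhat) :=
  (measurable_kernel_real_singleton ηhat).div (measurable_kernel_real_singleton η)

theorem jointLaw_eq_withDensity (PX : Measure 𝒳) [IsProbabilityMeasure PX]
    (η ηhat : Kernel 𝒳 𝒴) [IsMarkovKernel η] [IsMarkovKernel ηhat]
    (hac : jointLaw PX ηhat ≪ jointLaw PX η) :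
    jointLaw PX ηhat =
      (jointLaw PX η).withDensity fun w => ENNReal.ofReal (likelihoodRatio η ηhat w) := by
  classical
  have := Fintype.ofFinite 𝒴
  have hLM : Measurable fun w => ENNReal.ofReal (likelihoodRatio η ηhat w) :=
    (measurable_likelihoodRatio η ηhat).ennreal_ofReal
  set Z : Set (𝒳 × 𝒴) := {w | (η w.1).real {w.2} = 0} with hZ
  have hZM : MeasurableSet Z :=
    measurable_kernel_real_singleton η (measurableSet_singleton 0)
  have hZη : jointLaw PX η Z = 0 := by
    unfold jointLaw
    rw [Measure.compProd_apply hZM, lintegral_eq_zero_iff (Kernel.measurable_kernel_prodMk_left hZM)]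
    refine ae_of_all _ fun x => ?_
    have hfin : (Prod.mk x ⁻¹' Z) = ⋃ y ∈ {y | (x, y) ∈ Z}, {y} := by
      ext y; simp
    change η x (Prod.mk x ⁻¹' Z) = 0
    rw [hfin, measure_biUnion_null_iff (Set.to_countable _)]
    intro y hy
    have hy' : (η x).real {y} = 0 := hy
    exact (measureReal_eq_zero_iff).1 hy'
  have hZh := hac hZη
  unfold jointLaw at hZh
  rw [Measure.compProd_apply hZM,
    lintegral_eq_zero_iff (Kernel.measurable_kernel_prodMk_left hZM)] at hZh
  refine Measure.ext_of_lintegral _ fun F hF => ?_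
  rw [lintegral_withDensity_eq_lintegral_mul _ hLM hF]
  unfold jointLaw
  rw [Measure.lintegral_compProd hF, Measure.lintegral_compProd (hLM.mul hF)]
  refine lintegral_congr_ae ?_
  filter_upwards [hZh] with x hx
  rw [lintegral_fintype, lintegral_fintype]
  refine Finset.sum_congr rfl fun y _ => ?_
  by_cases hy : (η x).real {y} = 0
  · have h1 : ηhat x {y} = 0 := measure_mono_null (fun y' hy' => by
      rw [Set.mem_singleton_iff.1 hy']; exact hy) hx
    have h2 : η x {y} = 0 := (measureReal_eq_zero_iff).1 hy
    rw [h1, h2]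
    simp
  · have hpos : 0 < (η x).real {y} := lt_of_le_of_ne measureReal_nonneg (Ne.symm hy)
    have h1 : ENNReal.ofReal (likelihoodRatio η ηhat (x, y)) * η x {y} = ηhat x {y} := by
      rw [← ofReal_measureReal (μ := η x) (s := {y}), ← ofReal_measureReal (μ := ηhat x) (s := {y}),
        ← ENNReal.ofReal_mul (by unfold likelihoodRatio; positivity)]
      congr 1
      unfold likelihoodRatio
      field_simp
    rw [← h1, Pi.mul_apply]
    ring

variable (PX : Measure 𝒳) [IsProbabilityMeasure PX]
    (η ηhat : Kernel 𝒳 𝒴) [IsMarkovKernel η] [IsMarkovKernel ηhat]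

theorem integrable_likelihoodRatio (hac : jointLaw PX ηhat ≪ jointLaw PX η) :
    Integrable (likelihoodRatio η ηhat) (jointLaw PX η) := by
  refine ⟨(measurable_likelihoodRatio η ηhat).aestronglyMeasurable, ?_⟩
  rw [hasFiniteIntegral_iff_ofReal (ae_of_all _ (likelihoodRatio_nonneg η ηhat))]
  have h : (jointLaw PX ηhat) Set.univ = 1 := measure_univ
  rw [jointLaw_eq_withDensity PX η ηhat hac, withDensity_apply _ MeasurableSet.univ,
    Measure.restrict_univ] at h
  rw [h]
  exact ENNReal.one_lt_top

theorem auc_eq_integral (hac : jointLaw PX ηhat ≪ jointLaw PX η) {h : 𝒳 × 𝒴 → ℝ}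
    (hh : Measurable h) :
    auc PX η ηhat h = ∫ p, likelihoodRatio η ηhat p.2 * tieRankInd h p.1 p.2
      ∂((jointLaw PX η).prod (jointLaw PX η)) := by
  have hLM := measurable_likelihoodRatio η ηhat
  have hLs : Measurable fun p : (𝒳 × 𝒴) × 𝒳 × 𝒴 =>
      ENNReal.ofReal (likelihoodRatio η ηhat p.2) := hLM.ennreal_ofReal.comp measurable_snd
  have m1 : MeasurableSet {p : (𝒳 × 𝒴) × 𝒳 × 𝒴 | h p.1 < h p.2} :=
    measurableSet_lt (hh.comp measurable_fst) (hh.comp measurable_snd)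
  have m2 : MeasurableSet {p : (𝒳 × 𝒴) × 𝒳 × 𝒴 | h p.1 = h p.2} :=
    measurableSet_eq_fun (hh.comp measurable_fst) (hh.comp measurable_snd)
  have e : ∫ p, tieRankInd h p.1 p.2 ∂((jointLaw PX η).prod (jointLaw PX ηhat)) =
      auc PX η ηhat h := by
    have i1 : Integrable ({p : (𝒳 × 𝒴) × 𝒳 × 𝒴 | h p.1 < h p.2}.indicator (1 : (𝒳 × 𝒴) × 𝒳 × 𝒴 → ℝ))
        ((jointLaw PX η).prod (jointLaw PX ηhat)) := (integrable_const (1 : ℝ)).indicator m1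
    have i2 : Integrable ({p : (𝒳 × 𝒴) × 𝒳 × 𝒴 | h p.1 = h p.2}.indicator (1 : (𝒳 × 𝒴) × 𝒳 × 𝒴 → ℝ))
        ((jointLaw PX η).prod (jointLaw PX ηhat)) := (integrable_const (1 : ℝ)).indicator m2
    unfold auc
    rw [← integral_indicator_one m1, ← integral_indicator_one m2, ← integral_div,
      ← integral_add i1 (i2.div_const 2)]
    refine integral_congr_ae (ae_of_all _ fun p => ?_)
    classical
    simp only [tieRankInd, Set.indicator_apply, Set.mem_ofPred_eq, Pi.one_apply]
    rcases lt_trichotomy (h p.1) (h p.2) with hlt | heq | hgt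
    · simp [hlt, hlt.ne]
    · simp [heq]
    · simp [hgt.not_gt, hgt.ne']
  -- The second point now also has law P_η, weighted by the ratio, so the pair is exchangeable.
  rw [← e, jointLaw_eq_withDensity PX η ηhat hac, prod_withDensity_right hLM.ennreal_ofReal,
    integral_withDensity_eq_integral_toReal_smul hLs
      (ae_of_all _ fun p => ENNReal.ofReal_lt_top)]
  refine integral_congr_ae (ae_of_all _ fun p => ?_)
  simp only [smul_eq_mul]
  rw [ENNReal.toReal_ofReal (likelihoodRatio_nonneg η ηhat p.2)]

/-- The rank probability of a tie-free score falls short of the optimal separation by at most the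
`L¹` error of its ratio transformation. -/
theorem separation_sub_le (hac : jointLaw PX ηhat ≪ jointLaw PX η) {g : 𝒳 × 𝒴 → ℝ}
    (hg : Measurable g) (hg1 : ∀ w, g w ∈ Set.Icc (0 : ℝ) 1) {B : ℝ} (hB : 0 < B)
    (hP : HasDensityBoundedBy (jointLaw PX η) g B)
    (hQ : HasDensityBoundedBy (jointLaw PX ηhat) g B) {r : ℝ} (hr : 0 ≤ r)
    (hL1 : eLpNorm (fun w => ratioTransform g w - likelihoodRatio η ηhat w) 1 (jointLaw PX η) ≤
      ENNReal.ofReal r) :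
    separation PX η ηhat + 1 / 2 - r ≤
      ∫ s, ∫ t, rankKernel g s t ∂(tripleLaw PX η ηhat) ∂(tripleLaw PX η ηhat) := by
  have hLM := measurable_likelihoodRatio η ηhat
  have hratio : Measurable fun w => ratioTransform g w := by
    unfold ratioTransform
    exact hg.div (hg.const_sub 1)
  have hDM : Measurable fun w => ratioTransform g w - likelihoodRatio η ηhat w := hratio.sub hLM
  have hDi : Integrable (fun w => ratioTransform g w - likelihoodRatio η ηhat w)
      (jointLaw PX η) :=
    memLp_one_iff_integrable.1 ⟨hDM.aestronglyMeasurable, hL1.trans_lt ENNReal.ofReal_lt_top⟩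
  have hDr : ∫ w, |ratioTransform g w - likelihoodRatio η ηhat w| ∂(jointLaw PX η) ≤ r := by
    rw [eLpNorm_one_eq_lintegral_enorm, ← ofReal_integral_norm_eq_lintegral_enorm hDi] at hL1
    exact (ENNReal.ofReal_le_ofReal_iff hr).1 hL1
  -- At score 1 the transform is 1/0 = 0 and monotonicity fails; the density leaves no mass there.
  have hlt : ∀ᵐ w ∂(jointLaw PX η), g w < 1 := by
    have h0 := measureReal_abs_sub_le_of_density hg hB hP 1 le_rfl
    rw [mul_zero] at h0
    have h1 : (jointLaw PX η) {w | |g w - 1| ≤ 0} = 0 :=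
      (measureReal_eq_zero_iff).1 (le_antisymm h0 measureReal_nonneg)
    have h2 : ∀ᵐ w ∂(jointLaw PX η), ¬ |g w - 1| ≤ 0 := measure_eq_zero_iff_ae_notMem.1 h1
    filter_upwards [h2] with w hw
    refine lt_of_le_of_ne (hg1 w).2 fun h => hw ?_
    simp [h]
  have hmain := integral_mul_tieRankInd_sub_le hLM (integrable_likelihoodRatio PX η ηhat hac)
    hg hlt hDi
  rw [← auc_eq_integral PX η ηhat hac hLM, ← auc_eq_integral PX η ηhat hac hg] at hmain
  -- Conditionally on the first point, a tie is the event that the second score hits a prescribed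
  -- value.
  have hties : ((jointLaw PX η).prod (jointLaw PX ηhat)).real {p | g p.1 = g p.2} = 0 := by
    have hM : MeasurableSet {p : (𝒳 × 𝒴) × 𝒳 × 𝒴 | g p.1 = g p.2} :=
      measurableSet_eq_fun (hg.comp measurable_fst) (hg.comp measurable_snd)
    rw [measureReal_eq_zero_iff, Measure.prod_apply hM,
      lintegral_eq_zero_iff (measurable_measure_prodMk_left hM)]
    refine ae_of_all _ fun w => ?_
    have h0 := measureReal_abs_sub_le_of_density hg hB hQ (g w) le_rfl
    rw [mul_zero] at h0
    have h1 : (jointLaw PX ηhat) {v | |g v - g w| ≤ 0} = 0 :=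
      (measureReal_eq_zero_iff).1 (le_antisymm h0 measureReal_nonneg)
    refine measure_mono_null (fun v hv => ?_) h1
    have hv' : g w = g v := hv
    simp [hv']
  rw [integral_integral_rankKernel PX η ηhat hg]
  have hauc : auc PX η ηhat g =
      ((jointLaw PX η).prod (jointLaw PX ηhat)).real {p | g p.1 < g p.2} := by
    unfold auc
    rw [hties]
    ring
  rw [← hauc]
  unfold separation
  have : ∫ w, |g w / (1 - g w) - likelihoodRatio η ηhat w| ∂(jointLaw PX η) ≤ r := hDr
  linarith

end LikelihoodRatio

/-! ### Fold statistics as V-statistics; bounds on the variance estimate -/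

section Folds

variable {𝒳 𝒴 : Type*}

theorem sum_eq_sum_orderEmbOfFin {n : ℕ} (s : Finset (Fin n)) (f : Fin n → ℝ) :
    ∑ i ∈ s, f i = ∑ j : Fin s.card, f (s.orderEmbOfFin rfl j) := by
  conv_lhs => rw [← s.map_orderEmbOfFin_univ rfl]
  rw [Finset.sum_map]
  rfl

variable [MeasurableSpace 𝒳] [MeasurableSpace 𝒴] (A : DistinguisherProcedure 𝒳 𝒴)
  {n K : ℕ} (fold : Fin n → Fin K) (z : Fin n → Triple 𝒳 𝒴) (k : Fin K)

theorem foldStat_eq_kernelStat :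
    foldStat A fold z k = kernelStat (rankKernel (crossFit A fold z k))
      (subsample z (foldSet fold k)) := by
  unfold foldStat kernelStat
  simp_rw [sum_eq_sum_orderEmbOfFin (foldSet fold k)]
  rfl

theorem empProj_add_eq_kernelEmpProj (t : Triple 𝒳 𝒴) :
    empProj₁ A fold z k (truePair t) + empProj₂ A fold z k (modelPair t) =
      kernelEmpProj (rankKernel (crossFit A fold z k)) (subsample z (foldSet fold k)) t := by
  unfold empProj₁ empProj₂ kernelEmpProj
  simp_rw [sum_eq_sum_orderEmbOfFin (foldSet fold k)]
  rfl

theorem foldVar_eq :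
    foldVar A fold z k = 1 / (((foldSet fold k).card : ℝ) - 1) *
      ∑ j, (kernelEmpProj (rankKernel (crossFit A fold z k)) (subsample z (foldSet fold k))
          (subsample z (foldSet fold k) j) -
        2 * kernelStat (rankKernel (crossFit A fold z k)) (subsample z (foldSet fold k))) ^ 2 := by
  unfold foldVar
  simp_rw [empProj_add_eq_kernelEmpProj, foldStat_eq_kernelStat]
  rw [sum_eq_sum_orderEmbOfFin (foldSet fold k)]
  rfl

variable {A fold z k}

theorem foldVar_nonneg (h : 2 ≤ (foldSet fold k).card) : 0 ≤ foldVar A fold z k := by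
  have h' : (2 : ℝ) ≤ (foldSet fold k).card := by exact_mod_cast h
  have h2 : (0 : ℝ) ≤ ((foldSet fold k).card : ℝ) - 1 := by linarith
  unfold foldVar
  exact mul_nonneg (div_nonneg zero_le_one h2) (Finset.sum_nonneg fun _ _ => sq_nonneg _)

/-- Each squared deviation is a difference of numbers in [0, 2], hence at most 4, and m/(m−1) ≤ 2
for m ≥ 2. -/
theorem foldVar_le_eight (h : 2 ≤ (foldSet fold k).card) : foldVar A fold z k ≤ 8 := by
  have h' : (2 : ℝ) ≤ (foldSet fold k).card := by exact_mod_cast h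
  have h2 : (0 : ℝ) < ((foldSet fold k).card : ℝ) - 1 := by linarith
  have hR0 := fun s t => rankInd_nonneg (crossFit A fold z k) (truePair s) (modelPair t)
  have hR1 := fun s t => rankInd_le_one (crossFit A fold z k) (truePair s) (modelPair t)
  rw [foldVar_eq, one_div_mul_eq_div, div_le_iff₀ h2]
  set R := rankKernel (crossFit A fold z k)
  set u := subsample z (foldSet fold k)
  have hT0 : 0 ≤ kernelStat R u := kernelStat_nonneg hR0 u
  have hT1 : kernelStat R u ≤ 1 := kernelStat_le_one hR1 u
  calc ∑ j, (kernelEmpProj R u (u j) - 2 * kernelStat R u) ^ 2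
      ≤ ∑ _j : Fin (foldSet fold k).card, (4 : ℝ) := by
        refine Finset.sum_le_sum fun j _ => ?_
        have h3 : 0 ≤ kernelEmpProj R u (u j) := kernelEmpProj_nonneg hR0 u (u j)
        have h4 : kernelEmpProj R u (u j) ≤ 2 := kernelEmpProj_le_two hR1 u (u j)
        nlinarith
    _ ≤ 8 * (((foldSet fold k).card : ℝ) - 1) := by
        simp only [Finset.sum_const, Finset.card_univ, Fintype.card_fin, nsmul_eq_mul]
        linarith

/-- A vanishing sum of squares vanishes termwise. Two points in the fold are needed so that the
prefactor 1/(m−1) is not zero. -/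
theorem kernelEmpProj_eq_of_foldVar_eq_zero (h : 2 ≤ (foldSet fold k).card)
    (h0 : foldVar A fold z k = 0) (j : Fin (foldSet fold k).card) :
    kernelEmpProj (rankKernel (crossFit A fold z k)) (subsample z (foldSet fold k))
        (subsample z (foldSet fold k) j) =
      2 * kernelStat (rankKernel (crossFit A fold z k)) (subsample z (foldSet fold k)) := by
  have h' : (2 : ℝ) ≤ (foldSet fold k).card := by exact_mod_cast h
  have h2 : (0 : ℝ) < ((foldSet fold k).card : ℝ) - 1 := by linarith
  rw [foldVar_eq, mul_eq_zero] at h0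
  rcases h0 with h0 | h0
  · exact absurd h0 (by positivity)
  · rw [Finset.sum_eq_zero_iff_of_nonneg fun _ _ => sq_nonneg _] at h0
    have := pow_eq_zero_iff two_ne_zero |>.1 (h0 j (Finset.mem_univ j))
    linarith

/-- The statistic is large when every fold statistic is, unless the variance estimate
degenerates. -/
theorem lt_standardizedStat (hK : 0 < K) (hcard : ∀ k, 2 ≤ (foldSet fold k).card) {δ a M : ℝ}
    (hn : 0 < n) (ha : 0 < a) (hM : 4 * M < a)
    (hT : ∀ k, a / √(n : ℝ) ≤ foldStat A fold z k - δ - 1 / 2)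
    {k₀ : Fin K} (hvar : foldVar A fold z k₀ ≠ 0) :
    M < standardizedStat A fold δ z := by
  have hK' : (0 : ℝ) < K := by exact_mod_cast hK
  have hn' : 0 < √(n : ℝ) := Real.sqrt_pos.2 (by exact_mod_cast hn)
  -- All folds contribute nonnegatively, so a single nondegenerate one suffices.
  have hv0 : 0 < ∑ k, foldVar A fold z k :=
    Finset.sum_pos' (fun k _ => foldVar_nonneg (hcard k))
      ⟨k₀, Finset.mem_univ _, lt_of_le_of_ne (foldVar_nonneg (hcard k₀)) hvar.symm⟩
  have hv8 : ∑ k, foldVar A fold z k ≤ K * 8 := by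
    refine (Finset.sum_le_sum fun k _ => foldVar_le_eight (hcard k)).trans ?_
    simp
  have hc0 : 0 < crossVar A fold z := mul_pos (by positivity) hv0
  have hc8 : crossVar A fold z ≤ 8 := by
    unfold crossVar
    calc _ ≤ 1 / (K : ℝ) * (K * 8) := by gcongr
      _ = 8 := by field_simp
  have hs0 : 0 < √(crossVar A fold z) := Real.sqrt_pos.2 hc0
  -- A crude bound on √8; it is the origin of the 4 in `hM`.
  have hs4 : √(crossVar A fold z) ≤ 4 := Real.sqrt_le_iff.2 ⟨by norm_num, by linarith⟩
  have hstat : a / √(n : ℝ) ≤ crossStat A fold z - δ - 1 / 2 := by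
    have hsum : K * (a / √(n : ℝ) + δ + 1 / 2) ≤ ∑ k, foldStat A fold z k := by
      have h := Finset.sum_le_sum fun (k : Fin K) (_ : k ∈ Finset.univ) =>
        (by linarith [hT k] : a / √(n : ℝ) + δ + 1 / 2 ≤ foldStat A fold z k)
      rwa [Finset.sum_const, Finset.card_univ, Fintype.card_fin, nsmul_eq_mul] at h
    have : a / √(n : ℝ) + δ + 1 / 2 ≤ crossStat A fold z := by
      unfold crossStat
      calc _ = 1 / (K : ℝ) * (K * (a / √(n : ℝ) + δ + 1 / 2)) := by field_simp
        _ ≤ _ := by gcongr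
    linarith
  unfold standardizedStat
  calc M < a / 4 := by linarith
    _ ≤ a / √(crossVar A fold z) := by gcongr
    _ = √(n : ℝ) / √(crossVar A fold z) * (a / √(n : ℝ)) := by field_simp
    _ ≤ _ := by gcongr

end Folds

/-! ### Independence of a fold and its fitting sample -/

section Split

variable {𝒳 𝒴 : Type*} [MeasurableSpace 𝒳] [MeasurableSpace 𝒴]
  (PX : Measure 𝒳) [IsProbabilityMeasure PX]
  (η ηhat : Kernel 𝒳 𝒴) [IsMarkovKernel η] [IsMarkovKernel ηhat]

/-- Since the indices split into s and its complement, the product law factors. Conditioning on the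
fitting sample thereby becomes Fubini on a product space. -/
theorem measurePreserving_subsample_compl {n : ℕ} (s : Finset (Fin n)) :
    MeasurePreserving (fun z : Fin n → Triple 𝒳 𝒴 => (subsample z sᶜ, subsample z s))
      (dataLaw PX η ηhat n) ((dataLaw PX η ηhat sᶜ.card).prod (dataLaw PX η ηhat s.card)) := by
  have h1 := (measurePreserving_piCongrLeft (fun _ : Fin n => tripleLaw PX η ηhat)
    (finSumEquivOfFinset (s := s) rfl rfl)).symm
  have h2 := measurePreserving_sumPiEquivProdPi
    (fun _ : Fin s.card ⊕ Fin sᶜ.card => tripleLaw PX η ηhat)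
  have h3 := Measure.measurePreserving_swap (μ := dataLaw PX η ηhat s.card)
    (ν := dataLaw PX η ηhat sᶜ.card)
  exact h3.comp (h2.comp h1)

/-- A fold statistic is close to its conditional mean given the fitting sample. -/
theorem dataLaw_foldStat_deviation_le (A : DistinguisherProcedure 𝒳 𝒴) {n K : ℕ}
    (fold : Fin n → Fin K) (k : Fin K) (hk : 0 < (foldSet fold k).card) {t : ℝ} (ht : 0 < t) :
    dataLaw PX η ηhat n {z | t ≤ (foldStat A fold z k - ∫ s, ∫ s',
        rankKernel (crossFit A fold z k) s s' ∂(tripleLaw PX η ηhat) ∂(tripleLaw PX η ηhat)) ^ 2} ≤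
      ENNReal.ofReal (3 / (foldSet fold k).card / t) := by
  set S := foldSet fold k with hS
  set μ := tripleLaw PX η ηhat with hμ
  set ρ := dataLaw PX η ηhat Sᶜ.card with hρ
  set ν := dataLaw PX η ηhat S.card with hν
  set R : (Fin Sᶜ.card → Triple 𝒳 𝒴) → Triple 𝒳 𝒴 → Triple 𝒳 𝒴 → ℝ := fun d =>
    rankKernel (A.fit _ d) with hR
  have hRM : Measurable fun p : (Fin Sᶜ.card → Triple 𝒳 𝒴) × Triple 𝒳 𝒴 × Triple 𝒳 𝒴 =>
      R p.1 p.2.1 p.2.2 := measurable_rankKernel_param (A.measurable_fit _)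
  have h0 : ∀ d s s', 0 ≤ R d s s' := fun _ _ _ => rankInd_nonneg _ _ _
  have h1 : ∀ d s s', R d s s' ≤ 1 := fun _ _ _ => rankInd_le_one _ _ _
  set θ : (Fin Sᶜ.card → Triple 𝒳 𝒴) → ℝ := fun d => ∫ s, ∫ s', R d s s' ∂μ ∂μ with hθ
  have hθM : Measurable θ :=
    measurable_integral_right (f := fun p : (Fin Sᶜ.card → Triple 𝒳 𝒴) × Triple 𝒳 𝒴 =>
      ∫ t, R p.1 p.2 t ∂μ)
      (measurable_integral_right
        (f := fun q : ((Fin Sᶜ.card → Triple 𝒳 𝒴) × Triple 𝒳 𝒴) × Triple 𝒳 𝒴 =>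
          R q.1.1 q.1.2 q.2)
        (hRM.comp (f := fun q : ((Fin Sᶜ.card → Triple 𝒳 𝒴) × Triple 𝒳 𝒴) × Triple 𝒳 𝒴 =>
          (q.1.1, q.1.2, q.2)) (by fun_prop)))
  have hθ0 : ∀ d, 0 ≤ θ d := fun d => integral_nonneg fun s => integral_nonneg fun t => h0 d s t
  have hθ1 : ∀ d, θ d ≤ 1 := fun d => (le_abs_self _).trans
    (abs_integral_le_of_abs_le fun s => abs_integral_le_of_abs_le fun t =>
      abs_kernel_le_one (h0 d) (h1 d) s t)
  set F : (Fin Sᶜ.card → Triple 𝒳 𝒴) × (Fin S.card → Triple 𝒳 𝒴) → ℝ := fun p =>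
    (kernelStat (R p.1) p.2 - θ p.1) ^ 2 with hF
  have hFM : Measurable F :=
    ((measurable_kernelStat_param hRM).sub (hθM.comp measurable_fst)).pow_const 2
  have hFb : ∀ p, |F p| ≤ 1 ^ 2 := fun p => sq_le_of_abs_le <| abs_sub_le_one_of_mem_Icc
    ⟨kernelStat_nonneg (h0 p.1) p.2, kernelStat_le_one (h1 p.1) p.2⟩ ⟨hθ0 p.1, hθ1 p.1⟩
  have hFi : Integrable F (ρ.prod ν) := integrable_of_abs_le hFM hFb
  have hint : ∫ p, F p ∂(ρ.prod ν) ≤ 3 / S.card := by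
    rw [integral_prod _ hFi]
    exact integral_le_of_le hFi.integral_prod_left fun d =>
      integral_kernelStat_sub_sq_le
        (hRM.comp (f := fun p : Triple 𝒳 𝒴 × Triple 𝒳 𝒴 => (d, p.1, p.2)) (by fun_prop))
        (h0 d) (h1 d) hk
  have hmk := mul_meas_ge_le_integral_of_nonneg (ae_of_all (ρ.prod ν) fun p => sq_nonneg _) hFi t
  have hreal : (ρ.prod ν).real {p | t ≤ F p} ≤ 3 / S.card / t := by
    rw [le_div_iff₀ ht, mul_comm]
    exact hmk.trans hint
  have hset : {z : Fin n → Triple 𝒳 𝒴 | t ≤ (foldStat A fold z k - ∫ s, ∫ s',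
      rankKernel (crossFit A fold z k) s s' ∂μ ∂μ) ^ 2} =
      (fun z => (subsample z Sᶜ, subsample z S)) ⁻¹' {p | t ≤ F p} := by
    ext z
    simp only [Set.mem_ofPred_eq, Set.mem_preimage, foldStat_eq_kernelStat]
    rfl
  rw [hset, (measurePreserving_subsample_compl PX η ηhat S).measure_preimage
    (measurableSet_le measurable_const hFM).nullMeasurableSet]
  rw [← ofReal_measureReal]
  exact ENNReal.ofReal_le_ofReal hreal

/-- A fold variance estimate vanishes with small probability. -/
theorem dataLaw_foldVar_eq_zero_le (A : DistinguisherProcedure 𝒳 𝒴) {n K : ℕ}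
    (fold : Fin n → Fin K) (k : Fin K) (hk : 2 ≤ (foldSet fold k).card) {c e : ℝ} (hc : 0 < c)
    (hv : c < projVariance PX η ηhat A (foldSet fold k)ᶜ.card)
    (he : ∫ s, ∫ d, (kernelProj (tripleLaw PX η ηhat) (rankKernel (A.fit _ d)) s -
        ∫ d', kernelProj (tripleLaw PX η ηhat) (rankKernel (A.fit _ d')) s
          ∂(dataLaw PX η ηhat (foldSet fold k)ᶜ.card)) ^ 2
        ∂(dataLaw PX η ηhat (foldSet fold k)ᶜ.card) ∂(tripleLaw PX η ηhat) ≤ e) :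
    dataLaw PX η ηhat n {z | foldVar A fold z k = 0} ≤
      ENNReal.ofReal (64 / c ^ 2 / (foldSet fold k).card +
        8 / c * (2 * e + 20 / (foldSet fold k).card)) := by
  set S := foldSet fold k with hS
  have hv' : c < variance (fun s => ∫ d, kernelProj (tripleLaw PX η ηhat)
      (rankKernel (A.fit _ d)) s ∂(dataLaw PX η ηhat Sᶜ.card)) (tripleLaw PX η ηhat) := by
    simp_rw [kernelProj_rankKernel PX η ηhat (A.measurable_fit_apply _ _)]
    exact hv
  have h := measureReal_degenerate_le (ρ := dataLaw PX η ηhat Sᶜ.card)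
    (R := fun d => rankKernel (A.fit _ d)) (measurable_rankKernel_param (A.measurable_fit _))
    (fun _ _ _ => rankInd_nonneg _ _ _) (fun _ _ _ => rankInd_le_one _ _ _)
    (by omega : 0 < S.card) hc hv' he
  have hsub : {z : Fin n → Triple 𝒳 𝒴 | foldVar A fold z k = 0} ⊆
      (fun z => (subsample z Sᶜ, subsample z S)) ⁻¹' {p | ∀ i,
        kernelEmpProj (rankKernel (A.fit _ p.1)) p.2 (p.2 i) =
          2 * kernelStat (rankKernel (A.fit _ p.1)) p.2} := fun z hz j =>
    kernelEmpProj_eq_of_foldVar_eq_zero hk hz j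
  have hmp := measurePreserving_subsample_compl PX η ηhat S
  -- The inequality between a preimage and the image measure holds for arbitrary sets, so
  -- measurability of the degenerate event is not needed.
  refine (measure_mono hsub).trans ((Measure.le_map_apply hmp.measurable.aemeasurable _).trans ?_)
  rw [hmp.map_eq, ← ofReal_measureReal]
  exact ENNReal.ofReal_le_ofReal h

end Split

/-! ### The rate obtained from the stability condition -/

theorem stability_bound_eq {N : ℕ} (hN : 2 ≤ N) {β : ℝ} (hβ : 0 < β) (B : ℝ) :
    (N : ℝ) * (2 * (16 * B ^ 2 * ((2 * Real.log N) ^ β *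
        (Real.log N ^ (-β) * (N : ℝ) ^ (-(1 / 2) : ℝ))) *
      (4 * Real.Gamma (β + 1) * (Real.log N ^ (-β) * (N : ℝ) ^ (-(1 / 2) : ℝ))) +
      4 * Real.exp (-((2 * Real.log N) ^ β * (Real.log N ^ (-β) * (N : ℝ) ^ (-(1 / 2) : ℝ)) /
        (Real.log N ^ (-β) * (N : ℝ) ^ (-(1 / 2) : ℝ))) ^ (1 / β)))) =
    128 * B ^ 2 * Real.Gamma (β + 1) * 2 ^ β * Real.log N ^ (-β) + 8 * (N : ℝ)⁻¹ := by
  have hN0 : (0 : ℝ) < N := by positivity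
  have hN1 : (1 : ℝ) < N := by exact_mod_cast hN
  have hl : 0 < Real.log N := Real.log_pos hN1
  set l := Real.log N with hldef
  have hκ : 0 < l ^ (-β) * (N : ℝ) ^ (-(1 / 2) : ℝ) := by positivity
  -- With ε = (2 log N)^β κ the exponent (ε/κ)^(1/β) is 2 log N, so each tail is N^(−2). The
  -- logarithms in ε cancel and leave 2^β N^(−1/2), so N·ε·κ keeps one factor log(N)^(−β).
  rw [mul_div_assoc, div_self hκ.ne', mul_one, ← Real.rpow_mul (by positivity),
    mul_one_div_cancel hβ.ne', Real.rpow_one, Real.mul_rpow (by norm_num) hl.le]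
  have h1 : (N : ℝ) ^ (-(1 / 2) : ℝ) * (N : ℝ) ^ (-(1 / 2) : ℝ) = (N : ℝ)⁻¹ := by
    rw [← Real.rpow_add hN0, ← Real.rpow_neg_one]
    norm_num
  have h2 : l ^ β * l ^ (-β) = 1 := by
    rw [← Real.rpow_add hl]
    simp
  have h3 : Real.exp (-(2 * l)) = (N : ℝ)⁻¹ * (N : ℝ)⁻¹ := by
    have : -(2 * l) = -l + -l := by ring
    rw [this, Real.exp_add, Real.exp_neg, hldef, Real.exp_log hN0]
  rw [h3]
  set a := (N : ℝ) ^ (-(1 / 2) : ℝ)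
  have h4 : (N : ℝ) * (a * a) = 1 := by rw [h1, mul_inv_cancel₀ hN0.ne']
  have h5 : (N : ℝ) * (N : ℝ)⁻¹ = 1 := mul_inv_cancel₀ hN0.ne'
  calc _ = 128 * B ^ 2 * Real.Gamma (β + 1) * 2 ^ β * l ^ (-β) * (l ^ β * l ^ (-β)) *
        (N * (a * a)) + 8 * (N : ℝ)⁻¹ * (N * (N : ℝ)⁻¹) := by ring
    _ = _ := by rw [h2, h4, h5]; ring

theorem tendsto_stability_bound {β : ℝ} (hβ : 0 < β) (C : ℝ) :
    Tendsto (fun N : ℕ => C * Real.log N ^ (-β) + 8 * (N : ℝ)⁻¹) atTop (𝓝 0) := by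
  have h1 : Tendsto (fun N : ℕ => Real.log N ^ (-β)) atTop (𝓝 0) :=
    (tendsto_rpow_neg_atTop hβ).comp (Real.tendsto_log_atTop.comp tendsto_natCast_atTop_atTop)
  have h2 : Tendsto (fun N : ℕ => (N : ℝ)⁻¹) atTop (𝓝 0) := tendsto_inv_atTop_nhds_zero_nat
  simpa using (h1.const_mul C).add (h2.const_mul 8)

theorem tendsto_pred_mul_atTop {K : ℕ} (hK : 2 ≤ K) :
    Tendsto (fun m : ℕ => (K - 1) * m) atTop atTop :=
  tendsto_id.const_mul_atTop' (by omega)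

/-! ### The exceptional events along the sequence of fold sizes -/

section Main

variable {𝒳 𝒴 : Type*} [MeasurableSpace 𝒳] [MeasurableSpace 𝒴]

theorem card_compl_foldSet {K m : ℕ} {fold : Fin (K * m) → Fin K} {k : Fin K}
    (h : (foldSet fold k).card = m) : (foldSet fold k)ᶜ.card = (K - 1) * m := by
  rw [Finset.card_compl, h, Fintype.card_fin, Nat.sub_mul, one_mul]

theorem tendsto_dataLaw_foldVar_eq_zero (PX : Measure 𝒳) [IsProbabilityMeasure PX]
    (η ηhat : Kernel 𝒳 𝒴) [IsMarkovKernel η] [IsMarkovKernel ηhat]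
    (A : DistinguisherProcedure 𝒳 𝒴) {K : ℕ} (hK : 2 ≤ K) (fold : (m : ℕ) → Fin (K * m) → Fin K)
    (hfold : ∀ m k, (foldSet (fold m) k).card = m)
    (hcross : CrossFitConditions PX η ηhat A K) (k : Fin K) :
    Tendsto (fun m => dataLaw PX η ηhat (K * m) {z | foldVar A (fold m) z k = 0}) atTop (𝓝 0) := by
  obtain ⟨B, hB, hdens⟩ := hcross.density
  obtain ⟨β, hβ, hstab⟩ := hcross.stability
  obtain ⟨c, hc, hvar⟩ := hcross.variance_lower
  have hN := tendsto_pred_mul_atTop hK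
  set e : ℕ → ℝ := fun N =>
    128 * B ^ 2 * Real.Gamma (β + 1) * 2 ^ β * Real.log N ^ (-β) + 8 * (N : ℝ)⁻¹ with he
  have hev : ∀ᶠ N : ℕ in atTop,
      ∫ s, ∫ d, (kernelProj (tripleLaw PX η ηhat) (rankKernel (A.fit N d)) s -
        ∫ d', kernelProj (tripleLaw PX η ηhat) (rankKernel (A.fit N d')) s
          ∂(dataLaw PX η ηhat N)) ^ 2 ∂(dataLaw PX η ηhat N) ∂(tripleLaw PX η ηhat) ≤ e N := by
    filter_upwards [hdens, hstab, eventually_ge_atTop 2] with N hd hs hN2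
    have hN1 : (1 : ℝ) < N := by exact_mod_cast hN2
    have hl : 0 < Real.log N := Real.log_pos hN1
    -- The truncation level is the largest scale of the perturbation up to tails of order N^(−2),
    -- which remain negligible after summation over N replacements.
    refine (integral_projection_fluctuation_le PX η ηhat A hB
      (κ := Real.log N ^ (-β) * (N : ℝ) ^ (-(1 / 2) : ℝ))
      (ε := (2 * Real.log N) ^ β * (Real.log N ^ (-β) * (N : ℝ) ^ (-(1 / 2) : ℝ)))
      (by positivity) hβ (by positivity) hd hs).trans ?_
    exact (stability_bound_eq hN2 hβ B).le
  have hlim : Tendsto (fun m : ℕ => ENNReal.ofReal (64 / c ^ 2 / (m : ℝ) +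
      8 / c * (2 * e ((K - 1) * m) + 20 / (m : ℝ)))) atTop (𝓝 0) := by
    have h1 : Tendsto (fun m : ℕ => 64 / c ^ 2 / (m : ℝ)) atTop (𝓝 0) :=
      tendsto_const_div_atTop_nhds_zero_nat _
    have h2 : Tendsto (fun m : ℕ => 20 / (m : ℝ)) atTop (𝓝 0) :=
      tendsto_const_div_atTop_nhds_zero_nat _
    have h3 : Tendsto (fun m : ℕ => e ((K - 1) * m)) atTop (𝓝 0) :=
      (tendsto_stability_bound hβ _).comp hN
    have := h1.add (((h3.const_mul 2).add h2).const_mul (8 / c))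
    simp only [mul_zero, add_zero] at this
    simpa using ENNReal.tendsto_ofReal this
  refine tendsto_of_tendsto_of_tendsto_of_le_of_le' tendsto_const_nhds hlim
    (Eventually.of_forall fun _ => zero_le) ?_
  filter_upwards [hN.eventually hev, hvar, eventually_ge_atTop 2] with m hem hvm hm2
  have hcard := hfold m k
  rw [← card_compl_foldSet hcard] at hem hvm
  have := dataLaw_foldVar_eq_zero_le PX η ηhat A (fold m) k (by omega) hc hvm hem
  rwa [hcard, card_compl_foldSet hcard] at this

theorem tendsto_dataLaw_foldStat_deviation (PX : Measure 𝒳) [IsProbabilityMeasure PX]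
    (η ηhat : Kernel 𝒳 𝒴) [IsMarkovKernel η] [IsMarkovKernel ηhat]
    (A : DistinguisherProcedure 𝒳 𝒴) {K : ℕ} (hK : 0 < K) (fold : (m : ℕ) → Fin (K * m) → Fin K)
    (hfold : ∀ m k, (foldSet (fold m) k).card = m) {a : ℕ → ℝ} (ha : Tendsto a atTop atTop)
    (k : Fin K) :
    Tendsto (fun m => dataLaw PX η ηhat (K * m) {z | (a m / √((K * m : ℕ) : ℝ)) ^ 2 ≤
      (foldStat A (fold m) z k - ∫ s, ∫ s', rankKernel (crossFit A (fold m) z k) s s'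
        ∂(tripleLaw PX η ηhat) ∂(tripleLaw PX η ηhat)) ^ 2}) atTop (𝓝 0) := by
  -- The mean square bound 3/m divided by the squared threshold a²/(Km).
  have hlim : Tendsto (fun m : ℕ => ENNReal.ofReal (3 * K * ((a m) ^ 2)⁻¹)) atTop (𝓝 0) := by
    have h1 : Tendsto (fun m => ((a m) ^ 2)⁻¹) atTop (𝓝 0) :=
      tendsto_inv_atTop_zero.comp ((tendsto_pow_atTop two_ne_zero).comp ha)
    have := h1.const_mul (3 * K : ℝ)
    rw [mul_zero] at this
    simpa using ENNReal.tendsto_ofReal this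
  refine tendsto_of_tendsto_of_tendsto_of_le_of_le' tendsto_const_nhds hlim
    (Eventually.of_forall fun _ => zero_le) ?_
  filter_upwards [ha.eventually_gt_atTop 0, eventually_gt_atTop 0] with m ham hm
  have hcard := hfold m k
  have hK' : (0 : ℝ) < K := by exact_mod_cast hK
  have hm' : (0 : ℝ) < m := by exact_mod_cast hm
  have hn : (0 : ℝ) < ((K * m : ℕ) : ℝ) := by push_cast; positivity
  have hsq := Real.sqrt_pos.2 hn
  refine (dataLaw_foldStat_deviation_le PX η ηhat A (fold m) k (by omega)
    (t := (a m / √((K * m : ℕ) : ℝ)) ^ 2) (by positivity)).trans ?_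
  refine ENNReal.ofReal_le_ofReal (le_of_eq ?_)
  rw [hcard, div_pow, Real.sq_sqrt hn.le]
  push_cast
  field_simp

end Main

end ClassifierTest

end

/-! ### Assembly by a union bound -/

theorem mainTheorem6 {𝒳 𝒴 : Type*} [MeasurableSpace 𝒳] [Finite 𝒴] [MeasurableSpace 𝒴]
    [MeasurableSingletonClass 𝒴]
    (PX : Measure 𝒳) [IsProbabilityMeasure PX]
    (η ηhat : Kernel 𝒳 𝒴) [IsMarkovKernel η] [IsMarkovKernel ηhat]
    (hac : ClassifierTest.jointLaw PX ηhat ≪ ClassifierTest.jointLaw PX η)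
    (A : ClassifierTest.DistinguisherProcedure 𝒳 𝒴)
    (K : ℕ) (hK : 2 ≤ K)
    (fold : (m : ℕ) → Fin (K * m) → Fin K)
    (hfold : ∀ m k, (ClassifierTest.foldSet (fold m) k).card = m)
    (hcross : ClassifierTest.CrossFitConditions PX η ηhat A K)
    (r δ : ℕ → ℝ) (hr : ∀ n, 0 ≤ r n)
    (hL1 : ∀ k : Fin K, Tendsto
      (fun m : ℕ => ClassifierTest.dataLaw PX η ηhat (K * m)
        {z | ENNReal.ofReal (r (K * m)) <
          eLpNorm (fun w => ClassifierTest.ratioTransform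
              (ClassifierTest.crossFit A (fold m) z k) w -
            ClassifierTest.likelihoodRatio η ηhat w) 1 (ClassifierTest.jointLaw PX η)})
      atTop (𝓝 0))
    (hδ : Tendsto
      (fun m : ℕ => √((K * m : ℕ) : ℝ) *
        (ClassifierTest.separation PX η ηhat - δ (K * m) - 2 * r (K * m)))
      atTop atTop) :
    (∀ M : ℝ, Tendsto
      (fun m : ℕ => ClassifierTest.dataLaw PX η ηhat (K * m)
        {z | M < ClassifierTest.standardizedStat A (fold m) (δ (K * m)) z})
      atTop (𝓝 1)) ∧
    (∀ α : ℝ, 0 < α → α < 1 → Tendsto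
      (fun m : ℕ => ClassifierTest.dataLaw PX η ηhat (K * m)
        {z | ClassifierTest.normalQuantile (1 - α) <
          ClassifierTest.standardizedStat A (fold m) (δ (K * m)) z})
      atTop (𝓝 1)) := by
  have hmain : ∀ M : ℝ, Tendsto
      (fun m : ℕ => ClassifierTest.dataLaw PX η ηhat (K * m)
        {z | M < ClassifierTest.standardizedStat A (fold m) (δ (K * m)) z})
      atTop (𝓝 1) := by
    intro M
    have hK0 : 0 < K := by omega
    let k₀ : Fin K := ⟨0, hK0⟩
    set a : ℕ → ℝ := fun m => √((K * m : ℕ) : ℝ) *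
      (ClassifierTest.separation PX η ηhat - δ (K * m) - 2 * r (K * m)) with ha_def
    -- Half of the margin is granted to the fluctuation of the fold statistics; the other half
    -- drives the divergence.
    have ha2 : Tendsto (fun m => a m / 2) atTop atTop := hδ.atTop_div_const (by norm_num)
    obtain ⟨B, hB, hdens⟩ := hcross.density
    have hdens' := (ClassifierTest.tendsto_pred_mul_atTop hK).eventually hdens
    have hdev := ClassifierTest.tendsto_dataLaw_foldStat_deviation PX η ηhat A hK0 fold hfold ha2
    have hzero := ClassifierTest.tendsto_dataLaw_foldVar_eq_zero PX η ηhat A hK fold hfold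
      hcross k₀
    have hbad := ((tendsto_finsetSum Finset.univ fun k _ => hL1 k).add
      (tendsto_finsetSum Finset.univ fun k _ => hdev k)).add hzero
    simp only [Finset.sum_const_zero, add_zero] at hbad
    have hlow := ENNReal.Tendsto.sub (tendsto_const_nhds (x := (1 : ENNReal))) hbad
      (Or.inl ENNReal.one_ne_top)
    rw [tsub_zero] at hlow
    refine tendsto_of_tendsto_of_tendsto_of_le_of_le' hlow tendsto_const_nhds ?_
      (Eventually.of_forall fun m => prob_le_one)
    -- The 8 is 2 for the halved margin times 4 for the bound on the estimated standard deviation.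
    -- The 0 is needed for negative `M`, since the margin must be positive in any case.
    filter_upwards [hdens', eventually_ge_atTop 2, hδ.eventually_gt_atTop (max 0 (8 * M))]
      with m hdm hm ham
    have ham0 : 0 < a m := (le_max_left _ _).trans_lt ham
    have hamM : 8 * M < a m := (le_max_right _ _).trans_lt ham
    have hn : 0 < K * m := by positivity
    have hsq : 0 < √((K * m : ℕ) : ℝ) := Real.sqrt_pos.2 (by exact_mod_cast hn)
    rw [tsub_le_iff_right]
    set E₁ : Fin K → Set (Fin (K * m) → ClassifierTest.Triple 𝒳 𝒴) := fun k =>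
      {z | ENNReal.ofReal (r (K * m)) < eLpNorm (fun w => ClassifierTest.ratioTransform
        (ClassifierTest.crossFit A (fold m) z k) w - ClassifierTest.likelihoodRatio η ηhat w) 1
        (ClassifierTest.jointLaw PX η)}
    set E₂ : Fin K → Set (Fin (K * m) → ClassifierTest.Triple 𝒳 𝒴) := fun k =>
      {z | (a m / 2 / √((K * m : ℕ) : ℝ)) ^ 2 ≤ (ClassifierTest.foldStat A (fold m) z k -
        ∫ s, ∫ s', ClassifierTest.rankKernel (ClassifierTest.crossFit A (fold m) z k) s s'
          ∂(ClassifierTest.tripleLaw PX η ηhat) ∂(ClassifierTest.tripleLaw PX η ηhat)) ^ 2}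
    set E₃ : Set (Fin (K * m) → ClassifierTest.Triple 𝒳 𝒴) :=
      {z | ClassifierTest.foldVar A (fold m) z k₀ = 0}
    set G : Set (Fin (K * m) → ClassifierTest.Triple 𝒳 𝒴) :=
      {z | M < ClassifierTest.standardizedStat A (fold m) (δ (K * m)) z}
    -- Covering the whole space and using subadditivity gives the lower bound on the probability of
    -- G without measurability of any of these events.
    have hcover : Set.univ ⊆ G ∪ (((⋃ k, E₁ k) ∪ ⋃ k, E₂ k) ∪ E₃) := by
      intro z _
      by_cases h3 : z ∈ E₃
      · exact Or.inr (Or.inr h3)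
      by_cases h1 : z ∈ ⋃ k, E₁ k
      · exact Or.inr (Or.inl (Or.inl h1))
      by_cases h2 : z ∈ ⋃ k, E₂ k
      · exact Or.inr (Or.inl (Or.inr h2))
      left
      rw [Set.mem_iUnion, not_exists] at h1 h2
      refine ClassifierTest.lt_standardizedStat hK0 (fun k => by rw [hfold]; exact hm)
        (a := a m / 2) hn (by linarith) (by linarith) (fun k => ?_) h3
      have h1k := h1 k
      have h2k := h2 k
      simp only [E₁, Set.mem_ofPred_eq, not_lt] at h1k
      simp only [E₂, Set.mem_ofPred_eq, not_le] at h2k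
      rw [← ClassifierTest.card_compl_foldSet (hfold m k)] at hdm
      have hfit := hdm (ClassifierTest.subsample z (ClassifierTest.foldSet (fold m) k)ᶜ)
      have hsep := ClassifierTest.separation_sub_le PX η ηhat hac
        (g := ClassifierTest.crossFit A (fold m) z k) (A.measurable_fit_apply _ _)
        (fun w => A.fit_mem _ _ w) hB hfit.1 hfit.2 (hr _) h1k
      have habs := neg_lt_of_abs_lt (abs_lt_of_sq_lt_sq h2k (by positivity))
      have haq : a m / √((K * m : ℕ) : ℝ) =
          ClassifierTest.separation PX η ηhat - δ (K * m) - 2 * r (K * m) := by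
        simp only [ha_def]
        field_simp
      have hhalf : a m / 2 / √((K * m : ℕ) : ℝ) = a m / √((K * m : ℕ) : ℝ) / 2 := by ring
      rw [hhalf] at habs ⊢
      -- The AUC deficit costs only one r; the second one in the margin is nonnegative and is
      -- discarded.
      have := hr (K * m)
      linarith
    calc (1 : ENNReal) = ClassifierTest.dataLaw PX η ηhat (K * m) Set.univ := measure_univ.symm
      _ ≤ _ := measure_mono hcover
      _ ≤ _ := measure_union_le _ _
      _ ≤ _ := by
        gcongr
        refine (measure_union_le _ _).trans ?_
        gcongr
        refine (measure_union_le _ _).trans ?_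
        gcongr
        · exact measure_iUnion_fintype_le _ _
        · exact measure_iUnion_fintype_le _ _
  -- For fixed α the normal quantile is just one particular threshold M.
  exact ⟨hmain, fun α _ _ => hmain _⟩
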